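/- A mixed graph $G=(V,E,A)$ consists of a finite vertex set $V$, a set $E$ of undirected edges $\{u,v\}$ and a set $A$ of directed arcs $(u,v)$. An instance of Steiner Orientation is a mixed graph $G=(V,E,A)$ together with a set $\mathcal{T}$ of terminal pairs $(s,t)\in V\times V$ with $s\neq t$; the question is whether the undirected edges in $E$ can be oriented in such a way that the resulting directed graph has a directed path from $s$ to $t$ for every $(s,t)\in\mathcal{T}$. Theorem. There is an algorithm that decides Steiner Orientation in time $2^{O(|A|)}\cdot n^{O(1)}$, where $n=|V|$ and $|A|$ is the number of directed arcs. That is, there are a single program $P$ for a random access machine (unit-cost addition and truncated subtraction of natural numbers, no multiplication) and constants $C,c,d$ such that, for every $n$ and every instance on the vertex set $\{0,\dots,n-1\}$, given by $n$ and the adjacency matrices of $E$, $A$ and $\mathcal{T}$, the program $P$ halts with the correct answer after at most $C\cdot 2^{c|A|}\cdot (n+1)^{d}$ steps. -/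

import Mathlib

/-! ## The problem: mixed graphs, orientations, Steiner Orientation -/

/-- A (finite) mixed graph `G = (V, E, A)`: a set `E` of undirected edges `{u, v}` and a set `A` of
directed arcs `(u, v)`. An edge and an arc, or two opposite arcs, may join the same two vertices.
Loops are not excluded: the loopless mixed graphs are a special case. -/
structure MixedGraph (V : Type*) where
  /-- the undirected edges -/
  E : Finset (Sym2 V)
  /-- the directed arcs -/
  A : Finset (V × V)

namespace MixedGraph

variable {V : Type*}

/-- `o` is an orientation of the undirected edges of `G`: it assigns to every edge `{u, v}` one of
the two ordered pairs `(u, v)`, `(v, u)`. (The values of `o` outside `G.E` are irrelevant.) -/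
def IsOrientation (G : MixedGraph V) (o : Sym2 V → V × V) : Prop :=
  ∀ e ∈ G.E, s((o e).1, (o e).2) = e

/-- The arc relation of the directed graph obtained from `G` by orienting its edges by `o`. -/
def OrientedArc (G : MixedGraph V) (o : Sym2 V → V × V) (u v : V) : Prop :=
  (u, v) ∈ G.A ∨ ∃ e ∈ G.E, o e = (u, v)

/-- There is a directed path from `s` to `t` in the directed graph obtained from `G` by orienting
its edges by `o`. -/
def HasDirectedPath (G : MixedGraph V) (o : Sym2 V → V × V) (s t : V) : Prop :=
  Relation.ReflTransGen (G.OrientedArc o) s t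

end MixedGraph

/-- An instance of Steiner Orientation: a mixed graph and a set of terminal pairs `(s, t)`
with `s ≠ t`. -/
structure SteinerInstance (V : Type*) extends MixedGraph V where
  /-- the terminal (demand) pairs -/
  terminals : Finset (V × V)
  /-- the two terminals of a pair are distinct -/
  source_ne_sink : ∀ p ∈ terminals, p.1 ≠ p.2

/-- `I` is a yes-instance: the undirected edges can be oriented in such a way that the resulting
directed graph has a directed path from `s` to `t` for every terminal pair `(s, t)`. -/
def SteinerInstance.IsYes {V : Type*} (I : SteinerInstance V) : Prop :=
  ∃ o : Sym2 V → V × V, I.toMixedGraph.IsOrientation o ∧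
    ∀ p ∈ I.terminals, I.toMixedGraph.HasDirectedPath o p.1 p.2

/-! ## The machine model: a random access machine with a step count

A program uses registers and random access memories (both numbered by `ℕ`; a fixed program mentions
only finitely many of them), whose cells hold natural numbers. The arithmetic operations are
addition and truncated subtraction, at unit cost. There is no multiplication: in `t` steps a
number gains at most `O(t)` bits, so that the model is polynomially equivalent to Turing machines. -/

namespace RAM

/-- A state of the machine: `reg x` is the content of register `x`, and `mem a i` is the content of
cell `i` of memory `a`. -/
structure State where
  /-- the registers -/
  reg : ℕ → ℕ
  /-- the memories -/
  mem : ℕ → ℕ → ℕ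

/-- Expressions: constants, registers, sums, truncated differences, and reading the cell of a fixed
memory at a computed address. -/
inductive Expr : Type
  | const (k : ℕ)
  | reg (x : ℕ)
  | add (e₁ e₂ : Expr)
  | sub (e₁ e₂ : Expr)
  | read (a : ℕ) (e : Expr)

/-- The value of an expression. -/
def Expr.eval (σ : State) : Expr → ℕ
  | .const k => k
  | .reg x => σ.reg x
  | .add e₁ e₂ => e₁.eval σ + e₂.eval σ
  | .sub e₁ e₂ => e₁.eval σ - e₂.eval σ
  | .read a e => σ.mem a (e.eval σ)

/-- The number of steps that the evaluation of an expression takes: one for each constant, register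
access, arithmetic operation and memory access. -/
def Expr.cost : Expr → ℕ
  | .const _ => 1
  | .reg _ => 1
  | .add e₁ e₂ => e₁.cost + e₂.cost + 1
  | .sub e₁ e₂ => e₁.cost + e₂.cost + 1
  | .read _ e => e.cost + 1

/-- Programs. -/
inductive Program : Type
  /-- do nothing -/
  | skip
  /-- write the value of `e` to register `x` -/
  | assign (x : ℕ) (e : Expr)
  /-- write the value of `e` to the cell of memory `a` whose address is the value of `i` -/
  | store (a : ℕ) (i e : Expr)
  /-- run `P`, then `Q` -/
  | seq (P Q : Program)
  /-- run `P` if the value of `e` is nonzero, and `Q` otherwise -/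
  | branch (e : Expr) (P Q : Program)
  /-- run `P` as long as the value of `e` is nonzero -/
  | loop (e : Expr) (P : Program)

/-- `Runs P σ t τ`: the program `P`, started in the state `σ`, halts after exactly `t` steps, in the
state `τ`. -/
inductive Runs : Program → State → ℕ → State → Prop
  | skip (σ : State) : Runs .skip σ 1 σ
  | assign (x : ℕ) (e : Expr) (σ : State) :
      Runs (.assign x e) σ (e.cost + 1)
        { reg := Function.update σ.reg x (e.eval σ), mem := σ.mem }
  | store (a : ℕ) (i e : Expr) (σ : State) :
      Runs (.store a i e) σ (i.cost + e.cost + 1)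
        { reg := σ.reg
          mem := Function.update σ.mem a (Function.update (σ.mem a) (i.eval σ) (e.eval σ)) }
  | seq {P Q : Program} {σ τ υ : State} {t₁ t₂ : ℕ} (hP : Runs P σ t₁ τ) (hQ : Runs Q τ t₂ υ) :
      Runs (.seq P Q) σ (t₁ + t₂) υ
  | branch_true {e : Expr} {P Q : Program} {σ τ : State} {t : ℕ} (he : e.eval σ ≠ 0)
      (hP : Runs P σ t τ) : Runs (.branch e P Q) σ (e.cost + 1 + t) τ
  | branch_false {e : Expr} {P Q : Program} {σ τ : State} {t : ℕ} (he : e.eval σ = 0)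
      (hQ : Runs Q σ t τ) : Runs (.branch e P Q) σ (e.cost + 1 + t) τ
  | loop_true {e : Expr} {P : Program} {σ τ υ : State} {t₁ t₂ : ℕ} (he : e.eval σ ≠ 0)
      (hP : Runs P σ t₁ τ) (hloop : Runs (.loop e P) τ t₂ υ) :
      Runs (.loop e P) σ (e.cost + 1 + t₁ + t₂) υ
  | loop_false {e : Expr} {P : Program} {σ : State} (he : e.eval σ = 0) :
      Runs (.loop e P) σ (e.cost + 1) σ

/-- The `n × n` 0/1-matrix of a set of ordered pairs, stored row by row: cell `u * n + v` holds `1`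
if `(u, v) ∈ S`, and all other cells hold `0`. -/
def adjacency {n : ℕ} (S : Finset (Fin n × Fin n)) (i : ℕ) : ℕ :=
  if ∃ p ∈ S, i = (p.1 : ℕ) * n + (p.2 : ℕ) then 1 else 0

/-- The initial state that presents an instance on the vertices `0, …, n - 1` to a program: register
`0` holds `n`, and the memories `0`, `1` and `2` hold the adjacency matrices of the undirected edges,
of the arcs and of the terminal pairs. Everything else is `0`. -/
def input {n : ℕ} (I : SteinerInstance (Fin n)) : State where
  reg := fun x => if x = 0 then n else 0
  mem := fun a =>
    if a = 0 then adjacency (Finset.univ.filter fun p : Fin n × Fin n => s(p.1, p.2) ∈ I.E)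
    else if a = 1 then adjacency I.A
    else if a = 2 then adjacency I.terminals
    else fun _ => 0

/-- The program `P` answers the instance `I` correctly within `T` steps: it halts after at most `T`
steps, with `1` in register `0` if `I` is a yes-instance and with `0` there if it is not. -/
def SolvesWithin (P : Program) {n : ℕ} (I : SteinerInstance (Fin n)) (T : ℕ) : Prop :=
  ∃ (t : ℕ) (τ : State), Runs P (input I) t τ ∧ t ≤ T ∧
    (I.IsYes → τ.reg 0 = 1) ∧ (¬ I.IsYes → τ.reg 0 = 0)

end RAM

/-!
The proof has a graph part and a machine part.

**Graph part.** Call an edge a *bridge* if it lies on no mixed cycle. The other edges may be taken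
to be usable in both directions: as long as such an edge is used in both directions, one of the
directions can be given up by turning all edges of a cycle through it the same way around, which preserves
reachability and makes no other edge usable in both directions (`MixedRel.exists_reorientation`,
`MixedRel.IsOri.exists_orientation`). So only the bridges have to be oriented. They are cut edges
of the components of `(V, E)`, hence a route between two vertices of the same component exists if
and only if the bridges between them all point the right way (`MixedRel.IsOri.of_dir`,
`MixedRel.reach_of_dir`).

A route of a terminal pair `(s, t)` between different components runs from `s` to an end `p` of an
arc, then from end to end, and finally from an end `q` to `t`. Two bridges are *parallel* if they
split the ends of arcs in their component in the same way. Directed edges that separate two ends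
fall into at most `8 * |A|` parallel classes, because the sides that avoid a root of the
component form a laminar family of sets of ends (`card_le_of_laminar`, `MixedRel.ncard_rep_le`). Guess for each class whether all of its
members point in its direction. Given the guess, it is known how one can get from end to end. The
bridges that remain to be oriented for a pair `(s, t)` are those from `s` to `p` and those from
`q` to `t`, where `(p, q)` ranges over the options that the guess leaves. The crux is that both
sets take at most two values (`MixedRel.Feas.two_values`), so that the requirement that some
option be realized is equivalent to the conjunction of the 2-clauses that it implies
(`exists_two_clause`). The guess is therefore tested by 2-satisfiability
(`exists_consistent_closed`), and the instance is a yes-instance if and only if some guess passes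
(`SteinerInstance.isYes_iff_exists_accepts`).

**Machine part.** The test can be written with first-order formulas and least fixed points over
the vertices. Formulas and inductive definitions are evaluated by programs in polynomial time
(`RAM.exists_program_formula`, `RAM.exists_program_definitions`), where the only multiplications
needed, those by `n` in computing addresses, are looked up in a table. A binary counter runs
through the at most `2 ^ (8 * |A|)` guesses (`RAM.exists_program_search`).
-/

/-! ### Bounding the running time of programs -/

namespace RAM

/-- The function `f` grows at most polynomially. -/
def PolyBounded (f : ℕ → ℕ) : Prop :=
  ∃ C d : ℕ, ∀ n, f n ≤ C * (n + 1) ^ d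

namespace PolyBounded

theorem const (c : ℕ) : PolyBounded fun _ => c := ⟨c, 0, fun n => by simp⟩

theorem id : PolyBounded fun n => n := ⟨1, 1, fun n => by simp⟩

theorem add {f g : ℕ → ℕ} (hf : PolyBounded f) (hg : PolyBounded g) :
    PolyBounded fun n => f n + g n := by
  obtain ⟨C, d, hC⟩ := hf
  obtain ⟨C', d', hC'⟩ := hg
  refine ⟨C + C', d + d', fun n => ?_⟩
  have h1 : (n + 1) ^ d ≤ (n + 1) ^ (d + d') := Nat.pow_le_pow_right (by omega) (by omega)
  have h2 : (n + 1) ^ d' ≤ (n + 1) ^ (d + d') := Nat.pow_le_pow_right (by omega) (by omega)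
  calc f n + g n ≤ C * (n + 1) ^ d + C' * (n + 1) ^ d' := Nat.add_le_add (hC n) (hC' n)
    _ ≤ C * (n + 1) ^ (d + d') + C' * (n + 1) ^ (d + d') := by gcongr
    _ = _ := by ring

theorem mul {f g : ℕ → ℕ} (hf : PolyBounded f) (hg : PolyBounded g) :
    PolyBounded fun n => f n * g n := by
  obtain ⟨C, d, hC⟩ := hf
  obtain ⟨C', d', hC'⟩ := hg
  refine ⟨C * C', d + d', fun n => ?_⟩
  calc f n * g n ≤ (C * (n + 1) ^ d) * (C' * (n + 1) ^ d') := Nat.mul_le_mul (hC n) (hC' n)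
    _ = _ := by ring

/-- The time of a `forLoop` whose body takes time `f`. -/
theorem loop {f : ℕ → ℕ} (hf : PolyBounded f) : PolyBounded fun n => n * (f n + 8) + 6 :=
  (id.mul (hf.add (const 8))).add (const 6)

end PolyBounded

/-- The state `σ` with the content of register `x` replaced by `v`. -/
def setReg (σ : State) (x v : ℕ) : State :=
  { reg := Function.update σ.reg x v, mem := σ.mem }

/-- The state `σ` with the content of cell `i` of memory `a` replaced by `v`. -/
def setMem (σ : State) (a i v : ℕ) : State :=
  { reg := σ.reg, mem := Function.update σ.mem a (Function.update (σ.mem a) i v) }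

@[simp] theorem setReg_mem (σ : State) (x v : ℕ) : (setReg σ x v).mem = σ.mem := rfl

@[simp] theorem setReg_reg_self (σ : State) (x v : ℕ) : (setReg σ x v).reg x = v := by
  simp [setReg]

theorem setReg_reg_of_ne (σ : State) {x y : ℕ} (v : ℕ) (h : y ≠ x) :
    (setReg σ x v).reg y = σ.reg y := by
  simp [setReg, h]

@[simp] theorem setMem_reg (σ : State) (a i v : ℕ) : (setMem σ a i v).reg = σ.reg := rfl

/-- Total correctness with a time bound: `P`, started in `σ`, halts within `T` steps in a state
that satisfies `post`. -/
def Terminates (P : Program) (σ : State) (T : ℕ) (post : State → Prop) : Prop :=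
  ∃ t τ, Runs P σ t τ ∧ t ≤ T ∧ post τ

namespace Terminates

variable {P Q : Program} {σ : State} {T T' : ℕ} {post post' : State → Prop}

theorem mono (h : Terminates P σ T post) (hT : T ≤ T') (hp : ∀ τ, post τ → post' τ) :
    Terminates P σ T' post' := by
  obtain ⟨t, τ, hr, ht, hτ⟩ := h
  exact ⟨t, τ, hr, ht.trans hT, hp τ hτ⟩

theorem skip (h : post σ) : Terminates .skip σ 1 post := ⟨1, σ, .skip σ, le_rfl, h⟩

theorem assign {x : ℕ} {e : Expr} (h : post (setReg σ x (e.eval σ))) :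
    Terminates (.assign x e) σ (e.cost + 1) post :=
  ⟨_, _, .assign x e σ, le_rfl, h⟩

theorem store {a : ℕ} {i e : Expr} (h : post (setMem σ a (i.eval σ) (e.eval σ))) :
    Terminates (.store a i e) σ (i.cost + e.cost + 1) post :=
  ⟨_, _, .store a i e σ, le_rfl, h⟩

theorem seq (h : Terminates P σ T post) (h' : ∀ τ, post τ → Terminates Q τ T' post') :
    Terminates (.seq P Q) σ (T + T') post' := by
  obtain ⟨t, τ, hr, ht, hτ⟩ := h
  obtain ⟨t', υ, hr', ht', hυ⟩ := h' τ hτ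
  exact ⟨_, υ, .seq hr hr', by omega, hυ⟩

theorem branch {e : Expr} (h : e.eval σ ≠ 0 → Terminates P σ T post)
    (h' : e.eval σ = 0 → Terminates Q σ T' post) :
    Terminates (.branch e P Q) σ (e.cost + 1 + (T + T')) post := by
  by_cases he : e.eval σ = 0
  · obtain ⟨t, τ, hr, ht, hτ⟩ := h' he
    exact ⟨_, τ, .branch_false he hr, by omega, hτ⟩
  · obtain ⟨t, τ, hr, ht, hτ⟩ := h he
    exact ⟨_, τ, .branch_true he hr, by omega, hτ⟩

theorem loop_false {e : Expr} (he : e.eval σ = 0) (h : post σ) :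
    Terminates (.loop e P) σ (e.cost + 1) post :=
  ⟨_, σ, .loop_false he, le_rfl, h⟩

theorem loop_true {e : Expr} (he : e.eval σ ≠ 0) (h : Terminates P σ T post)
    (h' : ∀ τ, post τ → Terminates (.loop e P) τ T' post') :
    Terminates (.loop e P) σ (e.cost + 1 + T + T') post' := by
  obtain ⟨t, τ, hr, ht, hτ⟩ := h
  obtain ⟨t', υ, hr', ht', hυ⟩ := h' τ hτ
  exact ⟨_, υ, .loop_true he hr hr', by omega, hυ⟩

end Terminates

/-- Run `body` with register `x` running from `0` to `n - 1`, where `n` is the content of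
register `0`. -/
def forLoop (x : ℕ) (body : Program) : Program :=
  .seq (.assign x (.const 0))
    (.loop (.sub (.reg 0) (.reg x)) (.seq body (.assign x (.add (.reg x) (.const 1)))))

/-- The invariant rule for `forLoop`. -/
theorem Terminates.forLoop {x : ℕ} {body : Program} {n T : ℕ} {Inv : ℕ → State → Prop} {σ : State}
    (hx : x ≠ 0) (hn : σ.reg 0 = n) (h0 : Inv 0 (setReg σ x 0))
    (hbody : ∀ i < n, ∀ τ : State, τ.reg 0 = n → τ.reg x = i → Inv i τ →
      Terminates body τ T fun υ => υ.reg 0 = n ∧ υ.reg x = i ∧ Inv (i + 1) (setReg υ x (i + 1))) :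
    Terminates (forLoop x body) σ (n * (T + 8) + 6) fun τ => τ.reg 0 = n ∧ Inv n τ := by
  have key : ∀ k i, i + k = n → ∀ τ : State, τ.reg 0 = n → τ.reg x = i → Inv i τ →
      Terminates (.loop (.sub (.reg 0) (.reg x))
        (.seq body (.assign x (.add (.reg x) (.const 1))))) τ (k * (T + 8) + 4)
        fun τ => τ.reg 0 = n ∧ Inv n τ := by
    intro k
    induction k with
    | zero =>
      intro i hi τ h0 hxi hI
      refine (Terminates.loop_false (by simp [Expr.eval]; omega) ⟨h0, ?_⟩).mono
        (by simp [Expr.cost]) fun _ h => h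
      obtain rfl : i = n := by omega
      exact hI
    | succ k ih =>
      intro i hi τ h0 hxi hI
      refine (Terminates.loop_true (T := T + 4) (T' := k * (T + 8) + 4)
        (by simp [Expr.eval]; omega) (.seq (hbody i (by omega) τ h0 hxi hI) fun υ hυ =>
        .assign (post := fun υ => υ.reg 0 = n ∧ υ.reg x = i + 1 ∧ Inv (i + 1) υ) ?_)
        fun υ hυ => ?_).mono (by simp only [Expr.cost]; nlinarith) fun _ h => h
      · obtain ⟨hυ0, hυx, hυ⟩ := hυ
        simp only [Expr.eval, hυx]
        exact ⟨by rw [setReg_reg_of_ne _ _ hx.symm, hυ0], by simp, hυ⟩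
      · exact ih (i + 1) (by omega) υ hυ.1 hυ.2.1 hυ.2.2
  refine (Terminates.seq (T := 2) (T' := n * (T + 8) + 4)
    (.assign (post := fun τ => τ = setReg σ x 0) rfl) ?_).mono (by omega) fun _ h => h
  rintro _ rfl
  exact key n 0 (by omega) _ (by rw [setReg_reg_of_ne _ _ hx.symm, hn]) (by simp) h0

/-! ### First-order formulas and their evaluation -/

/-- The address of the tuple `xs` of numbers below `n` in a memory that stores a relation: the
number with the digits `xs` in base `n`, most significant digit first. -/
def addr (n : ℕ) (xs : List ℕ) : ℕ := xs.foldl (fun a x => a * n + x) 0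

theorem addr_concat (n : ℕ) (xs : List ℕ) (x : ℕ) : addr n (xs ++ [x]) = addr n xs * n + x := by
  simp [addr]

theorem addr_lt {n : ℕ} (xs : List ℕ) (h : ∀ x ∈ xs, x < n) : addr n xs < n ^ xs.length := by
  induction xs using List.reverseRecOn with
  | nil => simp [addr]
  | append_singleton xs x ih =>
    have h1 := ih fun y hy => h y (by simp [hy])
    have h2 := h x (by simp)
    rw [addr_concat, List.length_append, List.length_singleton, pow_succ]
    nlinarith

theorem addr_injective {n : ℕ} {xs ys : List ℕ} (hl : xs.length = ys.length)
    (hx : ∀ x ∈ xs, x < n) (hy : ∀ y ∈ ys, y < n) (h : addr n xs = addr n ys) : xs = ys := by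
  induction xs using List.reverseRecOn generalizing ys with
  | nil => exact (List.length_eq_zero_iff.1 hl.symm).symm
  | append_singleton xs x ih =>
    obtain rfl | ⟨ys, y, rfl⟩ := ys.eq_nil_or_concat'
    · simp at hl
    have h1 := hx x (by simp)
    have h2 := hy y (by simp)
    rw [addr_concat, addr_concat] at h
    have h3 : x = y := by
      have := congrArg (· % n) h
      simpa [Nat.mul_add_mod', Nat.mod_eq_of_lt h1, Nat.mod_eq_of_lt h2] using this
    subst h3
    have h4 : addr n xs = addr n ys :=
      Nat.eq_of_mul_eq_mul_right (by omega : 0 < n) (by omega)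
    rw [ih (by simpa using hl) (fun z hz => hx z (by simp [hz])) (fun z hz => hy z (by simp [hz]))
      h4]

/-- First-order formulas over the numbers below `n`, with variables and relation symbols numbered
by `ℕ`. The relation symbol `r` stands for the relation stored in memory `r`. -/
inductive Formula : Type
  | rel (r : ℕ) (xs : List ℕ)
  | eq (x y : ℕ)
  | lt (x y : ℕ)
  | neg (φ : Formula)
  | and (φ ψ : Formula)
  | ex (x : ℕ) (φ : Formula)

namespace Formula

/-- The truth value of a formula in the memory content `m` under the assignment `v`. -/
def Sat (n : ℕ) (m : ℕ → ℕ → ℕ) : (ℕ → ℕ) → Formula → Prop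
  | v, .rel r xs => m r (addr n (xs.map v)) ≠ 0
  | v, .eq x y => v x = v y
  | v, .lt x y => v x < v y
  | v, .neg φ => ¬ Sat n m v φ
  | v, .and φ ψ => Sat n m v φ ∧ Sat n m v ψ
  | v, .ex x φ => ∃ a : Fin n, Sat n m (Function.update v x a) φ

/-- Disjunction. -/
def or (φ ψ : Formula) : Formula := .neg (.and (.neg φ) (.neg ψ))

/-- Implication. -/
def imp (φ ψ : Formula) : Formula := .neg (.and φ (.neg ψ))

/-- Universal quantification. -/
def all (x : ℕ) (φ : Formula) : Formula := .neg (.ex x (.neg φ))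

/-- Scoping: the free variables of the formula lie below `k`, a quantifier binds the least variable
that is not yet in scope, relation symbols lie below `R`, and arities are at most `4`. -/
def WF (R : ℕ) : ℕ → Formula → Bool
  | k, .rel r xs => decide (r < R) && decide (xs.length ≤ 4) && xs.all fun x => decide (x < k)
  | k, .eq x y => decide (x < k) && decide (y < k)
  | k, .lt x y => decide (x < k) && decide (y < k)
  | k, .neg φ => WF R k φ
  | k, .and φ ψ => WF R k φ && WF R k ψ
  | k, .ex x φ => decide (x = k) && WF R (k + 1) φ

section Sat

variable (n : ℕ) (m : ℕ → ℕ → ℕ) (v : ℕ → ℕ) (φ ψ : Formula)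

theorem sat_rel (r : ℕ) (xs : List ℕ) :
    (Formula.rel r xs).Sat n m v ↔ m r (addr n (xs.map v)) ≠ 0 := Iff.rfl

theorem sat_eq (x y : ℕ) : (Formula.eq x y).Sat n m v ↔ v x = v y := Iff.rfl

theorem sat_lt (x y : ℕ) : (Formula.lt x y).Sat n m v ↔ v x < v y := Iff.rfl

theorem sat_neg : (Formula.neg φ).Sat n m v ↔ ¬ φ.Sat n m v := Iff.rfl

theorem sat_and : (Formula.and φ ψ).Sat n m v ↔ φ.Sat n m v ∧ ψ.Sat n m v := Iff.rfl

theorem sat_ex (x : ℕ) :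
    (Formula.ex x φ).Sat n m v ↔ ∃ a : Fin n, φ.Sat n m (Function.update v x a) := Iff.rfl

theorem sat_or : (φ.or ψ).Sat n m v ↔ φ.Sat n m v ∨ ψ.Sat n m v := by
  simp only [Formula.or, sat_neg, sat_and]; tauto

theorem sat_imp : (φ.imp ψ).Sat n m v ↔ (φ.Sat n m v → ψ.Sat n m v) := by
  simp only [Formula.imp, sat_neg, sat_and]; tauto

theorem sat_all (x : ℕ) :
    (Formula.all x φ).Sat n m v ↔ ∀ a : Fin n, φ.Sat n m (Function.update v x a) := by
  simp only [Formula.all, sat_neg, sat_ex, not_exists, not_not]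

end Sat

/-- The truth value of a formula depends only on the relations and the variables that it may
mention. -/
theorem sat_congr {n : ℕ} {m m' : ℕ → ℕ → ℕ} {R : ℕ} (hm : ∀ r < R, m r = m' r) (φ : Formula) :
    ∀ {k : ℕ} {v v' : ℕ → ℕ}, φ.WF R k = true → (∀ i < k, v i = v' i) →
      (φ.Sat n m v ↔ φ.Sat n m' v') := by
  induction φ with
  | rel r xs =>
    intro k v v' h hv
    simp only [WF, Bool.and_eq_true, decide_eq_true_eq, List.all_eq_true] at h
    have : xs.map v = xs.map v' := List.map_congr_left fun x hx => hv x (h.2 x hx)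
    rw [sat_rel, sat_rel, this, hm r h.1.1]
  | eq x y =>
    intro k v v' h hv
    simp only [WF, Bool.and_eq_true, decide_eq_true_eq] at h
    rw [sat_eq, sat_eq, hv x h.1, hv y h.2]
  | lt x y =>
    intro k v v' h hv
    simp only [WF, Bool.and_eq_true, decide_eq_true_eq] at h
    rw [sat_lt, sat_lt, hv x h.1, hv y h.2]
  | neg φ ih =>
    intro k v v' h hv
    rw [sat_neg, sat_neg, ih h hv]
  | and φ ψ ih ih' =>
    intro k v v' h hv
    simp only [WF, Bool.and_eq_true] at h
    rw [sat_and, sat_and, ih h.1 hv, ih' h.2 hv]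
  | ex x φ ih =>
    intro k v v' h hv
    simp only [WF, Bool.and_eq_true, decide_eq_true_eq] at h
    obtain ⟨rfl, h⟩ := h
    rw [sat_ex, sat_ex]
    refine exists_congr fun a => ih h fun i hi => ?_
    rcases eq_or_ne i x with rfl | hne
    · simp
    · simp [hne, hv i (by omega)]

end Formula

/-- The assignment of the variables in the state `σ`: variable `i` lives in register `i + 8`. -/
def vars (σ : State) (i : ℕ) : ℕ := σ.reg (i + 8)

/-- Register `0` holds `n`, and memory `3` holds a multiplication table by `n` which is long enough
to compute the addresses of tuples of length at most `4`. -/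
structure Ready (n : ℕ) (σ : State) : Prop where
  reg : σ.reg 0 = n
  table : ∀ i < n ^ 3, σ.mem 3 i = i * n

theorem Ready.congr {n : ℕ} {σ τ : State} (h : Ready n σ) (h0 : τ.reg 0 = σ.reg 0)
    (h3 : τ.mem 3 = σ.mem 3) : Ready n τ :=
  ⟨h0.trans h.reg, by rw [h3]; exact h.table⟩

/-- The expression that computes the address of a tuple of variables. -/
def addrExpr (xs : List ℕ) : Expr :=
  xs.foldl (fun e x => .add (.read 3 e) (.reg (x + 8))) (.const 0)

theorem addrExpr_eval {n : ℕ} {σ : State} (hσ : Ready n σ) (xs : List ℕ) (hl : xs.length ≤ 4)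
    (hx : ∀ x ∈ xs, vars σ x < n) : (addrExpr xs).eval σ = addr n (xs.map (vars σ)) := by
  induction xs using List.reverseRecOn with
  | nil => rfl
  | append_singleton xs x ih =>
    rw [List.length_append, List.length_singleton] at hl
    have hn : 0 < n := lt_of_le_of_lt (Nat.zero_le _) (hx x (by simp))
    have ih := ih (by omega) fun y hy => hx y (by simp [hy])
    have hlt : addr n (xs.map (vars σ)) < n ^ 3 := by
      refine lt_of_lt_of_le (addr_lt _ ?_) (Nat.pow_le_pow_right hn ?_)
      · intro y hy
        obtain ⟨z, hz, rfl⟩ := List.mem_map.1 hy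
        exact hx z (by simp [hz])
      · simp; omega
    have : addrExpr (xs ++ [x]) = .add (.read 3 (addrExpr xs)) (.reg (x + 8)) := by simp [addrExpr]
    rw [this, List.map_append, List.map_singleton, addr_concat]
    simp only [Expr.eval]
    rw [ih, hσ.table _ hlt]
    rfl

open Classical in
/-- A formula can be evaluated in polynomial time. The program leaves the truth value in register
`1`, and changes only register `1` and the registers of variables that are not in scope. -/
theorem exists_program_formula {R : ℕ} (φ : Formula) :
    ∀ {k : ℕ}, φ.WF R k = true → ∃ (P : Program) (T : ℕ → ℕ), PolyBounded T ∧
      ∀ (n : ℕ) (σ : State), Ready n σ → (∀ i < k, vars σ i < n) →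
        Terminates P σ (T n) fun τ => τ.mem = σ.mem ∧ (∀ i < k + 8, i ≠ 1 → τ.reg i = σ.reg i) ∧
          τ.reg 1 = if φ.Sat n σ.mem (vars σ) then 1 else 0 := by
  -- an atomic formula is the test of an expression
  have atom : ∀ (k : ℕ) (e : Expr) (p : ℕ → State → Prop), (∀ n σ, Ready n σ →
      (∀ i < k, vars σ i < n) → (e.eval σ ≠ 0 ↔ p n σ)) → ∃ (P : Program) (T : ℕ → ℕ),
      PolyBounded T ∧ ∀ (n : ℕ) (σ : State), Ready n σ → (∀ i < k, vars σ i < n) →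
        Terminates P σ (T n) fun τ => τ.mem = σ.mem ∧ (∀ i < k + 8, i ≠ 1 → τ.reg i = σ.reg i) ∧
          τ.reg 1 = if p n σ then 1 else 0 := by
    intro k e p h
    refine ⟨.branch e (.assign 1 (.const 1)) (.assign 1 (.const 0)),
      fun _ => e.cost + 1 + (2 + 2), .const _, fun n σ hσ hv => ?_⟩
    refine Terminates.branch (fun he => .assign ⟨rfl, ?_, ?_⟩) (fun he => .assign ⟨rfl, ?_, ?_⟩)
    · exact fun i _ hi => setReg_reg_of_ne _ _ hi
    · rw [if_pos ((h n σ hσ hv).1 he)]; simp [Expr.eval]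
    · exact fun i _ hi => setReg_reg_of_ne _ _ hi
    · rw [if_neg fun hp => (h n σ hσ hv).2 hp he]; simp [Expr.eval]
  induction φ with
  | rel r xs =>
    intro k h
    simp only [Formula.WF, Bool.and_eq_true, decide_eq_true_eq, List.all_eq_true] at h
    refine atom k (.read r (addrExpr xs)) _ fun n σ hσ hv => ?_
    rw [Formula.sat_rel, Expr.eval, addrExpr_eval hσ xs h.1.2 fun x hx => hv x (h.2 x hx)]
  | eq x y =>
    intro k h
    obtain ⟨P, T, hT, hP⟩ := atom k (.sub (.const 1) (.add (.sub (.reg (x + 8)) (.reg (y + 8)))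
      (.sub (.reg (y + 8)) (.reg (x + 8))))) (fun n σ => vars σ x = vars σ y) fun n σ hσ hv => by
        simp only [Expr.eval, vars]; omega
    exact ⟨P, T, hT, hP⟩
  | lt x y =>
    intro k h
    obtain ⟨P, T, hT, hP⟩ := atom k (.sub (.reg (y + 8)) (.reg (x + 8)))
      (fun n σ => vars σ x < vars σ y) fun n σ hσ hv => by
        simp only [Expr.eval, vars]; omega
    exact ⟨P, T, hT, hP⟩
  | neg φ ih =>
    intro k h
    obtain ⟨P, T, hT, hP⟩ := ih (k := k) h
    refine ⟨.seq P (.assign 1 (.sub (.const 1) (.reg 1))), fun n => T n + 4, hT.add (.const 4),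
      fun n σ hσ hv => ?_⟩
    refine (hP n σ hσ hv).seq fun τ ⟨hm, hr, h1⟩ => .assign ⟨hm, fun i hi hi1 => ?_, ?_⟩
    · rw [setReg_reg_of_ne _ _ hi1, hr i hi hi1]
    · rw [Formula.sat_neg, setReg_reg_self, Expr.eval, Expr.eval, Expr.eval, h1]
      by_cases hs : φ.Sat n σ.mem (vars σ) <;> simp [hs]
  | and φ ψ ih ih' =>
    intro k h
    simp only [Formula.WF, Bool.and_eq_true] at h
    obtain ⟨P, T, hT, hP⟩ := ih (k := k) h.1
    obtain ⟨P', T', hT', hP'⟩ := ih' (k := k) h.2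
    refine ⟨.seq P (.branch (.reg 1) P' .skip), fun n => T n + (2 + (T' n + 1)),
      hT.add ((PolyBounded.const 2).add (hT'.add (.const 1))), fun n σ hσ hv => ?_⟩
    refine (hP n σ hσ hv).seq fun τ ⟨hm, hr, h1⟩ => ?_
    have hvar : ∀ i < k, vars τ i = vars σ i := fun i hi => hr _ (by omega) (by omega)
    refine Terminates.branch (e := .reg 1) (fun he => ?_) fun he => .skip ?_
    · have hφ : φ.Sat n σ.mem (vars σ) := by
        by_contra hφ
        exact he (by simp [Expr.eval, h1, hφ])
      refine (hP' n τ (hσ.congr (hr 0 (by omega) (by omega)) (by rw [hm]))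
        fun i hi => by rw [hvar i hi]; exact hv i hi).mono le_rfl fun υ ⟨hm', hr', h1'⟩ =>
        ⟨hm'.trans hm, fun i hi hi1 => (hr' i hi hi1).trans (hr i hi hi1), ?_⟩
      rw [h1', hm, Formula.sat_and, Formula.sat_congr (fun _ _ => rfl) ψ h.2 hvar]
      simp [hφ]
    · have hφ : ¬ φ.Sat n σ.mem (vars σ) := by
        intro hφ
        simp [Expr.eval, h1, hφ] at he
      refine ⟨hm, hr, ?_⟩
      rw [h1, Formula.sat_and]
      simp [hφ]
  | ex x φ ih =>
    intro k h
    simp only [Formula.WF, Bool.and_eq_true, decide_eq_true_eq] at h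
    obtain ⟨rfl, h⟩ := h
    obtain ⟨P, T, hT, hP⟩ := ih (k := x + 1) h
    -- the search stops at a witness, by setting the loop variable to `n`
    refine ⟨.seq (.assign 1 (.const 0)) (.seq (.assign (x + 8) (.const 0))
      (.loop (.sub (.reg 0) (.reg (x + 8))) (.seq P (.branch (.reg 1)
        (.assign (x + 8) (.reg 0)) (.assign (x + 8) (.add (.reg (x + 8)) (.const 1))))))),
      fun n => 2 + (2 + (n * (T n + 12) + 4)), ?_, fun n σ hσ hv => ?_⟩
    · exact (PolyBounded.const 2).add ((PolyBounded.const 2).add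
        ((PolyBounded.id.mul (hT.add (.const 12))).add (.const 4)))
    have key : ∀ d i, i + d = n → ∀ τ : State, τ.mem = σ.mem →
        (∀ j < x + 8, j ≠ 1 → τ.reg j = σ.reg j) → τ.reg (x + 8) = i → τ.reg 1 = 0 →
        (∀ a : Fin n, (a : ℕ) < i → ¬ φ.Sat n σ.mem (Function.update (vars σ) x a)) →
        Terminates (.loop (.sub (.reg 0) (.reg (x + 8))) (.seq P (.branch (.reg 1)
          (.assign (x + 8) (.reg 0)) (.assign (x + 8) (.add (.reg (x + 8)) (.const 1)))))) τ
          (d * (T n + 12) + 4) fun τ => τ.mem = σ.mem ∧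
            (∀ i < x + 8, i ≠ 1 → τ.reg i = σ.reg i) ∧
            τ.reg 1 = if (Formula.ex x φ).Sat n σ.mem (vars σ) then 1 else 0 := by
      intro d
      induction d with
      | zero =>
        intro i hi τ hm hr hx h1 hno
        refine (Terminates.loop_false ?_ ⟨hm, hr, ?_⟩).mono (by simp [Expr.cost]) fun _ h => h
        · simp only [Expr.eval]
          rw [hx, hr 0 (by omega) (by omega), hσ.reg]
          omega
        · rw [h1, if_neg]
          rintro ⟨a, ha⟩
          exact hno a (by omega) ha
      | succ d ih' =>
        intro i hi τ hm hr hx h1 hno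
        have hreg0 : τ.reg 0 = n := by rw [hr 0 (by omega) (by omega), hσ.reg]
        have hvar : ∀ j < x + 1, vars τ j = Function.update (vars σ) x i j := by
          intro j hj
          rcases eq_or_ne j x with rfl | hne
          · simpa [vars] using hx
          · rw [Function.update_of_ne hne]
            exact hr _ (by omega) (by omega)
        have hlt : ∀ j < x + 1, vars τ j < n := by
          intro j hj
          rw [hvar j hj]
          rcases eq_or_ne j x with rfl | hne
          · simp; omega
          · rw [Function.update_of_ne hne]
            exact hv _ (by omega)
        have hne : (Expr.sub (.reg 0) (.reg (x + 8))).eval τ ≠ 0 := by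
          simp only [Expr.eval]; rw [hreg0, hx]; omega
        refine (Terminates.loop_true (T := T n + (2 + (2 + 4))) (T' := d * (T n + 12) + 4) hne
          ((hP n τ (hσ.congr (hr 0 (by omega) (by omega)) (by rw [hm])) hlt).seq
          (post' := fun υ => υ.mem = σ.mem ∧ (∀ j < x + 8, j ≠ 1 → υ.reg j = σ.reg j) ∧
            ((φ.Sat n σ.mem (Function.update (vars σ) x i) ∧ υ.reg (x + 8) = n ∧ υ.reg 1 = 1) ∨
            (¬ φ.Sat n σ.mem (Function.update (vars σ) x i) ∧ υ.reg (x + 8) = i + 1 ∧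
              υ.reg 1 = 0)))
          fun υ hυ => ?_) fun υ hυ => ?_).mono (by simp only [Expr.cost]; nlinarith) fun _ h => h
        · obtain ⟨hυm, hυr, hυ1⟩ := hυ
          rw [hm, Formula.sat_congr (fun _ _ => rfl) φ h hvar] at hυ1
          have hfix : ∀ w, ∀ j < x + 8, j ≠ 1 → (setReg υ (x + 8) w).reg j = σ.reg j := by
            intro w j hj hj1
            rw [setReg_reg_of_ne _ _ (by omega), hυr j (by omega) hj1, hr j hj hj1]
          refine Terminates.branch (e := .reg 1) (fun he => .assign ⟨hυm.trans hm, hfix _, ?_⟩)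
            fun he => .assign ⟨hυm.trans hm, hfix _, ?_⟩
          · have hs : φ.Sat n σ.mem (Function.update (vars σ) x i) := by
              by_contra hs
              exact he (by simp [Expr.eval, hυ1, hs])
            refine .inl ⟨hs, ?_, ?_⟩
            · rw [setReg_reg_self, Expr.eval, hυr 0 (by omega) (by omega), hreg0]
            · rw [setReg_reg_of_ne _ _ (by omega), hυ1, if_pos hs]
          · have hs : ¬ φ.Sat n σ.mem (Function.update (vars σ) x i) := by
              intro hs
              simp [Expr.eval, hυ1, hs] at he
            refine .inr ⟨hs, ?_, ?_⟩
            · rw [setReg_reg_self, Expr.eval, Expr.eval, Expr.eval, hυr _ (by omega) (by omega), hx]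
            · rw [setReg_reg_of_ne _ _ (by omega), hυ1, if_neg hs]
        · obtain ⟨hυm, hυr, ⟨hs, hυx, hυ1⟩ | ⟨hs, hυx, hυ1⟩⟩ := hυ
          · refine (Terminates.loop_false ?_ ⟨hυm, hυr, ?_⟩).mono (by simp [Expr.cost])
              fun _ h => h
            · simp only [Expr.eval]
              rw [hυx, hυr 0 (by omega) (by omega), hσ.reg]
              omega
            · rw [hυ1, if_pos]
              exact ⟨⟨i, by omega⟩, hs⟩
          · refine ih' (i + 1) (by omega) υ hυm hυr hυx hυ1 fun a ha hsa => ?_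
            rcases Nat.lt_succ_iff_lt_or_eq.1 ha with ha | ha
            · exact hno a ha hsa
            · exact hs (ha ▸ hsa)
    refine Terminates.seq (.assign (post := fun τ => τ = setReg σ 1 0) rfl) ?_
    rintro _ rfl
    refine Terminates.seq (.assign (post := fun τ => τ = setReg (setReg σ 1 0) (x + 8) 0) rfl) ?_
    rintro _ rfl
    refine key n 0 (by omega) _ rfl ?_ (by simp) ?_ (fun a ha => by omega)
    · intro j hj hj1
      rw [setReg_reg_of_ne _ _ (by omega), setReg_reg_of_ne _ _ hj1]
    · rw [setReg_reg_of_ne _ _ (by omega), setReg_reg_self]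

end RAM

/-! ### Relations defined explicitly or as least fixed points -/

namespace RAM

/-- `ys` is a `j`-tuple of numbers below `n`. -/
def IsTuple (n j : ℕ) (ys : List ℕ) : Prop := ys.length = j ∧ ∀ y ∈ ys, y < n

/-- The assignment that maps variable `i` to the `i`-th entry of `ys`. -/
def tupleEnv (ys : List ℕ) (i : ℕ) : ℕ := ys.getD i 0

/-- Run `body` for all values below `n` of the variables `k, …, k + d - 1`, in lexicographic
order. -/
def nestLoop (body : Program) : ℕ → ℕ → Program
  | 0, _ => body
  | d + 1, k => forLoop (k + 8) (nestLoop body d (k + 1))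

/-- Run `body` in `d` nested loops with the counters `2, …, d + 1`, that is, `n ^ d` times. -/
def repeatLoop (body : Program) : ℕ → Program
  | 0 => body
  | d + 1 => forLoop (d + 2) (repeatLoop body d)

/-- The time of `d` nested loops whose body takes time `T`. -/
def loopTime (T : ℕ → ℕ) : ℕ → ℕ → ℕ
  | 0, n => T n
  | d + 1, n => n * (loopTime T d n + 8) + 6

theorem PolyBounded.loopTime {T : ℕ → ℕ} (hT : PolyBounded T) :
    ∀ d, PolyBounded (loopTime T d)
  | 0 => hT
  | d + 1 => (PolyBounded.loopTime hT d).loop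

/-- The invariant rule for `nestLoop`. The effect of the body on the memory for the tuples in a set
`S` is described by the relation `Q S`. -/
theorem Terminates.nestLoop {n j : ℕ} {body : Program} {T : ℕ → ℕ}
    {Q : Set (List ℕ) → (ℕ → ℕ → ℕ) → (ℕ → ℕ → ℕ) → Prop}
    (hnil : ∀ m, Q ∅ m m)
    (hcomp : ∀ S S' m m' m'', Q S m m' → Q S' m' m'' → Q (S ∪ S') m m'')
    (hbody : ∀ σ, Ready n σ → (∀ i < j, vars σ i < n) → Terminates body σ (T n) fun τ =>
      τ.mem 3 = σ.mem 3 ∧ (∀ i < j + 8, i ≠ 1 → τ.reg i = σ.reg i) ∧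
        Q {(List.range j).map (vars σ)} σ.mem τ.mem) :
    ∀ d k, k + d = j → ∀ σ, Ready n σ → (∀ i < k, vars σ i < n) →
      Terminates (nestLoop body d k) σ (loopTime T d n) fun τ =>
        τ.mem 3 = σ.mem 3 ∧ (∀ i < k + 8, i ≠ 1 → τ.reg i = σ.reg i) ∧
          Q {ys | IsTuple n j ys ∧ (List.range k).map (vars σ) <+: ys} σ.mem τ.mem := by
  intro d
  induction d with
  | zero =>
    intro k hk σ hσ hv
    obtain rfl : k = j := by omega
    refine (hbody σ hσ hv).mono le_rfl fun τ ⟨h3, hr, hQ⟩ => ⟨h3, hr, ?_⟩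
    convert hQ using 1
    ext ys
    simp only [Set.mem_ofPred_eq, Set.mem_singleton_iff]
    constructor
    · rintro ⟨⟨hl, -⟩, hp⟩
      exact (hp.eq_of_length (by simp [hl])).symm
    · rintro rfl
      exact ⟨⟨by simp, by simpa using hv⟩, List.prefix_rfl⟩
  | succ d ih =>
    intro k hk σ hσ hv
    refine (Terminates.forLoop (Inv := fun i τ => τ.mem 3 = σ.mem 3 ∧
      (∀ i < k + 8, i ≠ 1 → τ.reg i = σ.reg i) ∧
      Q {ys | IsTuple n j ys ∧ ∃ a < i, (List.range k).map (vars σ) ++ [a] <+: ys} σ.mem τ.mem)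
      (by omega) hσ.reg ?_ ?_).mono le_rfl ?_
    · refine ⟨rfl, fun i hi _ => setReg_reg_of_ne _ _ (by omega), ?_⟩
      simpa using hnil σ.mem
    · rintro i hi τ h0 hx ⟨h3, hr, hQ⟩
      have hvar : ∀ l < k, vars τ l = vars σ l := fun l hl => hr _ (by omega) (by omega)
      have hx' : vars τ k = i := hx
      refine (ih (k + 1) (by omega) τ (hσ.congr (hr 0 (by omega) (by omega)) h3) ?_).mono le_rfl ?_
      · intro l hl
        rcases Nat.lt_succ_iff_lt_or_eq.1 hl with hl | rfl
        · rw [hvar l hl]; exact hv l hl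
        · rwa [hx']
      · rintro υ ⟨h3', hr', hQ'⟩
        refine ⟨by rw [hr' 0 (by omega) (by omega), h0], by rw [hr' _ (by omega) (by omega), hx],
          h3'.trans h3, fun l hl hl1 => ?_, ?_⟩
        · rw [setReg_reg_of_ne _ _ (by omega), hr' l (by omega) hl1, hr l hl hl1]
        · rw [setReg_mem]
          convert hcomp _ _ _ _ _ hQ hQ' using 1
          have hmap : (List.range (k + 1)).map (vars τ) = (List.range k).map (vars σ) ++ [i] := by
            rw [List.range_succ, List.map_append, List.map_singleton, hx']
            congr 1
            exact List.map_congr_left fun l hl => hvar l (List.mem_range.1 hl)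
          rw [hmap]
          ext ys
          simp only [Set.mem_ofPred_eq, Set.mem_union]
          constructor
          · rintro ⟨hy, a, ha, hp⟩
            rcases Nat.lt_succ_iff_lt_or_eq.1 ha with ha | rfl
            · exact .inl ⟨hy, a, ha, hp⟩
            · exact .inr ⟨hy, hp⟩
          · rintro (⟨hy, a, ha, hp⟩ | ⟨hy, hp⟩)
            · exact ⟨hy, a, by omega, hp⟩
            · exact ⟨hy, i, by omega, hp⟩
    · rintro τ ⟨-, h3, hr, hQ⟩
      refine ⟨h3, hr, ?_⟩
      convert hQ using 1
      ext ys
      simp only [Set.mem_ofPred_eq]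
      refine and_congr_right fun hy => ⟨?_, ?_⟩
      · rintro ⟨zs, rfl⟩
        rcases zs with _ | ⟨a, zs⟩
        · have := hy.1
          simp at this
          omega
        · exact ⟨a, hy.2 a (by simp), ⟨zs, by simp⟩⟩
      · rintro ⟨a, -, hp⟩
        exact (List.prefix_append _ _).trans hp

/-- The invariant rule for `repeatLoop`. The invariant must not depend on the counters. -/
theorem Terminates.repeatLoop {n : ℕ} {body : Program} {T : ℕ → ℕ} {Inv : ℕ → State → Prop}
    (hstab : ∀ i σ x v, 2 ≤ x → x ≤ 5 → Inv i σ → Inv i (setReg σ x v))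
    (hbody : ∀ i σ, σ.reg 0 = n → Inv i σ → Terminates body σ (T n) fun τ =>
      τ.reg 0 = n ∧ (∀ x, 2 ≤ x → x ≤ 5 → τ.reg x = σ.reg x) ∧ Inv (i + 1) τ) :
    ∀ d, d ≤ 4 → ∀ i σ, σ.reg 0 = n → Inv i σ →
      Terminates (repeatLoop body d) σ (loopTime T d n) fun τ => τ.reg 0 = n ∧
        (∀ x, d + 2 ≤ x → x ≤ 5 → τ.reg x = σ.reg x) ∧ Inv (i + n ^ d) τ := by
  intro d
  induction d with
  | zero =>
    intro _ i σ h0 hI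
    exact (hbody i σ h0 hI).mono le_rfl fun τ ⟨h0, hr, hQ⟩ =>
      ⟨h0, fun x hx => hr x (by omega), hQ⟩
  | succ d ih =>
    intro hd i σ h0 hI
    refine (Terminates.forLoop (Inv := fun l τ =>
      (∀ x, d + 3 ≤ x → x ≤ 5 → τ.reg x = σ.reg x) ∧ Inv (i + l * n ^ d) τ)
      (by omega) h0 ?_ ?_).mono le_rfl ?_
    · exact ⟨fun x hx _ => setReg_reg_of_ne _ _ (by omega),
        by simpa using hstab i σ _ _ (by omega) (by omega) hI⟩
    · rintro l hl τ h0 hx ⟨hr, hQ⟩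
      refine (ih (by omega) _ τ h0 hQ).mono le_rfl ?_
      rintro υ ⟨h0', hr', hQ'⟩
      refine ⟨h0', by rw [hr' _ (by omega) (by omega), hx], fun y hy hy' => ?_, ?_⟩
      · rw [setReg_reg_of_ne _ _ (by omega), hr' y (by omega) hy', hr y hy hy']
      · rw [show i + (l + 1) * n ^ d = i + l * n ^ d + n ^ d by ring]
        exact hstab _ _ _ _ (by omega) (by omega) hQ'
    · rintro τ ⟨h0, hr, hQ⟩
      refine ⟨h0, hr, ?_⟩
      convert hQ using 1
      ring

/-- A definition of the `j`-ary relation `r` by a formula in the variables `0, …, j - 1`: either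
explicitly, or as the least relation that is closed under the formula. -/
inductive Definition : Type
  | set (r j : ℕ) (φ : Formula)
  | lfp (r j : ℕ) (φ : Formula)

namespace Definition

/-- The relation stored in memory `r` contains all `j`-tuples that satisfy `φ`. -/
def Closed (n r j : ℕ) (φ : Formula) (m : ℕ → ℕ → ℕ) : Prop :=
  ∀ ys, IsTuple n j ys → φ.Sat n m (tupleEnv ys) → m r (addr n ys) ≠ 0

/-- The set `S` of tuples is a bound for the least fixed point: the formula `φ` adds no tuple
outside of `S` to a relation `r` that is contained in `S`. -/
def Bound (n r j : ℕ) (φ : Formula) (m : ℕ → ℕ → ℕ) (S : List ℕ → Prop) : Prop :=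
  ∀ m', (∀ a, a ≠ r → m' a = m a) →
    (∀ ys, IsTuple n j ys → m' r (addr n ys) ≠ 0 → S ys) →
      ∀ ys, IsTuple n j ys → φ.Sat n m' (tupleEnv ys) → S ys

/-- The memory content `m` satisfies the definition. -/
def Holds (n : ℕ) (m : ℕ → ℕ → ℕ) : Definition → Prop
  | set r j φ => ∀ ys, IsTuple n j ys → (m r (addr n ys) ≠ 0 ↔ φ.Sat n m (tupleEnv ys))
  | lfp r j φ => Closed n r j φ m ∧
      ∀ S, Bound n r j φ m S → ∀ ys, IsTuple n j ys → m r (addr n ys) ≠ 0 → S ys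

/-- The definitions define the relations `R, R + 1, …` in this order, each in terms of earlier
ones. -/
def WF : ℕ → List Definition → Bool
  | _, [] => true
  | R, set r j φ :: L => decide (r = R) && decide (j ≤ 4) && φ.WF R j && WF (R + 1) L
  | R, lfp r j φ :: L => decide (r = R) && decide (j ≤ 4) && φ.WF (R + 1) j && WF (R + 1) L

theorem holds_congr {n R : ℕ} {m m' : ℕ → ℕ → ℕ} {L : List Definition} (hL : WF R L = true)
    (hm : ∀ a < R + L.length, m a = m' a) {d : Definition} (hd : d ∈ L) (h : d.Holds n m) :
    d.Holds n m' := by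
  induction L generalizing R with
  | nil => simp at hd
  | cons e L ih =>
    rw [List.length_cons] at hm
    rcases List.mem_cons.1 hd with rfl | hd
    · cases d with
      | set r j φ =>
        simp only [WF, Bool.and_eq_true, decide_eq_true_eq] at hL
        obtain ⟨⟨⟨rfl, -⟩, hφ⟩, -⟩ := hL
        intro ys hy
        rw [← hm r (by omega), h ys hy]
        exact φ.sat_congr (fun a ha => hm a (by omega)) hφ fun _ _ => rfl
      | lfp r j φ =>
        simp only [WF, Bool.and_eq_true, decide_eq_true_eq] at hL
        obtain ⟨⟨⟨rfl, -⟩, hφ⟩, -⟩ := hL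
        refine ⟨fun ys hy hs => ?_, fun S hS ys hy hs => ?_⟩
        · rw [← hm r (by omega)]
          exact h.1 ys hy
            ((φ.sat_congr (fun a ha => hm a (by omega)) hφ fun _ _ => rfl).2 hs)
        · rw [← hm r (by omega)] at hs
          refine h.2 S (fun m₁ hm₁ hS₁ zs hz hsz => ?_) ys hy hs
          refine hS (Function.update m' r (m₁ r)) (fun a ha => by simp [ha])
            (by simpa using hS₁) zs hz ?_
          refine (φ.sat_congr (fun a ha => ?_) hφ fun _ _ => rfl).2 hsz
          rcases eq_or_ne a r with rfl | hne
          · simp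
          · rw [Function.update_of_ne hne, hm₁ a hne, hm a (by omega)]
    · have : WF (R + 1) L = true := by
        cases e <;> · simp only [WF, Bool.and_eq_true] at hL; exact hL.2
      exact ih this (fun a ha => hm a (by omega)) hd

end Definition

theorem map_range_vars {σ : State} {j : ℕ} {ys : List ℕ} (h : (List.range j).map (vars σ) = ys) :
    ∀ i < j, vars σ i = tupleEnv ys i := by
  rintro i hi
  simp [← h, tupleEnv, hi]

theorem isTuple_map_vars {n j : ℕ} {σ : State} (hv : ∀ i < j, vars σ i < n) :
    IsTuple n j ((List.range j).map (vars σ)) := ⟨by simp, by simpa using hv⟩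

/-- The frame of the programs below: the registers `0`, `6` and `7` keep their contents. -/
def Frame (σ τ : State) : Prop := ∀ i < 8, i = 0 ∨ 6 ≤ i → τ.reg i = σ.reg i

/-- An explicitly defined relation can be computed in polynomial time. -/
theorem exists_program_set {R j : ℕ} {φ : Formula} (hR : 4 ≤ R) (hj : j ≤ 4)
    (hφ : φ.WF R j = true) : ∃ (P : Program) (T : ℕ → ℕ), PolyBounded T ∧
      ∀ (n : ℕ) (σ : State), Ready n σ → Terminates P σ (T n) fun τ => Frame σ τ ∧
        (∀ a, a ≠ R → τ.mem a = σ.mem a) ∧ (Definition.set R j φ).Holds n τ.mem := by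
  classical
  obtain ⟨P, T, hT, hP⟩ := exists_program_formula φ hφ
  refine ⟨nestLoop (.seq P (.store R (addrExpr (List.range j)) (.reg 1))) j 0,
    loopTime (fun n => T n + ((addrExpr (List.range j)).cost + 1 + 1)) j,
    (hT.add (.const _)).loopTime j, fun n σ hσ => ?_⟩
  have key := Terminates.nestLoop (n := n) (j := j)
    (body := .seq P (.store R (addrExpr (List.range j)) (.reg 1)))
    (T := fun n => T n + ((addrExpr (List.range j)).cost + 1 + 1))
    (Q := fun S m m' => (∀ ys ∈ S, IsTuple n j ys) ∧ (∀ a, a ≠ R → m' a = m a) ∧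
      (∀ i, (∀ ys ∈ S, i ≠ addr n ys) → m' R i = m R i) ∧
      ∀ ys ∈ S, (m' R (addr n ys) ≠ 0 ↔ φ.Sat n m (tupleEnv ys)))
    (fun m => by simp) ?_ ?_ j 0 (by omega) σ hσ (by simp)
  · refine key.mono le_rfl fun τ ⟨h3, hr, _, hm, _, hQ⟩ =>
      ⟨fun i hi hi' => hr i (by omega) (by omega), hm, fun ys hy => ?_⟩
    rw [hQ ys ⟨hy, by simp⟩]
    exact φ.sat_congr (fun r hr => (hm r (by omega)).symm) hφ fun _ _ => rfl
  · rintro S S' m m' m'' ⟨hS, hm, ho, hs⟩ ⟨hS', hm', ho', hs'⟩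
    refine ⟨?_, fun a ha => (hm' a ha).trans (hm a ha), fun i hi => ?_, fun ys hy => ?_⟩
    · rintro ys (hy | hy)
      exacts [hS ys hy, hS' ys hy]
    · exact (ho' i fun ys hy => hi ys (.inr hy)).trans (ho i fun ys hy => hi ys (.inl hy))
    · have hsat : ∀ v, φ.Sat n m' v ↔ φ.Sat n m v := fun v =>
        φ.sat_congr (fun r hr => hm r (by omega)) hφ fun _ _ => rfl
      by_cases hy' : ys ∈ S'
      · rw [hs' ys hy', hsat]
      · have hy : ys ∈ S := hy.resolve_right hy'
        rw [ho', hs ys hy]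
        intro zs hz heq
        have h1 := hS ys hy
        have h2 := hS' zs hz
        exact hy' (addr_injective (h1.1.trans h2.1.symm) h1.2 h2.2 heq ▸ hz)
  · intro σ hσ hv
    refine (hP n σ hσ hv).seq fun τ ⟨hm, hr, h1⟩ => .store ?_
    have hvar : ∀ i < j, vars τ i = vars σ i := fun i hi => hr _ (by omega) (by omega)
    have haddr : (addrExpr (List.range j)).eval τ = addr n ((List.range j).map (vars σ)) := by
      rw [addrExpr_eval (hσ.congr (hr 0 (by omega) (by omega)) (by rw [hm])) _ (by simpa using hj)
        fun x hx => by rw [hvar x (by simpa using hx)]; exact hv x (by simpa using hx)]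
      congr 1
      exact List.map_congr_left fun l hl => hvar l (by simpa using hl)
    rw [haddr]
    refine ⟨?_, hr, ?_, fun a ha => ?_, fun i hi => ?_, ?_⟩
    · simp [setMem, hm, show 3 ≠ R by omega]
    · rintro _ rfl
      exact isTuple_map_vars hv
    · simp [setMem, hm, ha]
    · have := hi _ rfl
      simp [setMem, hm, this]
    · rintro _ rfl
      rw [φ.sat_congr (fun _ _ => rfl) hφ fun i hi => (map_range_vars rfl i hi).symm]
      simp [setMem, Expr.eval, h1]

open Classical in
/-- The number of empty cells among the first `N` cells of memory `r`. -/
noncomputable def zeros (N r : ℕ) (m : ℕ → ℕ → ℕ) : ℕ :=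
  ((Finset.range N).filter fun i => m r i = 0).card

theorem zeros_le (N r : ℕ) (m : ℕ → ℕ → ℕ) : zeros N r m ≤ N :=
  (Finset.card_filter_le _ _).trans (by simp)

theorem zeros_mono {N r : ℕ} {m m' : ℕ → ℕ → ℕ} (h : ∀ i, m r i ≠ 0 → m' r i ≠ 0) :
    zeros N r m' ≤ zeros N r m := by
  refine Finset.card_le_card fun i hi => ?_
  rw [Finset.mem_filter] at hi ⊢
  exact ⟨hi.1, by_contra fun hne => h i hne hi.2⟩

theorem zeros_lt {N r : ℕ} {m m' : ℕ → ℕ → ℕ} (h : ∀ i, m r i ≠ 0 → m' r i ≠ 0) {i : ℕ}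
    (hi : i < N) (h0 : m r i = 0) (h1 : m' r i ≠ 0) : zeros N r m' < zeros N r m := by
  refine Finset.card_lt_card ⟨fun i hi => ?_, fun hs => ?_⟩
  · rw [Finset.mem_filter] at hi ⊢
    exact ⟨hi.1, by_contra fun hne => h i hne hi.2⟩
  · have := hs (Finset.mem_filter.2 ⟨Finset.mem_range.2 hi, h0⟩)
    exact h1 (Finset.mem_filter.1 this).2

/-- What a pass over the tuples in `S` does that adds to the relation `r`, in place, every tuple
that satisfies `φ`: it respects the bounds of the least fixed point, and it changes nothing only if
the relation is already closed under `φ`, as far as tuples in `S` are concerned. -/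
def Pass (n r j : ℕ) (φ : Formula) (S : Set (List ℕ)) (m m' : ℕ → ℕ → ℕ) : Prop :=
  (∀ a, a ≠ r → m' a = m a) ∧ (∀ i, m r i ≠ 0 → m' r i ≠ 0) ∧
  (∀ B, Definition.Bound n r j φ m B → (∀ ys, IsTuple n j ys → m r (addr n ys) ≠ 0 → B ys) →
    ∀ ys, IsTuple n j ys → m' r (addr n ys) ≠ 0 → B ys) ∧
  ((m' = m ∧ ∀ ys ∈ S, φ.Sat n m (tupleEnv ys) → m r (addr n ys) ≠ 0) ∨
    (zeros (n ^ j) r m' < zeros (n ^ j) r m ∧ ¬ Definition.Closed n r j φ m))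

theorem Definition.Bound.congr {n r j : ℕ} {φ : Formula} {m m' : ℕ → ℕ → ℕ} {B : List ℕ → Prop}
    (h : Definition.Bound n r j φ m B) (hm : ∀ a, a ≠ r → m' a = m a) :
    Definition.Bound n r j φ m' B :=
  fun m₁ hm₁ => h m₁ fun a ha => (hm₁ a ha).trans (hm a ha)

theorem Pass.comp {n r j : ℕ} {φ : Formula} {S S' : Set (List ℕ)} {m m' m'' : ℕ → ℕ → ℕ}
    (h : Pass n r j φ S m m') (h' : Pass n r j φ S' m' m'') : Pass n r j φ (S ∪ S') m m'' := by
  obtain ⟨hm, hmono, hb, hp⟩ := h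
  obtain ⟨hm', hmono', hb', hp'⟩ := h'
  refine ⟨fun a ha => (hm' a ha).trans (hm a ha), fun i hi => hmono' i (hmono i hi),
    fun B hB h0 => hb' B (hB.congr hm) (hb B hB h0), ?_⟩
  rcases hp with ⟨rfl, hc⟩ | ⟨hlt, hc⟩
  · rcases hp' with ⟨rfl, hc'⟩ | hp'
    · refine .inl ⟨rfl, ?_⟩
      rintro ys (hy | hy)
      exacts [hc ys hy, hc' ys hy]
    · exact .inr hp'
  · exact .inr ⟨(zeros_mono hmono').trans_lt hlt, hc⟩

/-- A least fixed point can be computed in polynomial time. -/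
theorem exists_program_lfp {R j : ℕ} {φ : Formula} (hR : 4 ≤ R) (hj : j ≤ 4)
    (hφ : φ.WF (R + 1) j = true) : ∃ (P : Program) (T : ℕ → ℕ), PolyBounded T ∧
      ∀ (n : ℕ) (σ : State), Ready n σ → Terminates P σ (T n) fun τ => Frame σ τ ∧
        (∀ a, a ≠ R → τ.mem a = σ.mem a) ∧ (Definition.lfp R j φ).Holds n τ.mem := by
  classical
  obtain ⟨P, T, hT, hP⟩ := exists_program_formula φ hφ
  -- the relation is emptied by the explicit definition `False`
  obtain ⟨P₀, T₀, hT₀, hP₀⟩ := exists_program_set (R := R) (j := j)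
    (φ := .and (.ex j (.lt j j)) (.ex j (.lt j j))) hR hj (by simp [Formula.WF])
  -- the value `w + (1 - w)` is `1` if `w = 0`, and `w` otherwise
  let e : Expr := .add (.read R (addrExpr (List.range j)))
    (.sub (.const 1) (.read R (addrExpr (List.range j))))
  let body : Program :=
    .seq P (.branch (.reg 1) (.store R (addrExpr (List.range j)) e) .skip)
  let Tb : ℕ → ℕ := fun n => T n + (2 + ((addrExpr (List.range j)).cost + e.cost + 1 + 1))
  have hTb : PolyBounded Tb := hT.add (.const _)
  refine ⟨.seq P₀ (repeatLoop (nestLoop body j 0) j), fun n => T₀ n + loopTime (loopTime Tb j) j n,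
    hT₀.add ((hTb.loopTime j).loopTime j), fun n σ hσ => ?_⟩
  have pass : ∀ σ, Ready n σ → Terminates (nestLoop body j 0) σ (loopTime Tb j n) fun τ =>
      τ.mem 3 = σ.mem 3 ∧ (∀ i < 8, i ≠ 1 → τ.reg i = σ.reg i) ∧
        Pass n R j φ {ys | IsTuple n j ys} σ.mem τ.mem := by
    intro σ hσ
    refine (Terminates.nestLoop (n := n) (j := j) (T := Tb) (Q := Pass n R j φ) ?_
      (fun _ _ _ _ _ => Pass.comp) ?_ j 0 (by omega) σ hσ (by simp)).mono le_rfl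
      fun τ ⟨h3, hr, hQ⟩ => ⟨h3, hr, by simpa using hQ⟩
    · exact fun m => ⟨fun _ _ => rfl, fun _ h => h, fun _ _ h => h, .inl ⟨rfl, by simp⟩⟩
    · intro σ hσ hv
      refine (hP n σ hσ hv).seq fun τ ⟨hm, hr, h1⟩ => ?_
      have hvar : ∀ i < j, vars τ i = vars σ i := fun i hi => hr _ (by omega) (by omega)
      have haddr : (addrExpr (List.range j)).eval τ = addr n ((List.range j).map (vars σ)) := by
        rw [addrExpr_eval (hσ.congr (hr 0 (by omega) (by omega)) (by rw [hm])) _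
          (by simpa using hj)
          fun x hx => by rw [hvar x (by simpa using hx)]; exact hv x (by simpa using hx)]
        congr 1
        exact List.map_congr_left fun l hl => hvar l (by simpa using hl)
      set ys := (List.range j).map (vars σ) with hys
      have hyt : IsTuple n j ys := isTuple_map_vars hv
      rw [φ.sat_congr (fun _ _ => rfl) hφ (map_range_vars hys.symm)] at h1
      refine Terminates.branch (e := .reg 1) (fun he => .store ?_) (fun he => .skip ?_)
      · have hs : φ.Sat n σ.mem (tupleEnv ys) := by
          by_contra hs
          exact he (by simp [Expr.eval, h1, hs])
        have he : e.eval τ = σ.mem R (addr n ys) + (1 - σ.mem R (addr n ys)) := by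
          simp only [e, Expr.eval, haddr, hm]
        rw [haddr, he]
        have hmono : ∀ i, σ.mem R i ≠ 0 → Function.update (σ.mem R) (addr n ys)
            (σ.mem R (addr n ys) + (1 - σ.mem R (addr n ys))) i ≠ 0 := by
          intro i hi
          rcases eq_or_ne i (addr n ys) with rfl | hne
          · simp [hi]
          · rwa [Function.update_of_ne hne]
        refine ⟨by simp [setMem, hm, show 3 ≠ R by omega], hr, fun a ha => by simp [setMem, hm, ha],
          by simpa only [setMem, Function.update_self, hm] using hmono, ?_, ?_⟩
        · intro B hB h0 zs hz hzs
          simp only [setMem, Function.update_self, hm] at hzs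
          rcases eq_or_ne (addr n zs) (addr n ys) with heq | hne
          · rw [addr_injective (hz.1.trans hyt.1.symm) hz.2 hyt.2 heq]
            exact hB σ.mem (fun _ _ => rfl) h0 ys hyt hs
          · rw [Function.update_of_ne hne] at hzs
            exact h0 zs hz hzs
        · by_cases h0 : σ.mem R (addr n ys) = 0
          · refine .inr ⟨zeros_lt (i := addr n ys)
              (by simpa only [setMem, Function.update_self, hm] using hmono) ?_ h0 ?_,
              fun hc => hc ys hyt hs h0⟩
            · rw [← hyt.1]; exact addr_lt ys hyt.2
            · simp [setMem, h0]
          · refine .inl ⟨?_, ?_⟩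
            · have : σ.mem R (addr n ys) + (1 - σ.mem R (addr n ys)) = σ.mem R (addr n ys) := by
                omega
              simp [setMem, hm, this]
            · rintro _ rfl _
              exact h0
      · have hs : ¬ φ.Sat n σ.mem (tupleEnv ys) := by
          intro hs
          simp [Expr.eval, h1, hs] at he
        rw [hm]
        refine ⟨rfl, hr, fun _ _ => rfl, fun _ h => h, fun _ _ h => h, .inl ⟨rfl, ?_⟩⟩
        rintro _ rfl h
        exact absurd h hs
  refine (hP₀ n σ hσ).seq fun τ ⟨hf, hm, hset⟩ => ?_
  have hempty : ∀ ys, IsTuple n j ys → τ.mem R (addr n ys) = 0 := by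
    intro ys hy
    by_contra hne
    obtain ⟨⟨a, ha⟩, -⟩ := (hset ys hy).1 hne
    exact lt_irrefl _ ha
  have hτ : Ready n τ := hσ.congr (hf 0 (by omega) (by omega)) (hm 3 (by omega))
  refine (Terminates.repeatLoop (n := n) (T := loopTime Tb j) (Inv := fun i υ =>
    Frame σ υ ∧ (∀ a, a ≠ R → υ.mem a = τ.mem a) ∧
    (∀ B, Definition.Bound n R j φ τ.mem B →
      ∀ ys, IsTuple n j ys → υ.mem R (addr n ys) ≠ 0 → B ys) ∧
    (zeros (n ^ j) R υ.mem + i ≤ n ^ j ∨ Definition.Closed n R j φ υ.mem)) ?_ ?_ j hj 0 τ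
    hτ.reg ?_).mono le_rfl ?_
  · rintro i υ x v hx hx' ⟨hf', h⟩
    exact ⟨fun l hl hl' => (setReg_reg_of_ne _ _ (by omega)).trans (hf' l hl hl'), h⟩
  · rintro i υ - ⟨hf', hm', hb, hc⟩
    have hυ : Ready n υ := hσ.congr (hf' 0 (by omega) (by omega))
      ((hm' 3 (by omega)).trans (hm 3 (by omega)))
    refine (pass υ hυ).mono le_rfl fun ω ⟨h3, hr, hpm, hpmono, hpb, hp⟩ =>
      ⟨(hr 0 (by omega) (by omega)).trans hυ.reg, fun x hx hx' => hr x (by omega) (by omega),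
        fun l hl hl' => (hr l hl (by omega)).trans (hf' l hl hl'),
        fun a ha => (hpm a ha).trans (hm' a ha), fun B hB => ?_, ?_⟩
    · exact hpb B (hB.congr hm') (hb B hB)
    · rcases hp with ⟨heq, hcl⟩ | ⟨hlt, hncl⟩
      · rw [heq]
        exact .inr hcl
      · left
        have := hc.resolve_right hncl
        omega
  · refine ⟨hf, fun _ _ => rfl, fun B _ ys hy h => absurd (hempty ys hy) h, .inl ?_⟩
    simpa using zeros_le _ _ _
  · rintro υ ⟨-, -, hf', hm', hb, hc⟩
    refine ⟨hf',
      fun a ha => (hm' a ha).trans (hm a ha), ?_, fun B hB => hb B (hB.congr fun a ha =>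
        (hm' a ha).symm)⟩
    rcases hc with hc | hc
    · -- no cell is empty
      intro ys hy _ h0
      have hz : zeros (n ^ j) R υ.mem = 0 := by omega
      have hmem : addr n ys ∈ (Finset.range (n ^ j)).filter fun i => υ.mem R i = 0 := by
        rw [Finset.mem_filter, Finset.mem_range, ← hy.1]
        exact ⟨addr_lt ys hy.2, h0⟩
      rw [zeros, Finset.card_eq_zero] at hz
      simp [hz] at hmem
    · exact hc

/-- The relations of a list of definitions can be computed in polynomial time. -/
theorem exists_program_definitions (L : List Definition) {R : ℕ} (hR : 4 ≤ R)
    (hL : Definition.WF R L = true) : ∃ (P : Program) (T : ℕ → ℕ), PolyBounded T ∧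
      ∀ (n : ℕ) (σ : State), Ready n σ → Terminates P σ (T n) fun τ => Frame σ τ ∧
        (∀ a, a < R ∨ R + L.length ≤ a → τ.mem a = σ.mem a) ∧ ∀ d ∈ L, d.Holds n τ.mem := by
  induction L generalizing R with
  | nil => exact ⟨.skip, _, .const 1, fun n σ hσ => .skip ⟨fun _ _ _ => rfl, by simp, by simp⟩⟩
  | cons d L ih =>
    obtain ⟨hL', P, T, hT, hP⟩ : Definition.WF (R + 1) L = true ∧
        ∃ (P : Program) (T : ℕ → ℕ), PolyBounded T ∧
      ∀ (n : ℕ) (σ : State), Ready n σ → Terminates P σ (T n) fun τ => Frame σ τ ∧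
        (∀ a, a ≠ R → τ.mem a = σ.mem a) ∧ d.Holds n τ.mem := by
      cases d with
      | set r j φ =>
        simp only [Definition.WF, Bool.and_eq_true, decide_eq_true_eq] at hL
        obtain ⟨⟨⟨rfl, hj⟩, hφ⟩, hL⟩ := hL
        exact ⟨hL, exists_program_set hR hj hφ⟩
      | lfp r j φ =>
        simp only [Definition.WF, Bool.and_eq_true, decide_eq_true_eq] at hL
        obtain ⟨⟨⟨rfl, hj⟩, hφ⟩, hL⟩ := hL
        exact ⟨hL, exists_program_lfp hR hj hφ⟩
    have hd : Definition.WF R [d] = true := by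
      cases d <;>
      · simp only [Definition.WF, Bool.and_eq_true] at hL ⊢
        exact ⟨hL.1, trivial⟩
    obtain ⟨P', T', hT', hP'⟩ := ih (by omega) hL'
    refine ⟨.seq P P', fun n => T n + T' n, hT.add hT', fun n σ hσ => ?_⟩
    refine (hP n σ hσ).seq fun τ ⟨hf, hm, hh⟩ => ?_
    refine (hP' n τ (hσ.congr (hf 0 (by omega) (by omega)) (hm 3 (by omega)))).mono le_rfl
      fun υ ⟨hf', hm', hh'⟩ => ⟨fun i hi hi' => (hf' i hi hi').trans (hf i hi hi'), ?_, ?_⟩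
    · intro a ha
      rw [List.length_cons] at ha
      rw [hm' a (by omega), hm a (by omega)]
    · intro e he
      rcases List.mem_cons.1 he with rfl | he
      · refine Definition.holds_congr hd (fun a ha => (hm' a (.inl ?_)).symm) (by simp) hh
        simpa using ha
      · exact hh' e he

end RAM

/-! ### Mixed graphs as pairs of relations -/

open Relation

/-- A mixed graph, given by its symmetric edge relation and its arc relation. -/
structure MixedRel (V : Type*) where
  /-- adjacency by an undirected edge -/
  E : V → V → Prop
  /-- adjacency by a directed arc -/
  A : V → V → Prop
  symm : ∀ {u v}, E u v → E v u

/-- A shortest walk visits no vertex twice. -/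
theorem exists_injective_walk {V : Type*} {R : V → V → Prop} {p q : V} (h : ReflTransGen R p q) :
    ∃ (k : ℕ) (w : ℕ → V), w 0 = p ∧ w k = q ∧ (∀ i < k, R (w i) (w (i + 1))) ∧
      ∀ i j, i ≤ k → j ≤ k → w i = w j → i = j := by
  classical
  have hex : ∃ (k : ℕ) (w : ℕ → V), w 0 = p ∧ w k = q ∧ ∀ i < k, R (w i) (w (i + 1)) := by
    induction h with
    | refl => exact ⟨0, fun _ => p, rfl, rfl, by simp⟩
    | @tail b c _ hbc ih =>
      obtain ⟨k, w, h0, hk, hw⟩ := ih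
      refine ⟨k + 1, fun i => if i ≤ k then w i else c, by simp [h0], by simp, fun i hi => ?_⟩
      rcases Nat.lt_succ_iff_lt_or_eq.1 hi with hi | rfl
      · simpa [hi.le, Nat.succ_le_of_lt hi] using hw i hi
      · simpa [hk] using hbc
  obtain ⟨w, h0, hk, hw⟩ := Nat.find_spec hex
  set k := Nat.find hex with hkdef
  refine ⟨k, w, h0, hk, hw, ?_⟩
  -- a walk with a repeated vertex has a shortcut
  have key : ∀ i j, i < j → j ≤ k → w i ≠ w j := by
    intro i j hij hj heq
    refine Nat.find_min hex (m := k - (j - i)) (by omega)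
      ⟨fun l => if l ≤ i then w l else w (l + (j - i)), by simp [h0], ?_, fun l hl => ?_⟩
    · by_cases hji : j = k
      · subst hji
        simp [show k - (k - i) = i by omega, heq, hk]
      · simp [show ¬ k - (j - i) ≤ i by omega, show k - (j - i) + (j - i) = k by omega, hk]
    · rcases lt_trichotomy l i with hl' | rfl | hl'
      · simpa [hl'.le, Nat.succ_le_of_lt hl'] using hw l (by omega)
      · have := hw j (by omega)
        simpa [heq, show l + 1 + (j - l) = j + 1 by omega] using this
      · have := hw (l + (j - i)) (by omega)
        simpa [show ¬ l ≤ i by omega, show ¬ l + 1 ≤ i by omega,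
          show l + 1 + (j - i) = l + (j - i) + 1 by omega] using this
  intro i j hi hj heq
  rcases lt_trichotomy i j with h | h | h
  · exact absurd heq (key i j h hj)
  · exact h
  · exact absurd heq.symm (key j i h hi)

namespace MixedRel

variable {V : Type*} (G : MixedRel V)

/-- Adjacency by an edge other than `{x, y}`. -/
def Off (x y u v : V) : Prop := G.E u v ∧ ¬ (u = x ∧ v = y) ∧ ¬ (u = y ∧ v = x)

/-- Being connected by edges other than `{x, y}`. -/
def Conn (x y : V) : V → V → Prop := ReflTransGen (G.Off x y)

/-- Being reachable by arcs, and by edges other than `{x, y}` in any direction. -/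
def Reach (x y : V) : V → V → Prop := ReflTransGen fun u v => G.A u v ∨ G.Off x y u v

/-- Being connected by edges. -/
def Comp : V → V → Prop := ReflTransGen G.E

/-- The edge `{x, y}` lies on no mixed cycle. -/
def Bridge (x y : V) : Prop := G.E x y ∧ ¬ G.Reach x y x y ∧ ¬ G.Reach x y y x

/-- The edge `{x, y}` lies on a mixed cycle; such an edge may be used in both directions. -/
def Flex (x y : V) : Prop := G.E x y ∧ ¬ G.Bridge x y

/-- Every walk of undirected edges from `p` to `q` uses the bridge `{x, y}`, from `x` to `y`. -/
def Dir (p q x y : V) : Prop := G.Bridge x y ∧ G.Conn x y p x ∧ G.Conn x y y q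

/-- The vertex `p` is incident with an arc. -/
def End (p : V) : Prop := ∃ v, G.A p v ∨ G.A v p

/-- The directed bridges `(x, y)` and `(x', y')` are parallel: they lie in the same component, and
separate the ends of arcs in this component in the same way. -/
def Par (x y x' y' : V) : Prop :=
  G.Bridge x y ∧ G.Bridge x' y' ∧ G.Comp x x' ∧
    ∀ r, G.End r → G.Comp x r → (G.Conn x y x r ↔ G.Conn x' y' x' r)

/-- The bridge `{x, y}` separates two ends of arcs. -/
def Sep (x y : V) : Prop := ∃ p q, G.End p ∧ G.End q ∧ G.Dir p q x y

variable {G} {x y a b p q r s t u v : V}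

theorem Off.symm (h : G.Off x y u v) : G.Off x y v u :=
  ⟨G.symm h.1, fun h' => h.2.2 ⟨h'.2, h'.1⟩, fun h' => h.2.1 ⟨h'.2, h'.1⟩⟩

theorem off_comm : G.Off x y u v ↔ G.Off y x u v :=
  and_congr_right fun _ => and_comm

theorem Conn.symm (h : G.Conn x y u v) : G.Conn x y v u :=
  have : Std.Symm (G.Off x y) := ⟨fun _ _ => Off.symm⟩
  ReflTransGen.stdSymm.symm _ _ h

theorem Conn.trans (h : G.Conn x y u v) (h' : G.Conn x y v r) : G.Conn x y u r :=
  ReflTransGen.trans h h'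

theorem conn_comm : G.Conn x y u v ↔ G.Conn y x u v := by
  rw [Conn, Conn, show G.Off x y = G.Off y x from funext₂ fun _ _ => propext off_comm]

theorem reach_comm : G.Reach x y u v ↔ G.Reach y x u v := by
  rw [Reach, Reach, show G.Off x y = G.Off y x from funext₂ fun _ _ => propext off_comm]

theorem Conn.reach (h : G.Conn x y u v) : G.Reach x y u v :=
  ReflTransGen.mono (fun _ _ h => .inr h) _ _ h

theorem Conn.comp (h : G.Conn x y u v) : G.Comp u v :=
  ReflTransGen.mono (fun _ _ h => h.1) _ _ h

theorem Comp.symm (h : G.Comp u v) : G.Comp v u :=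
  have : Std.Symm G.E := ⟨fun _ _ => G.symm⟩
  ReflTransGen.stdSymm.symm _ _ h

theorem Comp.trans (h : G.Comp u v) (h' : G.Comp v r) : G.Comp u r :=
  ReflTransGen.trans h h'

theorem Bridge.symm (h : G.Bridge x y) : G.Bridge y x :=
  ⟨G.symm h.1, fun h' => h.2.2 (reach_comm.1 h'), fun h' => h.2.1 (reach_comm.1 h')⟩

theorem Flex.symm (h : G.Flex x y) : G.Flex y x := ⟨G.symm h.1, fun h' => h.2 h'.symm⟩

theorem Bridge.comp (h : G.Bridge x y) : G.Comp x y := .single h.1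

theorem Bridge.not_conn (h : G.Bridge x y) : ¬ G.Conn x y x y := fun h' => h.2.1 h'.reach

/-- No vertex lies on both sides of a bridge. -/
theorem Bridge.not_both (h : G.Bridge x y) (h1 : G.Conn x y x r) (h2 : G.Conn x y y r) : False :=
  h.not_conn (h1.trans h2.symm)

/-- Every vertex of the component lies on one of the sides of a bridge. -/
theorem conn_or_conn (h : G.Comp x r) : G.Conn x y x r ∨ G.Conn x y y r := by
  induction h with
  | refl => exact .inl .refl
  | @tail b c _ hbc ih =>
    by_cases h1 : b = x ∧ c = y
    · rw [h1.2]; exact .inr .refl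
    by_cases h2 : b = y ∧ c = x
    · rw [h2.2]; exact .inl .refl
    exact ih.imp (fun h => h.tail ⟨hbc, h1, h2⟩) fun h => h.tail ⟨hbc, h1, h2⟩

theorem Dir.swap (h : G.Dir p q x y) : G.Dir q p y x :=
  ⟨h.1.symm, conn_comm.1 h.2.2.symm, conn_comm.1 h.2.1.symm⟩

theorem dir_swap : G.Dir p q x y ↔ G.Dir q p y x := ⟨Dir.swap, Dir.swap⟩

theorem Dir.comp (h : G.Dir p q x y) : G.Comp p q :=
  h.2.1.comp.trans (h.1.comp.trans h.2.2.comp)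

/-- A side of a bridge `{x, y}` lies on one side of every bridge `{a, b}` of the opposite side. -/
theorem conn_of_conn (hxy : G.Bridge x y) (h1 : ¬ (a = x ∧ b = y)) (h2 : ¬ (a = y ∧ b = x))
    (hab : G.Bridge a b) (ha : G.Conn x y x a) (hr : G.Conn x y y r) : G.Conn a b y r := by
  have hb : G.Conn x y x b := ha.tail ⟨hab.1, h1, h2⟩
  induction hr with
  | refl => exact .refl
  | @tail c d hc hcd ih =>
    refine ih.tail ⟨hcd.1, ?_, ?_⟩
    · rintro ⟨rfl, -⟩
      exact hxy.not_both ha hc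
    · rintro ⟨rfl, -⟩
      exact hxy.not_both hb hc

/-- The sides of two bridges of a component do not cross: one of the four intersections of a side
of the first with a side of the second is empty. -/
theorem not_cross {r₁ r₂ r₃ r₄ : V} (hxy : G.Bridge x y) (hab : G.Bridge a b)
    (h1 : G.Conn x y x r₁) (h1' : G.Conn a b a r₁) (h2 : G.Conn x y x r₂) (h2' : G.Conn a b b r₂)
    (h3 : G.Conn x y y r₃) (h3' : G.Conn a b a r₃) (h4 : G.Conn x y y r₄)
    (h4' : G.Conn a b b r₄) : False := by
  by_cases e1 : a = x ∧ b = y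
  · obtain ⟨rfl, rfl⟩ := e1
    exact hxy.not_both h2 h2'
  by_cases e2 : a = y ∧ b = x
  · obtain ⟨rfl, rfl⟩ := e2
    exact hxy.not_both h1 (conn_comm.1 h1')
  rcases conn_or_conn (y := y) (h1.comp.trans h1'.comp.symm) with ha | ha
  · have h3'' := conn_of_conn hxy e1 e2 hab ha h3
    have h4'' := conn_of_conn hxy e1 e2 hab ha h4
    exact hab.not_conn (h3'.trans (h3''.symm.trans (h4''.trans h4'.symm)))
  · have h1'' := conn_of_conn hxy.symm e2 e1 hab (conn_comm.1 ha) (conn_comm.1 h1)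
    have h2'' := conn_of_conn hxy.symm e2 e1 hab (conn_comm.1 ha) (conn_comm.1 h2)
    exact hab.not_conn (h1'.trans (h1''.symm.trans (h2''.trans h2'.symm)))

/-! ### Orientations of the bridges -/

variable (G) in
/-- `O` contains one of the two directions of every bridge. -/
structure IsOri (O : V → V → Prop) : Prop where
  sub : ∀ {x y}, O x y → G.Bridge x y
  asymm : ∀ {x y}, O x y → ¬ O y x
  total : ∀ {x y}, G.Bridge x y → O x y ∨ O y x

variable (G) in
/-- The arcs of the directed graph in which the edges on mixed cycles may be used in both
directions, and the bridges in the directions in `O`. -/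
def Step (O : V → V → Prop) (u v : V) : Prop := G.A u v ∨ G.Flex u v ∨ O u v

/-- A path between two vertices of a component uses the bridges that separate them. -/
theorem IsOri.of_dir {O : V → V → Prop} (hO : G.IsOri O) (h : ReflTransGen (G.Step O) p q)
    (hd : G.Dir p q x y) : O x y := by
  by_contra hxy
  -- otherwise the path does not use the bridge at all, and closes a mixed cycle through it
  have key : ∀ r, ReflTransGen (G.Step O) p r → G.Reach x y x r := by
    intro r hr
    induction hr with
    | refl => exact hd.2.1.symm.reach
    | @tail b c _ hbc ih =>
      by_cases h1 : b = x ∧ c = y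
      · obtain ⟨rfl, rfl⟩ := h1
        rcases hbc with h | h | h
        · exact ih.tail (.inl h)
        · exact absurd hd.1 h.2
        · exact absurd h hxy
      by_cases h2 : b = y ∧ c = x
      · obtain ⟨rfl, rfl⟩ := h2
        exact absurd ih hd.1.2.1
      rcases hbc with h | h | h
      · exact ih.tail (.inl h)
      · exact ih.tail (.inr ⟨h.1, h1, h2⟩)
      · exact ih.tail (.inr ⟨(hO.sub h).1, h1, h2⟩)
  exact hd.1.2.1 ((key q h).trans hd.2.2.symm.reach)

/-- Two vertices of a component are joined by a path if all bridges that separate them have the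
right direction. -/
theorem reach_of_dir {O : V → V → Prop} (h : G.Comp p q) (hd : ∀ x y, G.Dir p q x y → O x y) :
    ReflTransGen (G.Step O) p q := by
  obtain ⟨k, w, rfl, rfl, hw, hinj⟩ := exists_injective_walk h
  have main : ∀ i ≤ k, ReflTransGen (G.Step O) (w 0) (w i) := by
    intro i
    induction i with
    | zero => exact fun _ => .refl
    | succ i ih =>
      intro hi
      refine (ih (by omega)).tail ?_
      by_cases hb : G.Bridge (w i) (w (i + 1))
      · -- the rest of the shortest walk avoids this bridge
        have off : ∀ j < k, j ≠ i → G.Off (w i) (w (i + 1)) (w j) (w (j + 1)) := by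
          refine fun j hj hji => ⟨hw j hj, fun ⟨h1, _⟩ => ?_, fun ⟨h1, h2⟩ => ?_⟩
          · exact hji (hinj _ _ (by omega) (by omega) h1)
          · have := hinj _ _ (by omega) (by omega) h1
            have := hinj _ _ (by omega) (by omega) h2
            omega
        refine .inr (.inr (hd _ _ ⟨hb, ?_, ?_⟩))
        · have : ∀ j ≤ i, G.Conn (w i) (w (i + 1)) (w 0) (w j) := by
            intro j
            induction j with
            | zero => exact fun _ => .refl
            | succ j ihj => exact fun hj => (ihj (by omega)).tail (off j (by omega) (by omega))
          exact this i le_rfl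
        · have : ∀ j, i + 1 + j ≤ k → G.Conn (w i) (w (i + 1)) (w (i + 1)) (w (i + 1 + j)) := by
            intro j
            induction j with
            | zero => exact fun _ => .refl
            | succ j ihj =>
              exact fun hj => (ihj (by omega)).tail (off (i + 1 + j) (by omega) (by omega))
          have := this (k - (i + 1)) (by omega)
          rwa [show i + 1 + (k - (i + 1)) = k by omega] at this
      · exact .inr (.inl ⟨hw i (by omega), hb⟩)
  exact main k le_rfl

/-- If an edge `{u, v}` lies on a mixed cycle, and may be used in both directions, then the edges
of this cycle can be reoriented along the cycle. -/
theorem exists_reorientation {D : V → V → Prop} (hE : ∀ x y, D x y → G.E x y)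
    (hD : ∀ x y, G.E x y → D x y ∨ D y x) (huv : D u v) (hne : u ≠ v)
    (h : G.Reach u v v u) : ∃ D' : V → V → Prop, (∀ x y, D' x y → G.E x y) ∧
      (∀ x y, G.E x y → D' x y ∨ D' y x) ∧
      (∀ x y, x ≠ y → D' x y → D' y x → D x y ∧ D y x) ∧ ¬ (D' u v ∧ D' v u) ∧
      ∀ p q, ReflTransGen (fun x y => G.A x y ∨ D x y) p q →
        ReflTransGen (fun x y => G.A x y ∨ D' x y) p q := by
  obtain ⟨k, w, hw0, hwk, hw, hinj⟩ := exists_injective_walk h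
  let C : V → V → Prop := fun x y =>
    (G.Off u v x y ∧ ∃ i < k, w i = x ∧ w (i + 1) = y) ∨ (x = u ∧ y = v)
  have hCE : ∀ x y, C x y → G.E x y := by
    rintro x y (⟨h, -⟩ | ⟨rfl, rfl⟩)
    · exact h.1
    · exact hE _ _ huv
  have hC : ∀ x y, C x y → ¬ C y x := by
    rintro x y (⟨h1, i, hi, hix, hiy⟩ | ⟨rfl, rfl⟩) (⟨h2, j, hj, hjy, hjx⟩ | ⟨h3, h4⟩)
    · have := hinj _ _ (by omega) (by omega) (hiy.trans hjy.symm)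
      have := hinj _ _ (by omega) (by omega) (hix.trans hjx.symm)
      omega
    · exact h1.2.2 ⟨h4, h3⟩
    · exact h2.2.2 ⟨rfl, rfl⟩
    · exact hne h4
  refine ⟨fun x y => C x y ∨ (D x y ∧ ¬ C y x), ?_, ?_, ?_, ?_, ?_⟩
  · rintro x y (h | h)
    exacts [hCE x y h, hE x y h.1]
  · intro x y hxy
    by_cases h1 : C x y
    · exact .inl (.inl h1)
    by_cases h2 : C y x
    · exact .inr (.inl h2)
    · exact (hD x y hxy).imp (fun h => .inr ⟨h, h2⟩) fun h => .inr ⟨h, h1⟩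
  · rintro x y - (h1 | h1) (h2 | h2)
    exacts [absurd h2 (hC x y h1), absurd h1 h2.2, absurd h2 h1.2, ⟨h1.1, h2.1⟩]
  · rintro ⟨-, h | h⟩
    · exact hC u v (.inr ⟨rfl, rfl⟩) h
    · exact h.2 (.inr ⟨rfl, rfl⟩)
  · set S' : V → V → Prop := fun x y => G.A x y ∨ C x y ∨ (D x y ∧ ¬ C y x) with hS'
    have h1 : ∀ d i, i + d ≤ k → ReflTransGen S' (w i) (w (i + d)) := by
      intro d
      induction d with
      | zero => exact fun i _ => .refl
      | succ d ih =>
        intro i hi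
        refine (ih i (by omega)).tail ?_
        rcases hw (i + d) (by omega) with h | h
        · exact .inl h
        · exact .inr (.inl (.inl ⟨h, i + d, by omega, rfl, rfl⟩))
    have h2 : S' (w k) (w 0) := .inr (.inl (.inr ⟨hwk, hw0⟩))
    have h3 : ∀ i j, i ≤ k → j ≤ k → ReflTransGen S' (w i) (w j) := by
      intro i j hi hj
      have e1 := h1 (k - i) i (by omega)
      have e2 := h1 j 0 (by omega)
      rw [show i + (k - i) = k by omega] at e1
      rw [Nat.zero_add] at e2
      exact (e1.tail h2).trans e2
    intro p q hpq
    induction hpq with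
    | refl => exact .refl
    | @tail x y _ hxy ih =>
      refine ih.trans ?_
      rcases hxy with h | h
      · exact .single (.inl h)
      · by_cases hyx : C y x
        · rcases hyx with ⟨-, i, hi, rfl, rfl⟩ | ⟨rfl, rfl⟩
          · exact h3 _ _ (by omega) (by omega)
          · rw [← hwk, ← hw0]
            exact h3 _ _ (by omega) (by omega)
        · exact .single (.inr (.inr ⟨h, hyx⟩))

/-- The edges on mixed cycles may be used in both directions: there is an orientation of all edges
that preserves reachability. -/
theorem IsOri.exists_orientation [Finite V] {O : V → V → Prop} (hO : G.IsOri O) :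
    ∃ D : V → V → Prop, (∀ x y, D x y → G.E x y) ∧ (∀ x y, G.E x y → D x y ∨ D y x) ∧
      (∀ x y, D x y → D y x → x = y) ∧ ∀ p q, ReflTransGen (G.Step O) p q →
        ReflTransGen (fun x y => G.A x y ∨ D x y) p q := by
  -- reduce the number of edges that are used in both directions
  have key : ∀ (k : ℕ) (D : V → V → Prop), {e : V × V | e.1 ≠ e.2 ∧ D e.1 e.2 ∧ D e.2 e.1}.ncard = k →
      (∀ x y, D x y → G.E x y) → (∀ x y, G.E x y → D x y ∨ D y x) →
      (∀ x y, x ≠ y → D x y → D y x → G.Flex x y) → (∀ p q, ReflTransGen (G.Step O) p q →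
        ReflTransGen (fun x y => G.A x y ∨ D x y) p q) →
      ∃ D : V → V → Prop, (∀ x y, D x y → G.E x y) ∧ (∀ x y, G.E x y → D x y ∨ D y x) ∧
      (∀ x y, D x y → D y x → x = y) ∧ ∀ p q, ReflTransGen (G.Step O) p q →
        ReflTransGen (fun x y => G.A x y ∨ D x y) p q := by
    intro k
    induction k using Nat.strong_induction_on with
    | _ k ih =>
      intro D hk hE hD hF hR
      by_cases hdone : ∀ x y, D x y → D y x → x = y
      · exact ⟨D, hE, hD, hdone, hR⟩
      push Not at hdone
      obtain ⟨u, v, huv, hvu, hne⟩ := hdone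
      have step : ∀ u v, D u v → D v u → u ≠ v → G.Reach u v v u →
          ∃ D : V → V → Prop, (∀ x y, D x y → G.E x y) ∧ (∀ x y, G.E x y → D x y ∨ D y x) ∧
          (∀ x y, D x y → D y x → x = y) ∧ ∀ p q, ReflTransGen (G.Step O) p q →
          ReflTransGen (fun x y => G.A x y ∨ D x y) p q := by
        intro u v huv hvu hne hr
        obtain ⟨D', hE', hD', hdbl, hnot, hR'⟩ := exists_reorientation hE hD huv hne hr
        refine ih _ ?_ D' rfl hE' hD'
          (fun x y hxy h1 h2 => hF x y hxy (hdbl x y hxy h1 h2).1 (hdbl x y hxy h1 h2).2)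
          fun p q h => hR' p q (hR p q h)
        rw [← hk]
        refine Set.ncard_lt_ncard ⟨?_, fun hs => ?_⟩ (Set.toFinite _)
        · rintro ⟨x, y⟩ ⟨hxy, h1, h2⟩
          exact ⟨hxy, hdbl x y hxy h1 h2⟩
        · have : (u, v) ∈ {e : V × V | e.1 ≠ e.2 ∧ D' e.1 e.2 ∧ D' e.2 e.1} :=
            hs ⟨hne, huv, hvu⟩
          exact hnot this.2
      have hnb : ¬ (¬ G.Reach u v u v ∧ ¬ G.Reach u v v u) := fun h =>
        (hF u v hne huv hvu).2 ⟨hE u v huv, h⟩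
      by_cases h : G.Reach u v v u
      · exact step u v huv hvu hne h
      · exact step v u hvu huv hne.symm (reach_comm.1 (by_contra fun h' => hnb ⟨h', h⟩))
  refine key _ (fun x y => G.Flex x y ∨ O x y) rfl ?_ ?_ ?_ ?_
  · rintro x y (h | h)
    exacts [h.1, (hO.sub h).1]
  · intro x y hxy
    by_cases hb : G.Bridge x y
    · exact (hO.total hb).imp .inr .inr
    · exact .inl (.inl ⟨hxy, hb⟩)
  · rintro x y - (h | h) (h' | h')
    exacts [h, h, h'.symm, absurd h' (hO.asymm h)]
  · exact fun p q h => h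

end MixedRel

/-! ### Two-satisfiability -/

/-- The criterion for two-satisfiability. If no literal of `F` forces its negation and is forced by
it, then there is a consistent set of literals that is closed under implication and contains each
literal of `F` or its negation. -/
theorem exists_consistent_closed {L : Type*} [Finite L] {neg : L → L} (hneg : ∀ a, neg (neg a) = a)
    {Imp : L → L → Prop} (hImp : ∀ a b, Imp a b → Imp (neg b) (neg a)) {F : L → Prop}
    (hF : ∀ a, F a → ¬ (ReflTransGen Imp a (neg a) ∧ ReflTransGen Imp (neg a) a)) :
    ∃ S : Set L, (∀ a b, a ∈ S → Imp a b → b ∈ S) ∧ (∀ a, a ∈ S → neg a ∉ S) ∧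
      ∀ a, F a → a ∈ S ∨ neg a ∈ S := by
  let good : Set (Set L) := {S | (∀ a b, a ∈ S → Imp a b → b ∈ S) ∧ ∀ a, a ∈ S → neg a ∉ S}
  obtain ⟨S, -, ⟨⟨hcl, hco⟩, hmax⟩⟩ := (Set.toFinite good).exists_le_maximal
    (show ∅ ∈ good from ⟨by simp, by simp⟩)
  have hImp' : ∀ a b, ReflTransGen Imp a b → ReflTransGen Imp (neg b) (neg a) := by
    intro a b h
    induction h with
    | refl => exact .refl
    | tail _ hbc ih => exact .head (hImp _ _ hbc) ih
  have hcl' : ∀ a b, a ∈ S → ReflTransGen Imp a b → b ∈ S := by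
    intro a b ha h
    induction h with
    | refl => exact ha
    | tail _ hbc ih => exact hcl _ _ ih hbc
  -- a literal that does not force its negation can be added to a maximal set
  have add : ∀ a, neg a ∉ S → ¬ ReflTransGen Imp a (neg a) → a ∈ S := by
    intro a hna hW
    refine hmax (y := S ∪ {b | ReflTransGen Imp a b}) ⟨?_, ?_⟩ Set.subset_union_left (.inr .refl)
    · rintro b c (hb | hb) hbc
      · exact .inl (hcl b c hb hbc)
      · exact .inr (ReflTransGen.tail hb hbc)
    · rintro b (hb | hb) (hb' | hb')
      · exact hco b hb hb'
      · have := hImp' _ _ hb'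
        rw [hneg] at this
        exact hna (hcl' _ _ hb this)
      · exact hna (hcl' _ _ hb' (hImp' _ _ hb))
      · have := hImp' _ _ hb'
        rw [hneg] at this
        exact hW (ReflTransGen.trans hb this)
  refine ⟨S, hcl, hco, fun a ha => ?_⟩
  by_contra hcon
  push Not at hcon
  rcases not_and_or.1 (hF a ha) with h | h
  · exact hcon.1 (add a hcon.2 h)
  · exact hcon.2 (add (neg a) (by rw [hneg]; exact hcon.1) (by rwa [hneg]))

/-- A disjunction of conjunctions `L p ∧ R q` of positive literals, where `L` and `R` take at most
two values each, is equivalent to the conjunction of the two-clauses that it implies. (Here `N` is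
the set of the literals that are not true.) -/
theorem exists_two_clause {ι α : Type*} {O : ι → ι → Prop} {L R : ι → Set α} {N : Set α}
    (hne : ∃ p q, O p q)
    (hL : ∀ p₁ q₁ p₂ q₂ p₃ q₃, O p₁ q₁ → O p₂ q₂ → O p₃ q₃ →
      L p₁ = L p₂ ∨ L p₃ = L p₁ ∨ L p₃ = L p₂)
    (hR : ∀ p₁ q₁ p₂ q₂ p₃ q₃, O p₁ q₁ → O p₂ q₂ → O p₃ q₃ →
      R q₁ = R q₂ ∨ R q₃ = R q₁ ∨ R q₃ = R q₂)
    (hN : ∀ p q, O p q → ∃ e ∈ N, e ∈ L p ∨ e ∈ R q) :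
    ∃ e ∈ N, ∃ f ∈ N, ∀ p q, O p q → (e ∈ L p ∨ e ∈ R q) ∨ (f ∈ L p ∨ f ∈ R q) := by
  obtain ⟨p₀, q₀, h₀⟩ := hne
  by_cases hLN : ∀ p q, O p q → ∃ e ∈ N, e ∈ L p
  · obtain ⟨e, he, heL⟩ := hLN p₀ q₀ h₀
    by_cases hall : ∀ p q, O p q → e ∈ L p
    · exact ⟨e, he, e, he, fun p q h => .inl (.inl (hall p q h))⟩
    push Not at hall
    obtain ⟨p₁, q₁, h₁, hne⟩ := hall
    obtain ⟨f, hf, hfL⟩ := hLN p₁ q₁ h₁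
    refine ⟨e, he, f, hf, fun p q h => ?_⟩
    rcases hL p₀ q₀ p₁ q₁ p q h₀ h₁ h with h' | h' | h'
    · exact absurd (h' ▸ heL) hne
    · exact .inl (.inl (h' ▸ heL))
    · exact .inr (.inl (h' ▸ hfL))
  by_cases hRN : ∀ p q, O p q → ∃ e ∈ N, e ∈ R q
  · obtain ⟨e, he, heR⟩ := hRN p₀ q₀ h₀
    by_cases hall : ∀ p q, O p q → e ∈ R q
    · exact ⟨e, he, e, he, fun p q h => .inl (.inr (hall p q h))⟩
    push Not at hall
    obtain ⟨p₁, q₁, h₁, hne⟩ := hall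
    obtain ⟨f, hf, hfR⟩ := hRN p₁ q₁ h₁
    refine ⟨e, he, f, hf, fun p q h => ?_⟩
    rcases hR p₀ q₀ p₁ q₁ p q h₀ h₁ h with h' | h' | h'
    · exact absurd (h' ▸ heR) hne
    · exact .inl (.inr (h' ▸ heR))
    · exact .inr (.inr (h' ▸ hfR))
  push Not at hLN hRN
  obtain ⟨p₁, q₁, h₁, hp₁⟩ := hLN
  obtain ⟨p₂, q₂, h₂, hq₂⟩ := hRN
  obtain ⟨f, hf, hfR⟩ : ∃ f ∈ N, f ∈ R q₁ := by
    obtain ⟨f, hf, hfL | hfR⟩ := hN p₁ q₁ h₁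
    exacts [absurd hfL (hp₁ f hf), ⟨f, hf, hfR⟩]
  obtain ⟨e, he, heL⟩ : ∃ e ∈ N, e ∈ L p₂ := by
    obtain ⟨e, he, heL | heR⟩ := hN p₂ q₂ h₂
    exacts [⟨e, he, heL⟩, absurd heR (hq₂ e he)]
  refine ⟨e, he, f, hf, fun p q h => ?_⟩
  rcases hL p₁ q₁ p₂ q₂ p q h₁ h₂ h with h' | h' | h'
  · exact absurd (h' ▸ heL) (hp₁ e he)
  · -- all literals of `L p` are true, so that `R q` contains one that is not
    rcases hR p₁ q₁ p₂ q₂ p q h₁ h₂ h with h'' | h'' | h''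
    · exact absurd (h'' ▸ hfR) (hq₂ f hf)
    · exact .inr (.inr (h'' ▸ hfR))
    · obtain ⟨g, hg, hgL | hgR⟩ := hN p q h
      · exact absurd (h' ▸ hgL) (hp₁ g hg)
      · exact absurd (h'' ▸ hgR) (hq₂ g hg)
  · exact .inl (.inl (h' ▸ heL))

namespace MixedRel

variable {V : Type*} {G : MixedRel V} {x y a b p q r s t u v : V}

/-! ### The ways from a vertex to the ends of arcs -/

theorem Par.symm (h : G.Par x y a b) : G.Par a b x y :=
  ⟨h.2.1, h.1, h.2.2.1.symm, fun r hr hc => (h.2.2.2 r hr (h.2.2.1.trans hc)).symm⟩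

theorem Par.trans (h : G.Par x y a b) (h' : G.Par a b u v) : G.Par x y u v :=
  ⟨h.1, h'.2.1, h.2.2.1.trans h'.2.2.1, fun r hr hc =>
    (h.2.2.2 r hr hc).trans (h'.2.2.2 r hr (h.2.2.1.symm.trans hc))⟩

theorem Par.refl (h : G.Bridge x y) : G.Par x y x y := ⟨h, h, .refl, fun _ _ _ => Iff.rfl⟩

/-- The second sides of parallel directed bridges contain the same ends of arcs. -/
theorem Par.snd (h : G.Par x y a b) (hr : G.End r) (hc : G.Comp x r) :
    G.Conn x y y r ↔ G.Conn a b b r := by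
  have h1 := h.2.2.2 r hr hc
  have hc' := h.2.2.1.symm.trans hc
  constructor
  · intro h2
    refine (conn_or_conn hc').resolve_left fun h3 => h.1.not_both (h1.2 h3) h2
  · intro h2
    refine (conn_or_conn hc).resolve_left fun h3 => h.2.1.not_both (h1.1 h3) h2

theorem Par.swap (h : G.Par x y a b) : G.Par y x b a := by
  refine ⟨h.1.symm, h.2.1.symm, h.1.comp.symm.trans (h.2.2.1.trans h.2.1.comp), fun r hr hc => ?_⟩
  rw [← conn_comm, ← conn_comm (x := a)]
  exact h.snd hr (h.1.comp.trans hc)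

theorem Sep.par (h : G.Sep x y) (h' : G.Par x y a b) : G.Sep a b := by
  obtain ⟨p, q, hp, hq, hb, hpx, hyq⟩ := h
  have hp' := (h'.2.2.2 p hp hpx.symm.comp).1 hpx.symm
  have hq' := (h'.snd hq (h'.1.comp.trans hyq.comp)).1 hyq
  exact ⟨p, q, hp, hq, h'.2.1, hp'.symm, hq'⟩

theorem Sep.swap (h : G.Sep x y) : G.Sep y x := by
  obtain ⟨p, q, hp, hq, hd⟩ := h
  exact ⟨q, p, hq, hp, hd.swap⟩

theorem Sep.bridge (h : G.Sep x y) : G.Bridge x y := by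
  obtain ⟨p, q, hp, hq, hd⟩ := h
  exact hd.1

variable (G) in
/-- If all directed bridges of a parallel class are used by the walks from `s` to `p`, then they
lie in `Y`. -/
def Feas (Y : V → V → Prop) (s p : V) : Prop :=
  ∀ x y, G.Sep x y → (∀ x' y', G.Par x y x' y' → G.Dir s p x' y') → Y x y

theorem Feas.swap {Y : V → V → Prop} (h : G.Feas Y p s) : G.Feas (fun x y => Y y x) s p :=
  fun x y hxy hd => h y x hxy.swap fun x' y' hp => (hd y' x' hp.swap).swap

/-- If a bridge separates `s` and the end `p₂` from the ends `p₁` and `p₃`, then the walks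
from `s` to `p₁` and to `p₃` use the same bridges outside of `Y`. -/
theorem Feas.dir_of_dir {Y : V → V → Prop} {p₁ p₂ p₃ : V} (h₁ : G.Feas Y s p₁)
    (hp₁ : G.End p₁) (hp₂ : G.End p₂) (hp₃ : G.End p₃) (hxy : G.Bridge x y) (hs : G.Conn x y x s)
    (hx₂ : G.Conn x y x p₂) (hy₁ : G.Conn x y y p₁) (hy₃ : G.Conn x y y p₃)
    (hab : G.Dir s p₁ a b) (hY : ¬ Y a b) : G.Dir s p₃ a b := by
  by_contra h₃
  have hs2 : G.Comp s p₂ := hs.symm.comp.trans hx₂.comp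
  have hs3 : G.Comp s p₃ := hs.symm.comp.trans (hxy.comp.trans hy₃.comp)
  have has : G.Comp a s := hab.2.1.symm.comp
  have ha₃ : G.Conn a b a p₃ :=
    (conn_or_conn (has.trans hs3)).resolve_right fun h => h₃ ⟨hab.1, hab.2.1, h⟩
  -- the bridge `(a, b)` has a parallel `(a', b')` with `s` between the two
  have hsep : G.Sep a b := ⟨p₃, p₁, hp₃, hp₁, hab.1, ha₃.symm, hab.2.2⟩
  have : ¬ ∀ a' b', G.Par a b a' b' → G.Dir s p₁ a' b' := fun h => hY (h₁ a b hsep h)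
  push Not at this
  obtain ⟨a', b', hpar, hnd⟩ := this
  have hb1 : G.Conn a' b' b' p₁ :=
    (hpar.snd hp₁ (has.trans (hab.comp))).1 hab.2.2
  have ha3 : G.Conn a' b' a' p₃ := (hpar.2.2.2 p₃ hp₃ (has.trans hs3)).1 ha₃
  have hbs : G.Conn a' b' b' s := (conn_or_conn (hpar.2.2.1.symm.trans has)).resolve_left
    fun h => hnd ⟨hpar.2.1, h.symm, hb1⟩
  -- then `p₂` would be on the sides of both `p₁` and `p₃`
  have h2 : G.Conn a b a p₂ := (conn_or_conn (has.trans hs2)).resolve_right fun h =>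
    not_cross hxy hab.1 hs hab.2.1.symm hx₂ h hy₃ ha₃ hy₁ hab.2.2
  have h2' : G.Conn a' b' a' p₂ := (hpar.2.2.2 p₂ hp₂ (has.trans hs2)).1 h2
  exact not_cross hxy hpar.2.1 hx₂ h2' hs hbs hy₃ ha3 hy₁ hb1

/-- For every vertex `s`, the set of bridges outside of `Y` that are used by the walks from `s` to a
feasible end `p` takes at most two values. -/
theorem Feas.two_values {Y : V → V → Prop} {p₁ p₂ p₃ : V} (h₁ : G.Feas Y s p₁)
    (h₂ : G.Feas Y s p₂) (h₃ : G.Feas Y s p₃) (hp₁ : G.End p₁) (hp₂ : G.End p₂) (hp₃ : G.End p₃)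
    (hs₁ : G.Comp s p₁) (hs₂ : G.Comp s p₂) (hs₃ : G.Comp s p₃) :
    let S : V → Set (V × V) := fun p => {e | G.Dir s p e.1 e.2 ∧ ¬ Y e.1 e.2}
    S p₁ = S p₂ ∨ S p₃ = S p₁ ∨ S p₃ = S p₂ := by
  intro S
  have key : ∀ {p₁ p₂ : V}, G.Feas Y s p₁ → G.Feas Y s p₂ → G.End p₁ → G.End p₂ → G.Comp s p₁ →
      G.Comp s p₂ → ∀ e ∈ S p₁, e ∉ S p₂ → S p₃ = S p₁ ∨ S p₃ = S p₂ := by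
    rintro p₁ p₂ h₁ h₂ hp₁ hp₂ hs₁ hs₂ ⟨x, y⟩ ⟨hd, hY⟩ hnot
    dsimp only at hd hY
    have hxs : G.Comp x s := hd.2.1.symm.comp
    have hx₂ : G.Conn x y x p₂ :=
      (conn_or_conn (hxs.trans hs₂)).resolve_right fun h => hnot ⟨⟨hd.1, hd.2.1, h⟩, hY⟩
    rcases conn_or_conn (y := y) (hxs.trans hs₃) with hx₃ | hy₃
    · right
      have hsep : G.Sep x y := ⟨p₂, p₁, hp₂, hp₁, hd.1, hx₂.symm, hd.2.2⟩
      have : ¬ ∀ a' b', G.Par x y a' b' → G.Dir s p₁ a' b' := fun h => hY (h₁ x y hsep h)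
      push Not at this
      obtain ⟨x', y', hpar, hnd⟩ := this
      have hy1' : G.Conn x' y' y' p₁ := (hpar.snd hp₁ (hxs.trans hs₁)).1 hd.2.2
      have hx2' : G.Conn x' y' x' p₂ := (hpar.2.2.2 p₂ hp₂ (hxs.trans hs₂)).1 hx₂
      have hx3' : G.Conn x' y' x' p₃ := (hpar.2.2.2 p₃ hp₃ (hxs.trans hs₃)).1 hx₃
      have hys' : G.Conn x' y' y' s := (conn_or_conn (hpar.2.2.1.symm.trans hxs)).resolve_left
        fun h => hnd ⟨hpar.2.1, h.symm, hy1'⟩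
      rw [conn_comm] at hy1' hx2' hx3' hys'
      ext ⟨a, b⟩
      exact ⟨fun ⟨h, hn⟩ => ⟨h₃.dir_of_dir hp₃ hp₁ hp₂ hpar.2.1.symm hys' hy1' hx3' hx2' h hn, hn⟩,
        fun ⟨h, hn⟩ => ⟨h₂.dir_of_dir hp₂ hp₁ hp₃ hpar.2.1.symm hys' hy1' hx2' hx3' h hn, hn⟩⟩
    · left
      ext ⟨a, b⟩
      exact ⟨fun ⟨h, hn⟩ => ⟨h₃.dir_of_dir hp₃ hp₂ hp₁ hd.1 hd.2.1.symm hx₂ hy₃ hd.2.2 h hn, hn⟩,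
        fun ⟨h, hn⟩ => ⟨h₁.dir_of_dir hp₁ hp₂ hp₃ hd.1 hd.2.1.symm hx₂ hd.2.2 hy₃ h hn, hn⟩⟩
  by_cases h12 : S p₁ ⊆ S p₂
  · by_cases h21 : S p₂ ⊆ S p₁
    · exact .inl (h12.antisymm h21)
    · obtain ⟨e, he, hne⟩ := Set.not_subset.1 h21
      exact .inr (key h₂ h₁ hp₂ hp₁ hs₂ hs₁ e he hne).symm
  · obtain ⟨e, he, hne⟩ := Set.not_subset.1 h12
    exact .inr (key h₁ h₂ hp₁ hp₂ hs₁ hs₂ e he hne)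

/-! ### The test of a guess -/

section Guess

variable (G) (T : V → V → Prop) (X : V → V → Prop)

/-- The directed bridges that are parallel to one in the guess `X`. -/
def Hat (x y : V) : Prop := ∃ x' y', X x' y' ∧ G.Par x' y' x y

/-- Reachability by arcs, edges on mixed cycles, and bridges oriented by the guess. -/
def Run : V → V → Prop := ReflTransGen (G.Step (G.Hat X))

/-- A path from `s` to `t` may leave the component of `s` at `p` and enter that of `t` at `q`. -/
def Opt (s t p q : V) : Prop :=
  G.End p ∧ G.End q ∧ G.Comp s p ∧ G.Comp q t ∧ G.Feas (G.Hat X) s p ∧ G.Feas (G.Hat X) q t ∧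
    G.Run X p q

/-- The orientation of bridges has to contain `(x, y)` or `(x', y')`: either both are equal to a
bridge whose direction is forced, or some terminal pair has only options that use one of them. -/
def Clause (x y x' y' : V) : Prop :=
  G.Bridge x y ∧ G.Bridge x' y' ∧
    (((x = x' ∧ y = y') ∧ (G.Hat X x y ∨ ∃ s t, T s t ∧ G.Comp s t ∧ G.Dir s t x y)) ∨
      ∃ s t, T s t ∧ ¬ G.Comp s t ∧ ∀ p q, G.Opt X s t p q →
        (G.Dir s p x y ∨ G.Dir q t x y) ∨ (G.Dir s p x' y' ∨ G.Dir q t x' y'))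

/-- By the clauses, an orientation that contains `(x, y)` also contains `(x', y')`. -/
def Forces (x y x' y' : V) : Prop :=
  ReflTransGen (fun e f : V × V => G.Clause T X e.2 e.1 f.1 f.2) (x, y) (x', y')

/-- The guess `X` passes the test: every terminal pair has an option, and the clauses are
satisfiable. -/
def Accepts : Prop :=
  (∀ s t, T s t → ¬ G.Comp s t → ∃ p q, G.Opt X s t p q) ∧
    ∀ x y, G.Bridge x y → ¬ (G.Forces T X x y y x ∧ G.Forces T X y x x y)

end Guess

theorem Clause.symm {T X : V → V → Prop} (h : G.Clause T X x y a b) : G.Clause T X a b x y := by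
  obtain ⟨h1, h2, ⟨⟨rfl, rfl⟩, h⟩ | ⟨s, t, hT, hc, h⟩⟩ := h
  · exact ⟨h2, h1, .inl ⟨⟨rfl, rfl⟩, h⟩⟩
  · exact ⟨h2, h1, .inr ⟨s, t, hT, hc, fun p q ho => (h p q ho).symm⟩⟩

/-- A guess that passes the test yields an orientation of the bridges. -/
theorem Accepts.exists_isOri [Finite V] {T X : V → V → Prop} (h : G.Accepts T X) :
    ∃ O, G.IsOri O ∧ ∀ s t, T s t → ReflTransGen (G.Step O) s t := by
  obtain ⟨hopt, hsat⟩ := h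
  obtain ⟨S, hcl, hco, htot⟩ := exists_consistent_closed (L := V × V) (neg := Prod.swap)
    (Imp := fun e f => G.Clause T X e.2 e.1 f.1 f.2) (F := fun e => G.Bridge e.1 e.2)
    (fun e => Prod.swap_swap e) (fun e f h => h.symm) (fun e he => hsat e.1 e.2 he)
  have hO : G.IsOri fun x y => G.Bridge x y ∧ (x, y) ∈ S :=
    ⟨fun h => h.1, fun h h' => hco _ h.2 h'.2,
      fun {x y} h => (htot (x, y) h).imp (fun h' => ⟨h, h'⟩) fun h' => ⟨h.symm, h'⟩⟩
  have hclause : ∀ x y a b, G.Clause T X x y a b → (x, y) ∈ S ∨ (a, b) ∈ S := by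
    intro x y a b h
    rcases htot (x, y) h.1 with h' | h'
    · exact .inl h'
    · exact .inr (hcl (y, x) (a, b) h' h)
  have hhat : ∀ x y, G.Hat X x y → G.Bridge x y ∧ (x, y) ∈ S := by
    intro x y h
    have hb : G.Bridge x y := by
      obtain ⟨_, _, -, hp⟩ := h
      exact hp.2.1
    exact ⟨hb, or_self_iff.1 (hclause x y x y ⟨hb, hb, .inl ⟨⟨rfl, rfl⟩, .inl h⟩⟩)⟩
  refine ⟨_, hO, fun s t hT => ?_⟩
  by_cases hc : G.Comp s t
  · refine reach_of_dir hc fun x y hd => ⟨hd.1, or_self_iff.1 (hclause x y x y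
      ⟨hd.1, hd.1, .inl ⟨⟨rfl, rfl⟩, .inr ⟨s, t, hT, hc, hd⟩⟩⟩)⟩
  by_contra hno
  let L : V → Set (V × V) := fun p => {e | G.Dir s p e.1 e.2 ∧ ¬ G.Hat X e.1 e.2}
  let R : V → Set (V × V) := fun q => {e | G.Dir q t e.1 e.2 ∧ ¬ G.Hat X e.1 e.2}
  have two := exists_two_clause (O := G.Opt X s t) (L := L) (R := R)
    (N := {e | G.Bridge e.1 e.2 ∧ e ∉ S}) (hopt s t hT hc) ?_ ?_ ?_
  · obtain ⟨⟨x, y⟩, ⟨he, heN⟩, ⟨a, b⟩, ⟨hf, hfN⟩, hhit⟩ := two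
    refine (hclause x y a b ⟨he, hf, .inr ⟨s, t, hT, hc, fun p q ho => ?_⟩⟩).elim heN hfN
    exact (hhit p q ho).imp (Or.imp (·.1) (·.1)) (Or.imp (·.1) (·.1))
  · rintro p₁ q₁ p₂ q₂ p₃ q₃ h₁ h₂ h₃
    exact Feas.two_values h₁.2.2.2.2.1 h₂.2.2.2.2.1 h₃.2.2.2.2.1 h₁.1 h₂.1 h₃.1
      h₁.2.2.1 h₂.2.2.1 h₃.2.2.1
  · rintro p₁ q₁ p₂ q₂ p₃ q₃ h₁ h₂ h₃
    -- walks to `t` are reversed walks from `t`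
    have hRR : ∀ q, R q = Prod.swap ⁻¹' {e | G.Dir t q e.1 e.2 ∧ ¬ G.Hat X e.2 e.1} := by
      intro q
      ext ⟨x, y⟩
      exact and_congr_left fun _ => dir_swap
    rw [hRR, hRR, hRR]
    exact (Feas.two_values h₁.2.2.2.2.2.1.swap h₂.2.2.2.2.2.1.swap h₃.2.2.2.2.2.1.swap
      h₁.2.1 h₂.2.1 h₃.2.1 h₁.2.2.2.1.symm h₂.2.2.2.1.symm h₃.2.2.2.1.symm).imp (congrArg _)
      (Or.imp (congrArg _) (congrArg _))
  · intro p q ho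
    by_contra hcon
    push Not at hcon
    refine hno (((reach_of_dir ho.2.2.1 fun x y hd => ?_).trans
      (ReflTransGen.mono ?_ _ _ ho.2.2.2.2.2.2)).trans (reach_of_dir ho.2.2.2.1 fun x y hd => ?_))
    · refine ⟨hd.1, by_contra fun hS => ?_⟩
      have := (hcon (x, y) ⟨hd.1, hS⟩).1
      exact this ⟨hd, fun hH => hS (hhat x y hH).2⟩
    · rintro x y (h | h | h)
      exacts [.inl h, .inr (.inl h), .inr (.inr (hhat x y h))]
    · refine ⟨hd.1, by_contra fun hS => ?_⟩
      have := (hcon (x, y) ⟨hd.1, hS⟩).2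
      exact this ⟨hd, fun hH => hS (hhat x y hH).2⟩

section Rep

variable [LinearOrder V]

variable (G) in
/-- The bridge `(x, y)` separates two ends of arcs, and is the lexicographically least of its
parallel class. -/
def Rep (x y : V) : Prop :=
  G.Sep x y ∧ ∀ x' y', G.Par x y x' y' → ¬ x' < x ∧ ¬ (x' = x ∧ y' < y)

theorem Sep.exists_rep [Finite V] (h : G.Sep x y) : ∃ a b, G.Rep a b ∧ G.Par a b x y := by
  let S : Set (V ×ₗ V) := {e | G.Par (ofLex e).1 (ofLex e).2 x y}
  have : Finite (V ×ₗ V) := inferInstanceAs (Finite (V × V))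
  obtain ⟨e, he, hmin⟩ := (Set.toFinite S).exists_minimal
    ⟨toLex (x, y), Par.refl h.bridge⟩
  refine ⟨(ofLex e).1, (ofLex e).2, ⟨h.par he.symm, fun x' y' hp => ?_⟩, he⟩
  have hmem : toLex (x', y') ∈ S := hp.symm.trans he
  have hle : ¬ toLex (x', y') < e := fun hlt => (hmin hmem hlt.le).not_gt hlt
  rw [Prod.Lex.lt_iff] at hle
  simpa [not_or] using hle

theorem Rep.eq_of_par (h : G.Rep x y) (h' : G.Rep a b) (hp : G.Par x y a b) : x = a ∧ y = b := by
  have h1 := h.2 a b hp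
  have h2 := h'.2 x y hp.symm
  obtain rfl : x = a := le_antisymm (not_lt.1 h1.1) (not_lt.1 h2.1)
  exact ⟨rfl, le_antisymm (not_lt.1 fun h => h1.2 ⟨rfl, h⟩) (not_lt.1 fun h => h2.2 ⟨rfl, h⟩)⟩

/-- From an orientation of the bridges, the guess is the set of the parallel classes that it
contains. -/
theorem IsOri.exists_accepts [Finite V] {T O : V → V → Prop} (hO : G.IsOri O)
    (h : ∀ s t, T s t → ReflTransGen (G.Step O) s t) :
    ∃ X : V → V → Prop, (∀ x y, X x y → G.Rep x y) ∧ G.Accepts T X := by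
  let X : V → V → Prop := fun x y => G.Rep x y ∧ ∀ x' y', G.Par x y x' y' → O x' y'
  have hhat : ∀ x y, G.Sep x y → (∀ x' y', G.Par x y x' y' → O x' y') → G.Hat X x y := by
    intro x y hs hp
    obtain ⟨a, b, hr, hab⟩ := hs.exists_rep
    exact ⟨a, b, ⟨hr, fun x' y' h => hp x' y' (hab.symm.trans h)⟩, hab⟩
  have hhat' : ∀ x y, G.Hat X x y → O x y := by
    rintro x y ⟨a, b, ⟨-, hp⟩, hab⟩
    exact hp x y hab
  have hfeas : ∀ p q, ReflTransGen (G.Step O) p q → G.Feas (G.Hat X) p q := by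
    intro p q hpq x y hs hp
    exact hhat x y hs fun x' y' h' => hO.of_dir hpq (hp x' y' h')
  -- between ends of arcs, the guess determines reachability
  have hrun : ∀ p, G.End p → ∀ z, ReflTransGen (G.Step O) p z →
      ∃ q, G.End q ∧ G.Run X p q ∧ G.Comp q z ∧ ReflTransGen (G.Step O) q z := by
    intro p hp z hz
    induction hz with
    | refl => exact ⟨p, hp, .refl, .refl, .refl⟩
    | @tail b c _ hbc ih =>
      obtain ⟨q, hq, hpq, hqb, hqb'⟩ := ih
      rcases hbc with h | h | h
      · have hb : G.End b := ⟨c, .inl h⟩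
        refine ⟨c, ⟨b, .inr h⟩, ReflTransGen.tail (hpq.trans (reach_of_dir hqb fun x y hd => ?_))
          (.inl h), .refl, .refl⟩
        refine hhat x y ⟨q, b, hq, hb, hd⟩ fun x' y' hpar => hO.of_dir hqb' ⟨hpar.2.1, ?_, ?_⟩
        · exact ((hpar.2.2.2 q hq hd.2.1.symm.comp).1 hd.2.1.symm).symm
        · exact (hpar.snd hb (hd.2.1.symm.comp.trans hqb)).1 hd.2.2
      · exact ⟨q, hq, hpq, hqb.tail h.1, hqb'.tail (.inr (.inl h))⟩
      · exact ⟨q, hq, hpq, hqb.tail (hO.sub h).1, hqb'.tail (.inr (.inr h))⟩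
  have hrun' : ∀ p q, G.End p → G.End q → ReflTransGen (G.Step O) p q → G.Run X p q := by
    intro p q hp hq hpq
    obtain ⟨r, hr, hpr, hrq, hrq'⟩ := hrun p hp q hpq
    refine hpr.trans (reach_of_dir hrq fun x y hd => ?_)
    refine hhat x y ⟨r, q, hr, hq, hd⟩ fun x' y' hpar => hO.of_dir hrq' ⟨hpar.2.1, ?_, ?_⟩
    · exact ((hpar.2.2.2 r hr hd.2.1.symm.comp).1 hd.2.1.symm).symm
    · exact (hpar.snd hq (hd.2.1.symm.comp.trans hrq)).1 hd.2.2
  have hstep : ∀ u v, G.Step O u v → G.A u v ∨ G.E u v := by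
    rintro u v (h | h | h)
    exacts [.inl h, .inr h.1, .inr (hO.sub h).1]
  have hfirst : ∀ s t, ReflTransGen (G.Step O) s t → G.Comp s t ∨
      ∃ p, G.End p ∧ G.Comp s p ∧ ReflTransGen (G.Step O) s p ∧ ReflTransGen (G.Step O) p t := by
    intro s t hst
    induction hst using ReflTransGen.head_induction_on with
    | refl => exact .inl .refl
    | @head s u hsu hut ih =>
      rcases hstep s u hsu with hA | hE
      · exact .inr ⟨s, ⟨u, .inl hA⟩, .refl, .refl, .head hsu hut⟩
      · rcases ih with ih | ⟨p, hp, h1, h2, h3⟩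
        · exact .inl (.head hE ih)
        · exact .inr ⟨p, hp, .head hE h1, .head hsu h2, h3⟩
  have hlast : ∀ s t, ReflTransGen (G.Step O) s t → G.Comp s t ∨
      ∃ q, G.End q ∧ G.Comp q t ∧ ReflTransGen (G.Step O) s q ∧ ReflTransGen (G.Step O) q t := by
    intro s t hst
    induction hst with
    | refl => exact .inl .refl
    | @tail b c hsb hbc ih =>
      rcases hstep b c hbc with hA | hE
      · exact .inr ⟨c, ⟨b, .inr hA⟩, .refl, hsb.tail hbc, .refl⟩
      · rcases ih with ih | ⟨q, hq, h1, h2, h3⟩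
        · exact .inl (ih.tail hE)
        · exact .inr ⟨q, hq, h1.tail hE, h2, h3.tail hbc⟩
  have hopt : ∀ s t, T s t → ¬ G.Comp s t → ∃ p q, G.Opt X s t p q ∧
      ReflTransGen (G.Step O) s p ∧ ReflTransGen (G.Step O) q t := by
    intro s t hT hc
    obtain ⟨p, hp, hsp, hsp', hpt⟩ := (hfirst s t (h s t hT)).resolve_left hc
    obtain ⟨q, hq, hqt, hpq, hqt'⟩ := (hlast p t hpt).resolve_left fun h => hc (hsp.trans h)
    exact ⟨p, q, ⟨hp, hq, hsp, hqt, hfeas s p hsp', hfeas q t hqt', hrun' p q hp hq hpq⟩, hsp', hqt'⟩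
  have hclause : ∀ x y a b, G.Clause T X x y a b → O x y ∨ O a b := by
    rintro x y a b ⟨-, -, ⟨⟨rfl, rfl⟩, hH | ⟨s, t, hT, -, hd⟩⟩ | ⟨s, t, hT, hc, hh⟩⟩
    · exact .inl (hhat' x y hH)
    · exact .inl (hO.of_dir (h s t hT) hd)
    · obtain ⟨p, q, ho, hsp, hqt⟩ := hopt s t hT hc
      rcases hh p q ho with (h | h) | (h | h)
      · exact .inl (hO.of_dir hsp h)
      · exact .inl (hO.of_dir hqt h)
      · exact .inr (hO.of_dir hsp h)
      · exact .inr (hO.of_dir hqt h)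
  have hforces : ∀ e f : V × V, ReflTransGen (fun e f : V × V => G.Clause T X e.2 e.1 f.1 f.2) e f →
      O e.1 e.2 → O f.1 f.2 := by
    intro e f hef he
    induction hef with
    | refl => exact he
    | @tail b c _ hbc ih => exact (hclause _ _ _ _ hbc).resolve_left (hO.asymm ih)
  refine ⟨X, fun x y h => h.1, fun s t hT hc => ?_, ?_⟩
  · obtain ⟨p, q, ho, -⟩ := hopt s t hT hc
    exact ⟨p, q, ho⟩
  · rintro x y hb ⟨h1, h2⟩
    rcases hO.total hb with h | h
    · exact hO.asymm h (hforces _ _ h1 h)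
    · exact hO.asymm h (hforces _ _ h2 h)

end Rep

end MixedRel

/-! ### The number of parallel classes -/

/-- A laminar family of nonempty subsets of `P` has at most `2 * |P|` members. -/
theorem card_le_of_laminar {α : Type*} [DecidableEq α] (P : Finset α) :
    ∀ 𝓛 : Finset (Finset α), (∀ S ∈ 𝓛, S.Nonempty ∧ S ⊆ P) →
      (∀ S ∈ 𝓛, ∀ T ∈ 𝓛, S ⊆ T ∨ T ⊆ S ∨ Disjoint S T) → 𝓛.card ≤ 2 * P.card := by
  induction P using Finset.induction_on with
  | empty =>
    intro 𝓛 h _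
    have : 𝓛 = ∅ := Finset.eq_empty_of_forall_notMem fun S hS => by
      obtain ⟨hne, hsub⟩ := h S hS
      exact hne.ne_empty (Finset.subset_empty.1 hsub)
    simp [this]
  | insert p P hp ih =>
    intro 𝓛 h hlam
    -- deleting `p` is injective, except for at most one set `S` such that `S.erase p` is in `𝓛`
    set bad := 𝓛.filter fun S => p ∈ S ∧ S.erase p ∈ 𝓛 with hbad
    have hbad1 : bad.card ≤ 1 := by
      have key : ∀ S ∈ bad, ∀ T ∈ bad, S ⊆ T → S = T := by
        intro S hS T hT hST
        rw [hbad, Finset.mem_filter] at hS hT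
        rcases hlam S hS.1 _ hT.2.2 with h' | h' | h'
        · exact absurd (h' hS.2.1) (Finset.notMem_erase p T)
        · refine hST.antisymm fun x hx => ?_
          rcases eq_or_ne x p with rfl | hne
          · exact hS.2.1
          · exact h' (Finset.mem_erase.2 ⟨hne, hx⟩)
        · obtain ⟨x, hx⟩ := (h _ hS.2.2).1
          rw [Finset.mem_erase] at hx
          exact absurd (Finset.mem_erase.2 ⟨hx.1, hST hx.2⟩) (Finset.disjoint_left.1 h' hx.2)
      refine Finset.card_le_one.2 fun S hS T hT => ?_
      have hS' := Finset.mem_filter.1 hS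
      have hT' := Finset.mem_filter.1 hT
      rcases hlam S hS'.1 T hT'.1 with h' | h' | h'
      · exact key S hS T hT h'
      · exact (key T hT S hS h').symm
      · exact absurd hT'.2.1 (Finset.disjoint_left.1 h' hS'.2.1)
    set 𝓛' := (𝓛.image fun S => S.erase p).erase ∅ with h𝓛'
    have hcard' : 𝓛'.card ≤ 2 * P.card := by
      refine ih 𝓛' (fun S hS => ?_) fun S hS T hT => ?_
      · rw [h𝓛', Finset.mem_erase, Finset.mem_image] at hS
        obtain ⟨hne, S, hS, rfl⟩ := hS
        refine ⟨Finset.nonempty_iff_ne_empty.2 hne, fun x hx => ?_⟩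
        rw [Finset.mem_erase] at hx
        exact (Finset.mem_insert.1 ((h S hS).2 hx.2)).resolve_left hx.1
      · rw [h𝓛', Finset.mem_erase, Finset.mem_image] at hS hT
        obtain ⟨-, S, hS, rfl⟩ := hS
        obtain ⟨-, T, hT, rfl⟩ := hT
        rcases hlam S hS T hT with h' | h' | h'
        · exact .inl (Finset.erase_subset_erase p h')
        · exact .inr (.inl (Finset.erase_subset_erase p h'))
        · exact .inr (.inr (h'.mono (Finset.erase_subset _ _) (Finset.erase_subset _ _)))
    have hmain : (𝓛 \ (bad ∪ {{p}})).card ≤ 𝓛'.card := by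
      refine Finset.card_le_card_of_injOn (fun S => S.erase p) (fun S hS => ?_) fun S hS T hT heq => ?_
      · rw [Finset.mem_coe, Finset.mem_sdiff, Finset.mem_union, Finset.mem_singleton] at hS
        rw [Finset.mem_coe, h𝓛', Finset.mem_erase]
        refine ⟨fun h0 => ?_, Finset.mem_image_of_mem _ hS.1⟩
        rcases Finset.erase_eq_empty_iff _ _ |>.1 h0 with h1 | h1
        · exact (h S hS.1).1.ne_empty h1
        · exact hS.2 (.inr h1)
      · rw [Finset.mem_coe, Finset.mem_sdiff, Finset.mem_union, hbad, Finset.mem_filter] at hS hT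
        dsimp only at heq
        by_cases hpS : p ∈ S <;> by_cases hpT : p ∈ T
        · rw [← Finset.insert_erase hpS, heq, Finset.insert_erase hpT]
        · refine absurd (.inl ⟨hS.1, hpS, ?_⟩) hS.2
          rw [heq, Finset.erase_eq_of_notMem hpT]
          exact hT.1
        · refine absurd (.inl ⟨hT.1, hpT, ?_⟩) hT.2
          rw [← heq, Finset.erase_eq_of_notMem hpS]
          exact hS.1
        · rw [← Finset.erase_eq_of_notMem hpS, heq, Finset.erase_eq_of_notMem hpT]
    have h1 : 𝓛.card ≤ (𝓛 \ (bad ∪ {{p}})).card + (bad ∪ {{p}}).card := by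
      have := Finset.le_card_sdiff (bad ∪ {{p}}) 𝓛
      omega
    have h2 := Finset.card_union_le bad {{p}}
    rw [Finset.card_singleton] at h2
    rw [Finset.card_insert_of_notMem hp]
    omega

namespace MixedRel

variable {V : Type*} {G : MixedRel V} {x y a b : V}

/-- A choice of a root in each component. -/
theorem exists_root (G : MixedRel V) :
    ∃ root : V → V, (∀ v, G.Comp v (root v)) ∧ ∀ u v, G.Comp u v → root u = root v := by
  let st : Setoid V := ⟨G.Comp, fun _ => .refl, Comp.symm, Comp.trans⟩
  refine ⟨fun v => (Quotient.mk st v).out, fun v => ?_, fun u v h => ?_⟩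
  · exact Comp.symm (Quotient.exact (s := st) (Quotient.out_eq (s := st) (Quotient.mk st v)))
  · exact congrArg _ (Quotient.sound (s := st) h)

open Classical in
variable (G) in
/-- The ends of arcs on the first side of the directed bridge `(x, y)`. -/
noncomputable def side [Fintype V] (e : V × V) : Finset V :=
  Finset.univ.filter fun r => G.End r ∧ G.Conn e.1 e.2 e.1 r

theorem mem_side [Fintype V] {e : V × V} {r : V} :
    r ∈ G.side e ↔ G.End r ∧ G.Conn e.1 e.2 e.1 r := by simp [side]

theorem Sep.side_nonempty [Fintype V] (h : G.Sep x y) : (G.side (x, y)).Nonempty := by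
  obtain ⟨p, q, hp, hq, hd⟩ := h
  exact ⟨p, mem_side.2 ⟨hp, hd.2.1.symm⟩⟩

theorem Sep.par_of_side_eq [Fintype V] (h : G.Sep x y) (h' : G.Sep a b)
    (heq : G.side (x, y) = G.side (a, b)) : G.Par x y a b := by
  obtain ⟨p, hp⟩ := h.side_nonempty
  have hp' := heq ▸ hp
  refine ⟨h.bridge, h'.bridge, (mem_side.1 hp).2.comp.trans (mem_side.1 hp').2.comp.symm,
    fun r hr _ => ?_⟩
  have := Finset.ext_iff.1 heq r
  rw [mem_side, mem_side] at this
  simpa [hr] using this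

/-- The number of parallel classes is linear in the number of ends of arcs, since the sides that do
not contain the root of their component form a laminar family. -/
theorem ncard_rep_le [Fintype V] [LinearOrder V] :
    {e : V × V | G.Rep e.1 e.2}.ncard ≤ 4 * {p | G.End p}.ncard := by
  classical
  obtain ⟨root, hroot, hrooteq⟩ := G.exists_root
  set ends : Finset V := Finset.univ.filter fun p => G.End p with hends
  set far : Finset (V × V) := Finset.univ.filter fun e =>
    G.Sep e.1 e.2 ∧ ¬ G.Conn e.1 e.2 e.1 (root e.1) with hfar
  have hcard : (far.image G.side).card ≤ 2 * ends.card := by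
    refine card_le_of_laminar ends _ (fun S hS => ?_) fun S hS S' hS' => ?_
    · obtain ⟨e, he, rfl⟩ := Finset.mem_image.1 hS
      rw [hfar, Finset.mem_filter] at he
      refine ⟨he.2.1.side_nonempty, fun r hr => ?_⟩
      rw [hends, Finset.mem_filter]
      exact ⟨Finset.mem_univ _, (mem_side.1 hr).1⟩
    · obtain ⟨⟨x, y⟩, he, rfl⟩ := Finset.mem_image.1 hS
      obtain ⟨⟨a, b⟩, hf, rfl⟩ := Finset.mem_image.1 hS'
      rw [hfar, Finset.mem_filter] at he hf
      dsimp only at he hf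
      by_contra hcon
      push Not at hcon
      obtain ⟨h1, h2, h3⟩ := hcon
      obtain ⟨r₂, hr₂, hr₂'⟩ := Finset.not_subset.1 h1
      obtain ⟨r₃, hr₃, hr₃'⟩ := Finset.not_subset.1 h2
      obtain ⟨r₁, hr₁, hr₁'⟩ := Finset.not_disjoint_iff.1 h3
      rw [mem_side] at *
      dsimp only at *
      have hxa : G.Comp x a := hr₁.2.comp.trans hr₁'.2.comp.symm
      refine not_cross he.2.1.bridge hf.2.1.bridge hr₁.2 hr₁'.2 hr₂.2 (r₄ := root x)
        ((conn_or_conn (hxa.symm.trans hr₂.2.comp)).resolve_left fun h => hr₂' ⟨hr₂.1, h⟩)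
        ((conn_or_conn (hxa.trans hr₃.2.comp)).resolve_left fun h => hr₃' ⟨hr₃.1, h⟩) hr₃.2
        ((conn_or_conn (hroot x)).resolve_left he.2.2) ?_
      rw [hrooteq x a hxa]
      exact (conn_or_conn (hroot a)).resolve_left hf.2.2
  have hinj : {e : V × V | G.Rep e.1 e.2}.ncard ≤
      ((far.image G.side) ×ˢ (Finset.univ : Finset Bool)).card := by
    rw [Set.ncard_eq_toFinset_card']
    refine Finset.card_le_card_of_injOn (fun e => if G.Conn e.1 e.2 e.1 (root e.1) then
      (G.side e.swap, true) else (G.side e, false)) ?_ ?_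
    · rintro ⟨x, y⟩ he
      have he : G.Rep x y := by simpa using he
      rw [Finset.mem_coe, Finset.mem_product]
      refine ⟨?_, Finset.mem_univ _⟩
      dsimp only
      split_ifs with hc
      · refine Finset.mem_image_of_mem _ ?_
        rw [hfar, Finset.mem_filter]
        refine ⟨Finset.mem_univ _, he.1.swap, fun h => ?_⟩
        dsimp only [Prod.swap] at h hc
        rw [hrooteq y x he.1.bridge.comp.symm, conn_comm] at h
        exact he.1.bridge.not_both hc h
      · refine Finset.mem_image_of_mem _ ?_
        rw [hfar, Finset.mem_filter]
        exact ⟨Finset.mem_univ _, he.1, hc⟩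
    · rintro ⟨x, y⟩ he ⟨a, b⟩ hf heq
      have he : G.Rep x y := by simpa using he
      have hf : G.Rep a b := by simpa using hf
      dsimp only at heq
      split_ifs at heq
      · have := (he.1.swap.par_of_side_eq hf.1.swap (congrArg Prod.fst heq)).swap
        obtain ⟨rfl, rfl⟩ := he.eq_of_par hf this
        rfl
      · exact absurd (congrArg Prod.snd heq) (by simp)
      · exact absurd (congrArg Prod.snd heq) (by simp)
      · have := he.1.par_of_side_eq hf.1 (congrArg Prod.fst heq)
        obtain ⟨rfl, rfl⟩ := he.eq_of_par hf this
        rfl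
  have hE : {p | G.End p}.ncard = ends.card := by
    rw [Set.ncard_eq_toFinset_card']
    congr 1
    ext p
    simp [hends]
  rw [Finset.card_product, Finset.card_univ, Fintype.card_bool] at hinj
  omega

end MixedRel

/-! ### The test of a guess as a list of definitions -/

namespace RAM

/-- Memory `r` contains the tuple `ys`. -/
def Mem (n : ℕ) (m : ℕ → ℕ → ℕ) (r : ℕ) (ys : List ℕ) : Prop := m r (addr n ys) ≠ 0

theorem mem_congr {n r : ℕ} {m m' : ℕ → ℕ → ℕ} (h : m r = m' r) (ys : List ℕ) :
    Mem n m r ys ↔ Mem n m' r ys := by rw [Mem, Mem, h]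

theorem Formula.sat_rel_mem (n : ℕ) (m : ℕ → ℕ → ℕ) (v : ℕ → ℕ) (r : ℕ) (xs : List ℕ) :
    (Formula.rel r xs).Sat n m v ↔ Mem n m r (xs.map v) := Iff.rfl

theorem isTuple_one {n : ℕ} (a : Fin n) : IsTuple n 1 [(a : ℕ)] := ⟨rfl, by simp⟩

theorem isTuple_two {n : ℕ} (a b : Fin n) : IsTuple n 2 [(a : ℕ), (b : ℕ)] := ⟨rfl, by simp⟩

theorem isTuple_four {n : ℕ} (a b c d : Fin n) :
    IsTuple n 4 [(a : ℕ), (b : ℕ), (c : ℕ), (d : ℕ)] := ⟨rfl, by simp⟩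

namespace Definition

variable {n r : ℕ} {m : ℕ → ℕ → ℕ} {φ : Formula}

theorem Holds.one (h : (set r 1 φ).Holds n m) (a : Fin n) :
    Mem n m r [(a : ℕ)] ↔ φ.Sat n m (tupleEnv [(a : ℕ)]) := h _ (isTuple_one a)

theorem Holds.two (h : (set r 2 φ).Holds n m) (a b : Fin n) :
    Mem n m r [(a : ℕ), (b : ℕ)] ↔ φ.Sat n m (tupleEnv [(a : ℕ), (b : ℕ)]) :=
  h _ (isTuple_two a b)

theorem Holds.four (h : (set r 4 φ).Holds n m) (a b c d : Fin n) :
    Mem n m r [(a : ℕ), (b : ℕ), (c : ℕ), (d : ℕ)] ↔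
      φ.Sat n m (tupleEnv [(a : ℕ), (b : ℕ), (c : ℕ), (d : ℕ)]) :=
  h _ (isTuple_four a b c d)

/-- A least fixed point that defines the reflexive and transitive closure of a relation. -/
theorem Holds.closure_two {R : Fin n → Fin n → Prop} (h : (lfp r 2 φ).Holds n m)
    (hφ : ∀ m', (∀ a, a ≠ r → m' a = m a) → ∀ u v : Fin n,
      φ.Sat n m' (tupleEnv [(u : ℕ), (v : ℕ)]) ↔
        u = v ∨ ∃ w : Fin n, Mem n m' r [(u : ℕ), (w : ℕ)] ∧ R w v) (u v : Fin n) :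
    Mem n m r [(u : ℕ), (v : ℕ)] ↔ ReflTransGen R u v := by
  constructor
  · intro hm
    refine h.2 (fun ys => ∀ u v : Fin n, ys = [(u : ℕ), (v : ℕ)] → ReflTransGen R u v) ?_ _
      (isTuple_two u v) hm u v rfl
    rintro m' hm' hS _ - hs u v rfl
    rcases (hφ m' hm' u v).1 hs with rfl | ⟨w, hw, hR⟩
    · exact .refl
    · exact (hS _ (isTuple_two u w) hw u w rfl).tail hR
  · intro hR
    induction hR with
    | refl => exact h.1 _ (isTuple_two u u) ((hφ m (fun _ _ => rfl) u u).2 (.inl rfl))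
    | @tail w v _ hR ih =>
      exact h.1 _ (isTuple_two u v) ((hφ m (fun _ _ => rfl) u v).2 (.inr ⟨w, ih, hR⟩))

/-- A least fixed point that defines the reflexive and transitive closure of a relation with two
parameters. -/
theorem Holds.closure_four {R : Fin n → Fin n → Fin n → Fin n → Prop} (h : (lfp r 4 φ).Holds n m)
    (hφ : ∀ m', (∀ a, a ≠ r → m' a = m a) → ∀ x y u v : Fin n,
      φ.Sat n m' (tupleEnv [(x : ℕ), (y : ℕ), (u : ℕ), (v : ℕ)]) ↔
        u = v ∨ ∃ w : Fin n, Mem n m' r [(x : ℕ), (y : ℕ), (u : ℕ), (w : ℕ)] ∧ R x y w v)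
    (x y u v : Fin n) :
    Mem n m r [(x : ℕ), (y : ℕ), (u : ℕ), (v : ℕ)] ↔ ReflTransGen (R x y) u v := by
  constructor
  · intro hm
    refine h.2 (fun ys => ∀ x y u v : Fin n, ys = [(x : ℕ), (y : ℕ), (u : ℕ), (v : ℕ)] →
      ReflTransGen (R x y) u v) ?_ _ (isTuple_four x y u v) hm x y u v rfl
    rintro m' hm' hS _ - hs x y u v rfl
    rcases (hφ m' hm' x y u v).1 hs with rfl | ⟨w, hw, hR⟩
    · exact .refl
    · exact (hS _ (isTuple_four x y u w) hw x y u w rfl).tail hR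
  · intro hR
    induction hR with
    | refl => exact h.1 _ (isTuple_four x y u u) ((hφ m (fun _ _ => rfl) x y u u).2 (.inl rfl))
    | @tail w v _ hR ih =>
      exact h.1 _ (isTuple_four x y u v) ((hφ m (fun _ _ => rfl) x y u v).2 (.inr ⟨w, ih, hR⟩))

/-- A least fixed point that defines the reflexive and transitive closure of a relation between
pairs. -/
theorem Holds.closure_pairs {R : Fin n × Fin n → Fin n × Fin n → Prop}
    (h : (lfp r 4 φ).Holds n m)
    (hφ : ∀ m', (∀ a, a ≠ r → m' a = m a) → ∀ x y u v : Fin n,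
      φ.Sat n m' (tupleEnv [(x : ℕ), (y : ℕ), (u : ℕ), (v : ℕ)]) ↔
        (x = u ∧ y = v) ∨ ∃ a b : Fin n, Mem n m' r [(x : ℕ), (y : ℕ), (a : ℕ), (b : ℕ)] ∧
          R (a, b) (u, v))
    (x y u v : Fin n) :
    Mem n m r [(x : ℕ), (y : ℕ), (u : ℕ), (v : ℕ)] ↔ ReflTransGen R (x, y) (u, v) := by
  constructor
  · intro hm
    refine h.2 (fun ys => ∀ x y u v : Fin n, ys = [(x : ℕ), (y : ℕ), (u : ℕ), (v : ℕ)] →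
      ReflTransGen R (x, y) (u, v)) ?_ _ (isTuple_four x y u v) hm x y u v rfl
    rintro m' hm' hS _ - hs x y u v rfl
    rcases (hφ m' hm' x y u v).1 hs with ⟨rfl, rfl⟩ | ⟨a, b, hw, hR⟩
    · exact .refl
    · exact (hS _ (isTuple_four x y a b) hw x y a b rfl).tail hR
  · intro hR
    have key : ∀ e, ReflTransGen R (x, y) e → Mem n m r [(x : ℕ), (y : ℕ), (e.1 : ℕ), (e.2 : ℕ)] := by
      intro e he
      induction he with
      | refl =>
        exact h.1 _ (isTuple_four x y x y) ((hφ m (fun _ _ => rfl) x y x y).2 (.inl ⟨rfl, rfl⟩))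
      | @tail w v _ hR ih =>
        exact h.1 _ (isTuple_four x y v.1 v.2)
          ((hφ m (fun _ _ => rfl) x y v.1 v.2).2 (.inr ⟨w.1, w.2, ih, hR⟩))
    exact key _ hR

end Definition

/-- The formula for `MixedRel.Off`. -/
def offFormula (x y u v : ℕ) : Formula :=
  .and (.rel 0 [u, v]) (.and (.neg (.and (.eq u x) (.eq v y))) (.neg (.and (.eq u y) (.eq v x))))

/-- The definitions of the relations that do not depend on the guess. Memories `4` to `12` receive
`Conn`, `Reach`, `Comp`, `Bridge`, `Dir`, `End`, `Par`, `Sep` and `Rep`. -/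
def graphDefinitions : List Definition :=
  [.lfp 4 4 (.or (.eq 2 3) (.ex 4 (.and (.rel 4 [0, 1, 2, 4]) (offFormula 0 1 4 3)))),
   .lfp 5 4 (.or (.eq 2 3) (.ex 4 (.and (.rel 5 [0, 1, 2, 4])
      (.or (.rel 1 [4, 3]) (offFormula 0 1 4 3))))),
   .lfp 6 2 (.or (.eq 0 1) (.ex 2 (.and (.rel 6 [0, 2]) (.rel 0 [2, 1])))),
   .set 7 2 (.and (.rel 0 [0, 1]) (.and (.neg (.rel 5 [0, 1, 0, 1])) (.neg (.rel 5 [0, 1, 1, 0])))),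
   .set 8 4 (.and (.rel 7 [2, 3]) (.and (.rel 4 [2, 3, 0, 2]) (.rel 4 [2, 3, 3, 1]))),
   .set 9 1 (.ex 1 (.or (.rel 1 [0, 1]) (.rel 1 [1, 0]))),
   .set 10 4 (.and (.rel 7 [0, 1]) (.and (.rel 7 [2, 3]) (.and (.rel 6 [0, 2])
      (.all 4 (.imp (.rel 9 [4]) (.imp (.rel 6 [0, 4])
        (.and (.imp (.rel 4 [0, 1, 0, 4]) (.rel 4 [2, 3, 2, 4]))
          (.imp (.rel 4 [2, 3, 2, 4]) (.rel 4 [0, 1, 0, 4]))))))))),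
   .set 11 2 (.ex 2 (.ex 3 (.and (.rel 9 [2]) (.and (.rel 9 [3]) (.rel 8 [2, 3, 0, 1]))))),
   .set 12 2 (.and (.rel 11 [0, 1]) (.all 2 (.all 3 (.imp (.rel 10 [0, 1, 2, 3])
      (.and (.neg (.lt 2 0)) (.neg (.and (.eq 2 0) (.lt 3 1))))))))]

/-- The definitions of the relations that depend on the guess, which is stored in memory `13`.
Memories `14` to `19` receive `Hat`, `Run`, `Feas`, `Opt`, `Clause` and `Forces`. -/
def guessDefinitions : List Definition :=
  [.set 14 2 (.ex 2 (.ex 3 (.and (.rel 13 [2, 3]) (.rel 10 [2, 3, 0, 1])))),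
   .lfp 15 2 (.or (.eq 0 1) (.ex 2 (.and (.rel 15 [0, 2]) (.or (.rel 1 [2, 1])
      (.or (.and (.rel 0 [2, 1]) (.neg (.rel 7 [2, 1]))) (.rel 14 [2, 1])))))),
   .set 16 2 (.all 2 (.all 3 (.imp (.rel 11 [2, 3])
      (.imp (.all 4 (.all 5 (.imp (.rel 10 [2, 3, 4, 5]) (.rel 8 [0, 1, 4, 5]))))
        (.rel 14 [2, 3]))))),
   .set 17 4 (.and (.rel 9 [2]) (.and (.rel 9 [3]) (.and (.rel 6 [0, 2]) (.and (.rel 6 [3, 1])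
      (.and (.rel 16 [0, 2]) (.and (.rel 16 [3, 1]) (.rel 15 [2, 3]))))))),
   .set 18 4 (.and (.rel 7 [0, 1]) (.and (.rel 7 [2, 3])
      (.or (.and (.and (.eq 0 2) (.eq 1 3)) (.or (.rel 14 [0, 1])
        (.ex 4 (.ex 5 (.and (.rel 2 [4, 5]) (.and (.rel 6 [4, 5]) (.rel 8 [4, 5, 0, 1])))))))
      (.ex 4 (.ex 5 (.and (.rel 2 [4, 5]) (.and (.neg (.rel 6 [4, 5]))
        (.all 6 (.all 7 (.imp (.rel 17 [4, 5, 6, 7])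
          (.or (.or (.rel 8 [4, 6, 0, 1]) (.rel 8 [7, 5, 0, 1]))
            (.or (.rel 8 [4, 6, 2, 3]) (.rel 8 [7, 5, 2, 3]))))))))))))),
   .lfp 19 4 (.or (.and (.eq 0 2) (.eq 1 3)) (.ex 4 (.ex 5 (.and (.rel 19 [0, 1, 4, 5])
      (.rel 18 [5, 4, 2, 3])))))]

/-- The sentence for `MixedRel.Accepts`. -/
def acceptFormula : Formula :=
  .and (.all 0 (.all 1 (.imp (.rel 2 [0, 1]) (.imp (.neg (.rel 6 [0, 1]))
      (.ex 2 (.ex 3 (.rel 17 [0, 1, 2, 3])))))))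
    (.all 0 (.all 1 (.imp (.rel 7 [0, 1])
      (.neg (.and (.rel 19 [0, 1, 1, 0]) (.rel 19 [1, 0, 0, 1]))))))

theorem graphDefinitions_wf : Definition.WF 4 graphDefinitions = true := by decide

theorem guessDefinitions_wf : Definition.WF 14 guessDefinitions = true := by decide

theorem acceptFormula_wf : acceptFormula.WF 20 0 = true := by decide

/-- Memories `0` and `1` contain the edges and the arcs of `G`, and memories `4` to `12` contain the
derived relations. -/
structure Represents {n : ℕ} (G : MixedRel (Fin n)) (m : ℕ → ℕ → ℕ) : Prop where
  edge : ∀ x y : Fin n, Mem n m 0 [(x : ℕ), (y : ℕ)] ↔ G.E x y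
  arc : ∀ x y : Fin n, Mem n m 1 [(x : ℕ), (y : ℕ)] ↔ G.A x y
  conn : ∀ x y u v : Fin n, Mem n m 4 [(x : ℕ), (y : ℕ), (u : ℕ), (v : ℕ)] ↔ G.Conn x y u v
  comp : ∀ u v : Fin n, Mem n m 6 [(u : ℕ), (v : ℕ)] ↔ G.Comp u v
  bridge : ∀ u v : Fin n, Mem n m 7 [(u : ℕ), (v : ℕ)] ↔ G.Bridge u v
  dir : ∀ x y u v : Fin n, Mem n m 8 [(x : ℕ), (y : ℕ), (u : ℕ), (v : ℕ)] ↔ G.Dir x y u v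
  isEnd : ∀ u : Fin n, Mem n m 9 [(u : ℕ)] ↔ G.End u
  par : ∀ x y u v : Fin n, Mem n m 10 [(x : ℕ), (y : ℕ), (u : ℕ), (v : ℕ)] ↔ G.Par x y u v
  sep : ∀ u v : Fin n, Mem n m 11 [(u : ℕ), (v : ℕ)] ↔ G.Sep u v
  rep : ∀ u v : Fin n, Mem n m 12 [(u : ℕ), (v : ℕ)] ↔ G.Rep u v

theorem represents_of_holds {n : ℕ} {G : MixedRel (Fin n)} {m : ℕ → ℕ → ℕ}
    (hE : ∀ x y : Fin n, Mem n m 0 [(x : ℕ), (y : ℕ)] ↔ G.E x y)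
    (hA : ∀ x y : Fin n, Mem n m 1 [(x : ℕ), (y : ℕ)] ↔ G.A x y)
    (h : ∀ d ∈ graphDefinitions, d.Holds n m) : Represents G m := by
  simp only [graphDefinitions, List.forall_mem_cons] at h
  obtain ⟨h4, h5, h6, h7, h8, h9, h10, h11, h12, -⟩ := h
  have conn : ∀ x y u v : Fin n,
      Mem n m 4 [(x : ℕ), (y : ℕ), (u : ℕ), (v : ℕ)] ↔ G.Conn x y u v := by
    refine h4.closure_four fun m' hm' x y u v => ?_
    simp [Formula.sat_or, Formula.sat_and, Formula.sat_ex, Formula.sat_rel_mem, Formula.sat_eq,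
      Formula.sat_neg, offFormula, tupleEnv, Fin.val_inj,
      mem_congr (hm' 0 (by decide)), hE, MixedRel.Off]
  have reach : ∀ x y u v : Fin n,
      Mem n m 5 [(x : ℕ), (y : ℕ), (u : ℕ), (v : ℕ)] ↔ G.Reach x y u v := by
    refine h5.closure_four fun m' hm' x y u v => ?_
    simp [Formula.sat_or, Formula.sat_and, Formula.sat_ex, Formula.sat_rel_mem, Formula.sat_eq,
      Formula.sat_neg, offFormula, tupleEnv, Fin.val_inj,
      mem_congr (hm' 0 (by decide)), mem_congr (hm' 1 (by decide)), hE, hA, MixedRel.Off]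
  have comp : ∀ u v : Fin n, Mem n m 6 [(u : ℕ), (v : ℕ)] ↔ G.Comp u v := by
    refine h6.closure_two fun m' hm' u v => ?_
    simp [Formula.sat_or, Formula.sat_and, Formula.sat_ex, Formula.sat_rel_mem, Formula.sat_eq,
      tupleEnv, Fin.val_inj, mem_congr (hm' 0 (by decide)), hE]
  have bridge : ∀ u v : Fin n, Mem n m 7 [(u : ℕ), (v : ℕ)] ↔ G.Bridge u v := by
    intro u v
    rw [h7.two]
    simp [Formula.sat_and, Formula.sat_rel_mem, Formula.sat_neg, tupleEnv, hE, reach,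
      MixedRel.Bridge]
  have dir : ∀ x y u v : Fin n,
      Mem n m 8 [(x : ℕ), (y : ℕ), (u : ℕ), (v : ℕ)] ↔ G.Dir x y u v := by
    intro x y u v
    rw [h8.four]
    simp [Formula.sat_and, Formula.sat_rel_mem, tupleEnv, bridge, conn, MixedRel.Dir]
  have isEnd : ∀ u : Fin n, Mem n m 9 [(u : ℕ)] ↔ G.End u := by
    intro u
    rw [h9.one]
    simp [Formula.sat_or, Formula.sat_ex, Formula.sat_rel_mem, tupleEnv, hA,
      MixedRel.End]
  have par : ∀ x y u v : Fin n,
      Mem n m 10 [(x : ℕ), (y : ℕ), (u : ℕ), (v : ℕ)] ↔ G.Par x y u v := by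
    intro x y u v
    rw [h10.four]
    simp [Formula.sat_and, Formula.sat_all, Formula.sat_imp, Formula.sat_rel_mem, tupleEnv,
      bridge, comp, conn, isEnd, MixedRel.Par, iff_iff_implies_and_implies]
  have sep : ∀ u v : Fin n, Mem n m 11 [(u : ℕ), (v : ℕ)] ↔ G.Sep u v := by
    intro u v
    rw [h11.two]
    simp [Formula.sat_and, Formula.sat_ex, Formula.sat_rel_mem, tupleEnv,
      isEnd, dir, MixedRel.Sep]
  have rep : ∀ u v : Fin n, Mem n m 12 [(u : ℕ), (v : ℕ)] ↔ G.Rep u v := by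
    intro u v
    rw [h12.two]
    simp [Formula.sat_and, Formula.sat_all, Formula.sat_imp, Formula.sat_neg, Formula.sat_eq,
      Formula.sat_lt, Formula.sat_rel_mem, tupleEnv, Fin.val_inj, sep, par,
      MixedRel.Rep]
  exact ⟨hE, hA, conn, comp, bridge, dir, isEnd, par, sep, rep⟩

theorem sat_acceptFormula_iff {n : ℕ} {G : MixedRel (Fin n)} {T X : Fin n → Fin n → Prop}
    {m : ℕ → ℕ → ℕ} (hG : Represents G m)
    (hT : ∀ x y : Fin n, Mem n m 2 [(x : ℕ), (y : ℕ)] ↔ T x y)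
    (hX : ∀ x y : Fin n, Mem n m 13 [(x : ℕ), (y : ℕ)] ↔ X x y)
    (h : ∀ d ∈ guessDefinitions, d.Holds n m) (v : ℕ → ℕ) :
    acceptFormula.Sat n m v ↔ G.Accepts T X := by
  simp only [guessDefinitions, List.forall_mem_cons] at h
  obtain ⟨h14, h15, h16, h17, h18, h19, -⟩ := h
  have hat : ∀ u v : Fin n, Mem n m 14 [(u : ℕ), (v : ℕ)] ↔ G.Hat X u v := by
    intro u v
    rw [h14.two]
    simp [Formula.sat_and, Formula.sat_ex, Formula.sat_rel_mem, tupleEnv,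
      hX, hG.par, MixedRel.Hat]
  have run : ∀ u v : Fin n, Mem n m 15 [(u : ℕ), (v : ℕ)] ↔ G.Run X u v := by
    refine h15.closure_two fun m' hm' u v => ?_
    simp [Formula.sat_or, Formula.sat_and, Formula.sat_ex, Formula.sat_rel_mem, Formula.sat_eq,
      Formula.sat_neg, tupleEnv, Fin.val_inj, mem_congr (hm' 0 (by decide)),
      mem_congr (hm' 1 (by decide)), mem_congr (hm' 7 (by decide)), mem_congr (hm' 14 (by decide)),
      hG.edge, hG.arc, hG.bridge, hat, MixedRel.Step, MixedRel.Flex]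
  have feas : ∀ u v : Fin n, Mem n m 16 [(u : ℕ), (v : ℕ)] ↔ G.Feas (G.Hat X) u v := by
    intro u v
    rw [h16.two]
    simp [Formula.sat_all, Formula.sat_imp, Formula.sat_rel_mem, tupleEnv,
      hG.sep, hG.par, hG.dir, hat, MixedRel.Feas]
  have opt : ∀ x y u v : Fin n,
      Mem n m 17 [(x : ℕ), (y : ℕ), (u : ℕ), (v : ℕ)] ↔ G.Opt X x y u v := by
    intro x y u v
    rw [h17.four]
    simp [Formula.sat_and, Formula.sat_rel_mem, tupleEnv, hG.isEnd, hG.comp, feas, run,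
      MixedRel.Opt]
  have clause : ∀ x y u v : Fin n,
      Mem n m 18 [(x : ℕ), (y : ℕ), (u : ℕ), (v : ℕ)] ↔ G.Clause T X x y u v := by
    intro x y u v
    rw [h18.four]
    simp [Formula.sat_and, Formula.sat_or, Formula.sat_ex, Formula.sat_all, Formula.sat_imp,
      Formula.sat_neg, Formula.sat_eq, Formula.sat_rel_mem, tupleEnv,
      Fin.val_inj, hG.bridge, hG.comp, hG.dir, hat, opt, hT, MixedRel.Clause]
  have forces : ∀ x y u v : Fin n,
      Mem n m 19 [(x : ℕ), (y : ℕ), (u : ℕ), (v : ℕ)] ↔ G.Forces T X x y u v := by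
    refine h19.closure_pairs fun m' hm' x y u v => ?_
    simp [Formula.sat_and, Formula.sat_or, Formula.sat_ex, Formula.sat_eq, Formula.sat_rel_mem,
      tupleEnv, Fin.val_inj, mem_congr (hm' 18 (by decide)), clause]
  simp [acceptFormula, Formula.sat_and, Formula.sat_all, Formula.sat_imp, Formula.sat_ex,
    Formula.sat_neg, Formula.sat_rel_mem, hT, hG.comp, hG.bridge, opt,
    forces, MixedRel.Accepts]

end RAM

/-! ### The multiplication table -/

namespace RAM

/-- The program that prepares the multiplication table in memory `3`. -/
theorem exists_program_table : ∃ (P : Program) (T : ℕ → ℕ), PolyBounded T ∧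
    ∀ (n : ℕ) (σ : State), σ.reg 0 = n → Terminates P σ (T n) fun τ =>
      Ready n τ ∧ ∀ a, a ≠ 3 → τ.mem a = σ.mem a := by
  let body : Program := .seq (.store 3 (.reg 6) (.reg 7))
    (.seq (.assign 6 (.add (.reg 6) (.const 1))) (.assign 7 (.add (.reg 7) (.reg 0))))
  refine ⟨.seq (.assign 6 (.const 0)) (.seq (.assign 7 (.const 0)) (repeatLoop body 3)),
    fun n => 2 + (2 + loopTime (fun _ => 3 + (4 + 4)) 3 n),
    (PolyBounded.const 2).add ((PolyBounded.const 2).add ((PolyBounded.const _).loopTime 3)),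
    fun n σ hσ => ?_⟩
  refine Terminates.seq (.assign (post := fun τ => τ = setReg σ 6 0) rfl) ?_
  rintro _ rfl
  refine Terminates.seq (.assign (post := fun τ => τ = setReg (setReg σ 6 0) 7 0) rfl) ?_
  rintro _ rfl
  refine (Terminates.repeatLoop (n := n) (T := fun _ => 3 + (4 + 4)) (Inv := fun i τ =>
    τ.reg 6 = i ∧ τ.reg 7 = i * n ∧ (∀ l < i, τ.mem 3 l = l * n) ∧ ∀ a, a ≠ 3 → τ.mem a = σ.mem a)
    ?_ ?_ 3 (by omega) 0 _ ?_ ?_).mono le_rfl ?_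
  · rintro i τ x v hx hx' ⟨h6, h7, h⟩
    exact ⟨(setReg_reg_of_ne _ _ (by omega)).trans h6, (setReg_reg_of_ne _ _ (by omega)).trans h7, h⟩
  · rintro i τ h0 ⟨h6, h7, h3, hm⟩
    refine Terminates.seq (.store (post := fun υ => υ = setMem τ 3 i (i * n)) ?_) ?_
    · simp [Expr.eval, h6, h7]
    rintro _ rfl
    refine Terminates.seq (.assign
      (post := fun υ => υ = setReg (setMem τ 3 i (i * n)) 6 (i + 1)) ?_) ?_
    · simp [Expr.eval, h6]
    rintro _ rfl
    refine .assign ⟨?_, fun x hx hx' => ?_, ?_, ?_, fun l hl => ?_, fun a ha => ?_⟩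
    · rw [setReg_reg_of_ne _ _ (by omega), setReg_reg_of_ne _ _ (by omega), setMem_reg, h0]
    · rw [setReg_reg_of_ne _ _ (by omega), setReg_reg_of_ne _ _ (by omega), setMem_reg]
    · rw [setReg_reg_of_ne _ _ (by omega), setReg_reg_self]
    · simp only [setReg_reg_self, Expr.eval]
      rw [setReg_reg_of_ne _ _ (by omega), setReg_reg_of_ne _ _ (by omega), setMem_reg, h0, h7]
      ring
    · rcases Nat.lt_succ_iff_lt_or_eq.1 hl with hl | rfl
      · simpa [setMem, Function.update_apply, hl.ne] using h3 l hl
      · simp [setMem]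
    · simpa [setMem, ha] using hm a ha
  · rw [setReg_reg_of_ne _ _ (by omega), setReg_reg_of_ne _ _ (by omega), hσ]
  · refine ⟨?_, by simp, by simp, fun a _ => rfl⟩
    rw [setReg_reg_of_ne _ _ (by omega), setReg_reg_self]
  · rintro τ ⟨h0, -, -, -, h3, hm⟩
    exact ⟨⟨h0, by simpa using h3⟩, hm⟩

/-! ### A binary counter -/

section Counter

open Classical in
/-- The number of elements of `N` below `a`. -/
noncomputable def count (N : ℕ → Prop) : ℕ → ℕ
  | 0 => 0
  | a + 1 => count N a + if N a then 1 else 0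

open Classical in
/-- The number whose binary digits are the truth values of `X` at the elements of `N` below `a`,
least significant digit first. -/
noncomputable def value (N X : ℕ → Prop) : ℕ → ℕ
  | 0 => 0
  | a + 1 => value N X a + if N a ∧ X a then 2 ^ count N a else 0

variable {N X Y : ℕ → Prop}

theorem value_lt (N X : ℕ → Prop) (a : ℕ) : value N X a < 2 ^ count N a := by
  induction a with
  | zero => simp [value, count]
  | succ a ih =>
    rw [value, count]
    by_cases hN : N a <;> by_cases hX : X a <;> simp [hN, hX, pow_succ] <;> omega

theorem value_congr {a : ℕ} (h : ∀ i < a, X i ↔ Y i) : value N X a = value N Y a := by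
  induction a with
  | zero => rfl
  | succ a ih =>
    rw [value, value, ih fun i hi => h i (by omega), propext (h a (by omega))]

theorem value_injective {a : ℕ} (h : value N X a = value N Y a) :
    ∀ i < a, N i → (X i ↔ Y i) := by
  induction a with
  | zero => simp
  | succ a ih =>
    have h1 := value_lt N X a
    have h2 := value_lt N Y a
    rw [value, value] at h
    intro i hi hN
    by_cases hNa : N a
    · by_cases hX : X a <;> by_cases hY : Y a <;> simp only [hNa, hX, hY, and_self, and_false,
        if_true, if_false] at h
      · rcases Nat.lt_succ_iff_lt_or_eq.1 hi with hi | rfl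
        · exact ih (by omega) i hi hN
        · simp [hX, hY]
      · omega
      · omega
      · rcases Nat.lt_succ_iff_lt_or_eq.1 hi with hi | rfl
        · exact ih (by omega) i hi hN
        · simp [hX, hY]
    · simp only [hNa, false_and, if_false] at h
      rcases Nat.lt_succ_iff_lt_or_eq.1 hi with hi | rfl
      · exact ih (by omega) i hi hN
      · exact absurd hN hNa

theorem value_empty (N : ℕ → Prop) (a : ℕ) : value N (fun _ => False) a = 0 := by
  induction a with
  | zero => rfl
  | succ a ih => rw [value, ih]; simp

end Counter

/-- The body of the loop that increments the counter with the digits in memory `13`, at the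
positions given by memory `12`; register `7` holds the carry, register `8` the position. -/
def digitProgram : Program :=
  .seq (.branch (.read 12 (.reg 8)) (.branch (.reg 7) (.branch (.read 13 (.reg 8))
    (.store 13 (.reg 8) (.const 0))
    (.seq (.store 13 (.reg 8) (.const 1)) (.assign 7 (.const 0)))) .skip) .skip)
    (.assign 8 (.add (.reg 8) (.const 1)))

/-- Increment the counter. -/
def incrementProgram : Program :=
  .seq (.assign 7 (.const 1)) (.seq (.assign 8 (.const 0)) (repeatLoop digitProgram 2))

/-- A bound for the running time of `digitProgram`. -/
def digitTime : ℕ := 3 + (2 + (3 + (3 + (3 + 2)) + 1) + 1) + 4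

/-- The digits below position `i`, with the carry, represent the incremented number. -/
theorem terminates_digitProgram {n i : ℕ} {N X : ℕ → Prop} {τ : State} (h0 : τ.reg 0 = n)
    (hN : ∀ l, N l ↔ τ.mem 12 l ≠ 0) (h7 : τ.reg 7 ≤ 1) (h8 : τ.reg 8 = i)
    (hX : ∀ l, i ≤ l → (τ.mem 13 l ≠ 0 ↔ X l))
    (hv : value N (fun l => τ.mem 13 l ≠ 0) i + τ.reg 7 * 2 ^ count N i = value N X i + 1) :
    Terminates digitProgram τ digitTime fun υ => υ.reg 0 = n ∧ υ.reg 7 ≤ 1 ∧ υ.reg 8 = i + 1 ∧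
      (∀ x ≤ 6, υ.reg x = τ.reg x) ∧ (∀ a, a ≠ 13 → υ.mem a = τ.mem a) ∧
      (∀ l, l ≠ i → υ.mem 13 l = τ.mem 13 l) ∧ (υ.mem 13 i ≠ 0 → N i ∨ X i) ∧
      value N (fun l => υ.mem 13 l ≠ 0) (i + 1) + υ.reg 7 * 2 ^ count N (i + 1) =
        value N X (i + 1) + 1 := by
  have hXi := hX i le_rfl
  -- the effect of the step on the digit and the carry
  have main : ∀ υ : State, υ.reg 7 ≤ 1 → (∀ x ≤ 6, υ.reg x = τ.reg x) → υ.reg 8 = i →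
      (∀ a, a ≠ 13 → υ.mem a = τ.mem a) → (∀ l, l ≠ i → υ.mem 13 l = τ.mem 13 l) →
      (N i → υ.reg 7 * 2 + (if υ.mem 13 i ≠ 0 then 1 else 0) =
        τ.reg 7 + if τ.mem 13 i ≠ 0 then 1 else 0) →
      (¬ N i → υ.reg 7 = τ.reg 7 ∧ υ.mem 13 i = τ.mem 13 i) →
      Terminates (.assign 8 (.add (.reg 8) (.const 1))) υ 4 fun υ =>
        υ.reg 0 = n ∧ υ.reg 7 ≤ 1 ∧ υ.reg 8 = i + 1 ∧
        (∀ x ≤ 6, υ.reg x = τ.reg x) ∧ (∀ a, a ≠ 13 → υ.mem a = τ.mem a) ∧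
        (∀ l, l ≠ i → υ.mem 13 l = τ.mem 13 l) ∧ (υ.mem 13 i ≠ 0 → N i ∨ X i) ∧
        value N (fun l => υ.mem 13 l ≠ 0) (i + 1) + υ.reg 7 * 2 ^ count N (i + 1) =
          value N X (i + 1) + 1 := by
    intro υ h7' hr h8' hm hm13 hNi hNi'
    refine .assign ⟨?_, ?_, ?_, fun x hx => ?_, hm, hm13, ?_, ?_⟩
    · rw [setReg_reg_of_ne _ _ (by omega), hr 0 (by omega), h0]
    · rwa [setReg_reg_of_ne _ _ (by omega)]
    · simp [Expr.eval, h8']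
    · rw [setReg_reg_of_ne _ _ (by omega), hr x hx]
    · intro hne
      by_cases hN' : N i
      · exact .inl hN'
      · rw [setReg_mem, (hNi' hN').2] at hne
        exact .inr (hXi.1 hne)
    · rw [setReg_reg_of_ne _ _ (by omega), setReg_mem, value, value, count,
        value_congr (Y := fun l => τ.mem 13 l ≠ 0) fun l hl => by rw [hm13 l (by omega)]]
      rw [← propext hXi]
      by_cases hN' : N i
      · have := hNi hN'
        simp only [hN', true_and, if_true, pow_succ]
        have h2 := congrArg (· * 2 ^ count N i) this
        simp only [add_mul] at h2
        split_ifs at h2 ⊢ <;> linarith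
      · have := hNi' hN'
        simp only [hN', false_and, if_false, add_zero]
        rw [this.1, hv]
  refine Terminates.seq (post := fun υ : State => υ.reg 7 ≤ 1 ∧ (∀ x ≤ 6, υ.reg x = τ.reg x) ∧
    υ.reg 8 = i ∧ (∀ a, a ≠ 13 → υ.mem a = τ.mem a) ∧ (∀ l, l ≠ i → υ.mem 13 l = τ.mem 13 l) ∧
      (N i → υ.reg 7 * 2 + (if υ.mem 13 i ≠ 0 then 1 else 0) =
        τ.reg 7 + if τ.mem 13 i ≠ 0 then 1 else 0) ∧
      (¬ N i → υ.reg 7 = τ.reg 7 ∧ υ.mem 13 i = τ.mem 13 i))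
    (Terminates.branch (T := 2 + (3 + (3 + (3 + 2)) + 1)) (T' := 1) (fun he => ?_) fun he => ?_)
    fun υ ⟨h1, h2, h3, h4, h5, h6, h7⟩ => main υ h1 h2 h3 h4 h5 h6 h7
  · have hNi : N i := by simpa [Expr.eval, h8, hN] using he
    refine Terminates.branch (e := .reg 7) (T := 3 + (3 + (3 + 2))) (fun hc => ?_) fun hc => ?_
    · have h7 : τ.reg 7 = 1 := by
        simp only [Expr.eval] at hc
        omega
      refine (Terminates.branch (T := 3) (T' := 3 + 2) (fun hd => .store ?_) fun hd => ?_)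
      · have hd : τ.mem 13 i ≠ 0 := by simpa [Expr.eval, h8] using hd
        simp only [Expr.eval, h8]
        refine ⟨h7.le, fun _ _ => rfl, h8, fun a ha => by simp [setMem, ha],
          fun l hl => by simp [setMem, hl], fun _ => ?_, fun h => absurd hNi h⟩
        rw [setMem_reg, h7, if_pos hd]
        simp [setMem]
      · have hd : τ.mem 13 i = 0 := by simpa [Expr.eval, h8] using hd
        refine Terminates.seq (.store (post := fun υ => υ = setMem τ 13 i 1) ?_) ?_
        · simp [Expr.eval, h8]
        rintro _ rfl
        refine .assign ⟨by simp [Expr.eval], fun x hx => setReg_reg_of_ne _ _ (by omega), ?_,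
          fun a ha => by simp [setMem, ha], fun l hl => by simp [setMem, hl], fun _ => ?_,
          fun h => absurd hNi h⟩
        · rw [setReg_reg_of_ne _ _ (by omega), setMem_reg, h8]
        · simp [Expr.eval, h7, hd, setMem]
    · have hc : τ.reg 7 = 0 := hc
      refine .skip ⟨h7, fun _ _ => rfl, h8, fun _ _ => rfl, fun _ _ => rfl, fun _ => ?_,
        fun _ => ⟨rfl, rfl⟩⟩
      rw [hc]
  · have hNi : ¬ N i := by
      simp only [Expr.eval, h8] at he
      rw [hN, he]
      simp
    exact .skip ⟨h7, fun _ _ => rfl, h8, fun _ _ => rfl, fun _ _ => rfl, fun h => absurd h hNi,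
      fun _ => ⟨rfl, rfl⟩⟩

/-- `incrementProgram` increments the counter; register `7` receives the carry. -/
theorem terminates_incrementProgram {n : ℕ} {N : ℕ → Prop} {σ : State} (h0 : σ.reg 0 = n)
    (hN : ∀ l, N l ↔ σ.mem 12 l ≠ 0) (hX : ∀ l, σ.mem 13 l ≠ 0 → l < n ^ 2 ∧ N l) :
    Terminates incrementProgram σ (2 + (2 + loopTime (fun _ => digitTime) 2 n)) fun τ =>
      τ.reg 0 = n ∧ τ.reg 6 = σ.reg 6 ∧ τ.reg 7 ≤ 1 ∧ (∀ a, a ≠ 13 → τ.mem a = σ.mem a) ∧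
      (∀ l, τ.mem 13 l ≠ 0 → l < n ^ 2 ∧ N l) ∧
      value N (fun l => τ.mem 13 l ≠ 0) (n ^ 2) + τ.reg 7 * 2 ^ count N (n ^ 2) =
        value N (fun l => σ.mem 13 l ≠ 0) (n ^ 2) + 1 := by
  refine Terminates.seq (.assign (post := fun τ => τ = setReg σ 7 1) rfl) ?_
  rintro _ rfl
  refine Terminates.seq (.assign (post := fun τ => τ = setReg (setReg σ 7 1) 8 0) rfl) ?_
  rintro _ rfl
  set X : ℕ → Prop := fun l => σ.mem 13 l ≠ 0 with hXdef
  refine (Terminates.repeatLoop (n := n) (T := fun _ => digitTime) (Inv := fun i τ =>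
    τ.reg 6 = σ.reg 6 ∧ τ.reg 7 ≤ 1 ∧ τ.reg 8 = i ∧ (∀ a, a ≠ 13 → τ.mem a = σ.mem a) ∧
    (∀ l, i ≤ l → τ.mem 13 l = σ.mem 13 l) ∧ (∀ l, τ.mem 13 l ≠ 0 → N l) ∧
    value N (fun l => τ.mem 13 l ≠ 0) i + τ.reg 7 * 2 ^ count N i = value N X i + 1)
    ?_ ?_ 2 (by omega) 0 _ ?_ ?_).mono le_rfl ?_
  · rintro i τ x v hx hx' ⟨h6, h7, h8, h⟩
    have hr : ∀ y, 6 ≤ y → (setReg τ x v).reg y = τ.reg y := fun y hy =>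
      setReg_reg_of_ne _ _ (by omega)
    rw [hr 6 (by omega), hr 7 (by omega), hr 8 (by omega)]
    exact ⟨h6, h7, h8, h⟩
  · rintro i τ h0 ⟨h6, h7, h8, hm, hm13, hsub, hv⟩
    refine (terminates_digitProgram (N := N) (X := X) h0 (fun l => ?_) h7 h8 (fun l hl => ?_)
      hv).mono le_rfl ?_
    · rw [hN, hm 12 (by omega)]
    · rw [hm13 l hl]
    · rintro υ ⟨h0', h7', h8', hr', hm', hm13', hi, hv'⟩
      refine ⟨h0', fun x hx hx' => hr' x (by omega), (hr' 6 le_rfl).trans h6, h7', h8',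
        fun a ha => (hm' a ha).trans (hm a ha),
        fun l hl => (hm13' l (by omega)).trans (hm13 l (by omega)), fun l hl => ?_, hv'⟩
      rcases eq_or_ne l i with rfl | hne
      · exact (hi hl).elim id fun h => (hX l h).2
      · exact hsub l (by rwa [hm13' l hne] at hl)
  · rw [setReg_reg_of_ne _ _ (by omega), setReg_reg_of_ne _ _ (by omega), h0]
  · refine ⟨?_, ?_, by simp, fun _ _ => rfl, fun _ _ => rfl, fun l hl => (hX l hl).2, ?_⟩
    · rw [setReg_reg_of_ne _ _ (by omega), setReg_reg_of_ne _ _ (by omega)]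
    · rw [setReg_reg_of_ne _ _ (by omega), setReg_reg_self]
    · rw [setReg_reg_of_ne _ _ (by omega), setReg_reg_self]
      simp [value, count]
  · rintro τ ⟨h0', -, h6, h7, -, hm, hm13, hsub, hv⟩
    rw [Nat.zero_add] at hm13 hv
    refine ⟨h0', h6, h7, hm, fun l hl => ⟨?_, hsub l hl⟩, hv⟩
    by_contra hlt
    rw [hm13 l (by omega)] at hl
    exact hlt (hX l hl).1

/-! ### Exhaustive search -/

/-- A body `B` tests the guess in memory `13`: it leaves memories `0` to `13` unchanged, and
writes the truth value of `good` to register `1`. -/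
def Tests (B : Program) (n : ℕ) (T : ℕ) (m : ℕ → ℕ → ℕ) (good : (ℕ → Prop) → Prop) : Prop :=
  ∀ σ : State, Ready n σ → (∀ a < 13, σ.mem a = m a) → Terminates B σ T fun τ =>
    Frame σ τ ∧ (∀ a ≤ 13, τ.mem a = σ.mem a) ∧
      (τ.reg 1 = 1 ∧ good (fun l => σ.mem 13 l ≠ 0) ∨
        τ.reg 1 = 0 ∧ ¬ good (fun l => σ.mem 13 l ≠ 0))

/-- The loop that tests the guesses until the counter overflows. Register `6` records whether some
guess has passed the test. -/
def searchLoop (B : Program) : Program :=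
  .loop (.sub (.const 1) (.reg 7))
    (.seq B (.seq (.branch (.reg 1) (.assign 6 (.const 1)) .skip) incrementProgram))

/-- The time of one round of `searchLoop`. -/
def roundTime (T n : ℕ) : ℕ :=
  T + (2 + (2 + 1) + (2 + (2 + loopTime (fun _ => digitTime) 2 n)))

open Classical in
theorem terminates_searchLoop {B : Program} {n T : ℕ} {m : ℕ → ℕ → ℕ}
    {good : (ℕ → Prop) → Prop} (hB : Tests B n T m good) {N : ℕ → Prop}
    (hN : ∀ l, N l ↔ m 12 l ≠ 0) :
    ∀ k (σ : State), Ready n σ → (∀ a < 13, σ.mem a = m a) →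
      (∀ l, σ.mem 13 l ≠ 0 → l < n ^ 2 ∧ N l) → σ.reg 6 ≤ 1 → σ.reg 7 = 0 →
      value N (fun l => σ.mem 13 l ≠ 0) (n ^ 2) + k = 2 ^ count N (n ^ 2) →
      Terminates (searchLoop B) σ (k * (roundTime T n + 4) + 4) fun τ =>
        τ.reg 6 = if σ.reg 6 = 1 ∨ ∃ S : ℕ → Prop, (∀ l, S l → l < n ^ 2 ∧ N l) ∧ good S ∧
          value N (fun l => σ.mem 13 l ≠ 0) (n ^ 2) ≤ value N S (n ^ 2) then 1 else 0 := by
  intro k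
  induction k with
  | zero =>
    intro σ _ _ _ _ _ hv
    have := value_lt N (fun l => σ.mem 13 l ≠ 0) (n ^ 2)
    omega
  | succ k ih =>
    intro σ hσ hm hX h6 h7 hv
    set X : ℕ → Prop := fun l => σ.mem 13 l ≠ 0 with hXdef
    -- guesses are determined by their values
    have huniq : ∀ S : ℕ → Prop, (∀ l, S l → l < n ^ 2 ∧ N l) →
        value N S (n ^ 2) = value N X (n ^ 2) → S = X := by
      intro S hS heq
      funext l
      apply propext
      constructor
      · exact fun h => (value_injective heq l (hS l h).1 (hS l h).2).1 h
      · exact fun h => (value_injective heq l (hX l h).1 (hX l h).2).2 h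
    refine (Terminates.loop_true (T := roundTime T n) (T' := k * (roundTime T n + 4) + 4)
      (by simp [Expr.eval, h7]) ((hB σ hσ hm).seq fun τ hτ => Terminates.seq (T := 2 + (2 + 1))
        (post := fun υ => Ready n υ ∧ (∀ a ≤ 13, υ.mem a = σ.mem a) ∧ υ.reg 6 ≤ 1 ∧
          (υ.reg 6 = 1 ↔ σ.reg 6 = 1 ∨ good X)) ?_ fun υ hυ => ?_)
      (post := fun ω => Ready n ω ∧ (∀ a < 13, ω.mem a = m a) ∧
        (∀ l, ω.mem 13 l ≠ 0 → l < n ^ 2 ∧ N l) ∧ ω.reg 6 ≤ 1 ∧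
        (ω.reg 6 = 1 ↔ σ.reg 6 = 1 ∨ good X) ∧ ω.reg 7 ≤ 1 ∧
        value N (fun l => ω.mem 13 l ≠ 0) (n ^ 2) + ω.reg 7 * 2 ^ count N (n ^ 2) =
          value N X (n ^ 2) + 1) fun ω hω => ?_).mono
      (by simp only [Expr.cost]; nlinarith) fun _ h => h
    · obtain ⟨hf, hmτ, hτ⟩ := hτ
      have hτR : Ready n τ := hσ.congr (hf 0 (by omega) (by omega)) (hmτ 3 (by omega))
      have hτ6 := hf 6 (by omega) (by omega)
      refine Terminates.branch (e := .reg 1) (T := 2) (fun he => .assign ⟨?_, hmτ, ?_⟩)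
        fun he => .skip ⟨hτR, hmτ, ?_⟩
      · exact hτR.congr (setReg_reg_of_ne _ _ (by omega)) rfl
      · have hg : good X := by
          rcases hτ with h | h
          · exact h.2
          · exact absurd h.1 he
        simp [Expr.eval, hg]
      · have hg : ¬ good X := by
          rcases hτ with h | h
          · rw [Expr.eval, h.1] at he
            omega
          · exact h.2
        simp [hτ6, h6, hg]
    · obtain ⟨hυR, hmυ, h6υ, h6υ'⟩ := hυ
      refine (terminates_incrementProgram (N := N) hυR.reg (fun l => ?_) (fun l hl => ?_)).mono
        le_rfl ?_
      · rw [hmυ 12 (by omega), hm 12 (by omega), hN]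
      · rw [hmυ 13 le_rfl] at hl
        exact hX l hl
      · rintro ω ⟨hω0, hω6, hω7, hωm, hωX, hωv⟩
        refine ⟨hυR.congr (hω0.trans hυR.reg.symm) (hωm 3 (by omega)), fun a ha => ?_, hωX,
          by rwa [hω6], by rw [hω6, h6υ'], hω7, ?_⟩
        · rw [hωm a (by omega), hmυ a (by omega), hm a ha]
        · rw [hωv, hmυ 13 le_rfl]
    · obtain ⟨hωR, hωm, hωX, hω6, hω6', hω7, hωv⟩ := hω
      have hlt := value_lt N (fun l => ω.mem 13 l ≠ 0) (n ^ 2)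
      rcases Nat.le_one_iff_eq_zero_or_eq_one.1 hω7 with h | h
      · -- no overflow: the counter has been incremented
        rw [h, Nat.zero_mul, Nat.add_zero] at hωv
        refine (ih ω hωR hωm hωX hω6 h (by omega)).mono le_rfl fun τ hτ => hτ.trans ?_
        refine if_congr ?_ rfl rfl
        rw [hω6', hωv, or_assoc]
        refine or_congr_right ⟨?_, ?_⟩
        · rintro (hg | ⟨S, hS, hg, hle⟩)
          · exact ⟨X, hX, hg, le_rfl⟩
          · exact ⟨S, hS, hg, by omega⟩
        · rintro ⟨S, hS, hg, hle⟩
          rcases hle.eq_or_lt with heq | hlt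
          · rw [huniq S hS heq.symm] at hg
            exact .inl hg
          · exact .inr ⟨S, hS, hg, hlt⟩
      · -- overflow: there is no larger guess
        rw [h, Nat.one_mul] at hωv
        refine (Terminates.loop_false (by simp [Expr.eval, h]) ?_).mono (by simp [Expr.cost])
          fun _ h => h
        have hiff : ω.reg 6 = 1 ↔ (σ.reg 6 = 1 ∨ ∃ S : ℕ → Prop, (∀ l, S l → l < n ^ 2 ∧ N l) ∧
            good S ∧ value N X (n ^ 2) ≤ value N S (n ^ 2)) := by
          rw [hω6']
          refine or_congr_right ⟨fun hg => ⟨X, hX, hg, le_rfl⟩, ?_⟩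
          rintro ⟨S, hS, hg, hle⟩
          have := value_lt N S (n ^ 2)
          rwa [huniq S hS (by omega)] at hg
        rw [← if_congr hiff rfl rfl]
        split_ifs with h1
        · exact h1
        · omega

open Classical in
/-- Exhaustive search over the subsets of the relation in memory `12`. -/
theorem exists_program_search (B : Program) {T : ℕ → ℕ} (hT : PolyBounded T) :
    ∃ (P : Program) (T' : ℕ → ℕ), PolyBounded T' ∧ ∀ (n : ℕ) (σ : State)
      (good : (ℕ → Prop) → Prop), Tests B n (T n) σ.mem good → Ready n σ →
      (∀ l, σ.mem 13 l = 0) → Terminates P σ (2 ^ count (fun l => σ.mem 12 l ≠ 0) (n ^ 2) * T' n)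
        fun τ => τ.reg 0 = if ∃ S : ℕ → Prop, (∀ l, S l → l < n ^ 2 ∧ σ.mem 12 l ≠ 0) ∧ good S
          then 1 else 0 := by
  refine ⟨.seq (.assign 6 (.const 0)) (.seq (.assign 7 (.const 0))
    (.seq (searchLoop B) (.assign 0 (.reg 6)))), fun n => roundTime (T n) n + 14, ?_,
    fun n σ good hB hσ h13 => ?_⟩
  · refine PolyBounded.add (hT.add (.add (.const _) (.add (.const _) (.add (.const _) ?_)))) (.const _)
    exact (PolyBounded.const _).loopTime 2
  set N : ℕ → Prop := fun l => σ.mem 12 l ≠ 0 with hN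
  have hpow : 1 ≤ 2 ^ count N (n ^ 2) := Nat.one_le_two_pow
  refine (Terminates.seq (T := 2) (T' := 2 + (2 ^ count N (n ^ 2) * (roundTime (T n) n + 4) + 4 + 2))
    (.assign (post := fun τ => τ = setReg σ 6 0) rfl) ?_).mono (by nlinarith) fun _ h => h
  rintro _ rfl
  refine Terminates.seq (.assign (post := fun τ => τ = setReg (setReg σ 6 0) 7 0) rfl) ?_
  rintro _ rfl
  have hX : (fun l => (setReg (setReg σ 6 0) 7 0).mem 13 l ≠ 0) = fun _ => False := by
    funext l
    simp [h13]
  have h6 : (setReg (setReg σ 6 0) 7 0).reg 6 = 0 := by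
    rw [setReg_reg_of_ne _ _ (by omega), setReg_reg_self]
  refine (terminates_searchLoop hB (N := N) (fun l => Iff.rfl) (2 ^ count N (n ^ 2))
    (setReg (setReg σ 6 0) 7 0) (hσ.congr ?_ rfl) (fun _ _ => rfl) ?_ ?_ ?_ ?_).seq fun τ hτ => .assign ?_
  · rw [setReg_reg_of_ne _ _ (by omega), setReg_reg_of_ne _ _ (by omega)]
  · exact fun l hl => absurd (h13 l) hl
  · omega
  · rw [setReg_reg_self]
  · rw [hX, value_empty]
    omega
  · rw [setReg_reg_self, Expr.eval, hτ, hX, h6, value_empty]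
    simp [hN]

end RAM

/-! ### Steiner Orientation -/

/-- The edge and arc relations of an instance. -/
def SteinerInstance.toMixedRel {V : Type*} (I : SteinerInstance V) : MixedRel V where
  E u v := s(u, v) ∈ I.E
  A u v := (u, v) ∈ I.A
  symm h := by rwa [Sym2.eq_swap]

/-- It suffices to orient the bridges. -/
theorem SteinerInstance.isYes_iff_exists_isOri {V : Type*} [Finite V] (I : SteinerInstance V) :
    I.IsYes ↔ ∃ O, I.toMixedRel.IsOri O ∧
      ∀ s t, (s, t) ∈ I.terminals → ReflTransGen (I.toMixedRel.Step O) s t := by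
  classical
  constructor
  · rintro ⟨o, ho, hT⟩
    refine ⟨fun x y => I.toMixedRel.Bridge x y ∧ o s(x, y) = (x, y), ⟨fun h => h.1, ?_, ?_⟩, ?_⟩
    · rintro x y ⟨hb, h⟩ ⟨-, h'⟩
      rw [Sym2.eq_swap, h] at h'
      obtain rfl : x = y := congrArg Prod.fst h'
      exact hb.2.1 .refl
    · intro x y hb
      have h : s((o s(x, y)).1, (o s(x, y)).2) = s(x, y) := ho _ hb.1
      rcases Sym2.eq_iff.1 h with ⟨h1, h2⟩ | ⟨h1, h2⟩
      · exact .inl ⟨hb, Prod.ext h1 h2⟩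
      · refine .inr ⟨hb.symm, ?_⟩
        rw [Sym2.eq_swap]
        exact Prod.ext h1 h2
    · intro s t hst
      refine ReflTransGen.mono ?_ _ _ (hT (s, t) hst)
      rintro u v (h | ⟨e, he, hoe⟩)
      · exact .inl h
      · have heq := ho e he
        rw [hoe] at heq
        subst heq
        by_cases hb : I.toMixedRel.Bridge u v
        · exact .inr (.inr ⟨hb, hoe⟩)
        · exact .inr (.inl ⟨he, hb⟩)
  · rintro ⟨O, hO, hT⟩
    obtain ⟨D, hDE, hED, hDD, hR⟩ := hO.exists_orientation
    let o : Sym2 V → V × V := fun e =>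
      if h : ∃ p : V × V, s(p.1, p.2) = e ∧ D p.1 p.2 then h.choose else Quot.out e
    have ho : ∀ e ∈ I.E, s((o e).1, (o e).2) = e ∧ D (o e).1 (o e).2 := by
      intro e he
      have h : ∃ p : V × V, s(p.1, p.2) = e ∧ D p.1 p.2 := by
        induction e using Sym2.ind with
        | _ x y =>
          rcases hED x y he with h | h
          · exact ⟨(x, y), rfl, h⟩
          · exact ⟨(y, x), Sym2.eq_swap, h⟩
      simp only [o, dif_pos h]
      exact h.choose_spec
    refine ⟨o, fun e he => (ho e he).1, fun p hp => ?_⟩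
    refine ReflTransGen.mono ?_ _ _ (hR p.1 p.2 (hT p.1 p.2 hp))
    rintro u v (h | h)
    · exact .inl h
    · obtain ⟨h1, h2⟩ := ho _ (hDE u v h)
      refine .inr ⟨s(u, v), hDE u v h, ?_⟩
      rcases Sym2.eq_iff.1 h1 with ⟨h3, h4⟩ | ⟨h3, h4⟩
      · exact Prod.ext h3 h4
      · rw [h3, h4] at h2
        obtain rfl := hDD u v h h2
        exact Prod.ext h3 h4

/-- The instance is a yes-instance if and only if some guess passes the test. -/
theorem SteinerInstance.isYes_iff_exists_accepts {V : Type*} [Finite V] [LinearOrder V]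
    (I : SteinerInstance V) : I.IsYes ↔ ∃ X : V → V → Prop,
      (∀ x y, X x y → I.toMixedRel.Rep x y) ∧
        I.toMixedRel.Accepts (fun s t => (s, t) ∈ I.terminals) X := by
  rw [I.isYes_iff_exists_isOri]
  constructor
  · rintro ⟨O, hO, h⟩
    exact hO.exists_accepts h
  · rintro ⟨X, -, h⟩
    exact h.exists_isOri

/-- Every arc has two ends. -/
theorem SteinerInstance.ncard_end_le {V : Type*} [Finite V] (I : SteinerInstance V) :
    {p | I.toMixedRel.End p}.ncard ≤ 2 * I.A.card := by
  classical
  have hsub : {p | I.toMixedRel.End p} ⊆ ↑(I.A.image Prod.fst ∪ I.A.image Prod.snd) := by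
    rintro p ⟨v, h | h⟩
    · exact Finset.mem_coe.2 (Finset.mem_union_left _ (Finset.mem_image.2 ⟨_, h, rfl⟩))
    · exact Finset.mem_coe.2 (Finset.mem_union_right _ (Finset.mem_image.2 ⟨_, h, rfl⟩))
  have h1 := Set.ncard_le_ncard hsub (Finset.finite_toSet _)
  rw [Set.ncard_coe_finset] at h1
  have h2 := Finset.card_union_le (I.A.image Prod.fst) (I.A.image Prod.snd)
  have h3 := Finset.card_image_le (s := I.A) (f := Prod.fst)
  have h4 := Finset.card_image_le (s := I.A) (f := Prod.snd)
  omega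

namespace RAM

theorem addr_two (n u v : ℕ) : addr n [u, v] = u * n + v := by simp [addr]

theorem addr_two_injective {n : ℕ} {u v a b : Fin n}
    (h : addr n [(u : ℕ), (v : ℕ)] = addr n [(a : ℕ), (b : ℕ)]) : u = a ∧ v = b := by
  have h1 := addr_injective (xs := [(u : ℕ), (v : ℕ)]) (ys := [(a : ℕ), (b : ℕ)]) rfl
    (isTuple_two u v).2 (isTuple_two a b).2 h
  simp only [List.cons.injEq, and_true] at h1
  exact ⟨Fin.ext h1.1, Fin.ext h1.2⟩

theorem mem_adjacency {n : ℕ} (S : Finset (Fin n × Fin n)) (u v : Fin n) :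
    adjacency S (addr n [(u : ℕ), (v : ℕ)]) ≠ 0 ↔ (u, v) ∈ S := by
  rw [adjacency]
  constructor
  · intro h
    have h : ∃ p ∈ S, addr n [(u : ℕ), (v : ℕ)] = (p.1 : ℕ) * n + (p.2 : ℕ) := by
      by_contra hne
      exact h (if_neg hne)
    obtain ⟨p, hp, heq⟩ := h
    rw [← addr_two] at heq
    obtain ⟨h1, h2⟩ := addr_two_injective heq
    rwa [h1, h2]
  · intro h
    rw [if_pos ⟨(u, v), h, addr_two _ _ _⟩]
    exact one_ne_zero

theorem Represents.congr {n : ℕ} {G : MixedRel (Fin n)} {m m' : ℕ → ℕ → ℕ} (h : Represents G m)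
    (hm : ∀ a < 13, m' a = m a) : Represents G m' := by
  constructor <;> intros <;> rw [mem_congr (hm _ (by omega))]
  exacts [h.edge _ _, h.arc _ _, h.conn _ _ _ _, h.comp _ _, h.bridge _ _, h.dir _ _ _ _,
    h.isEnd _, h.par _ _ _ _, h.sep _ _, h.rep _ _]

/-- The number of binary digits of a guess is at most the number of parallel classes. -/
theorem count_le_ncard {n : ℕ} {N : ℕ → Prop} {R : Fin n → Fin n → Prop}
    (h : ∀ x y : Fin n, N (addr n [(x : ℕ), (y : ℕ)]) ↔ R x y) :
    count N (n ^ 2) ≤ {e : Fin n × Fin n | R e.1 e.2}.ncard := by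
  classical
  have hcount : ∀ a, count N a = ((Finset.range a).filter N).card := by
    intro a
    induction a with
    | zero => rfl
    | succ a ih =>
      rw [count, ih, Finset.range_add_one, Finset.filter_insert]
      split_ifs <;> simp
  rw [hcount, Set.ncard_eq_toFinset_card']
  refine (Finset.card_le_card fun i hi => ?_).trans
    (Finset.card_image_le (f := fun e : Fin n × Fin n => addr n [(e.1 : ℕ), (e.2 : ℕ)]))
  rw [Finset.mem_filter, Finset.mem_range, sq] at hi
  have hn : 0 < n := Nat.pos_of_ne_zero fun h0 => by
    subst h0
    exact absurd hi.1 (by simp)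
  have heq : addr n [i / n, i % n] = i := by rw [addr_two, mul_comm, Nat.div_add_mod]
  refine Finset.mem_image.2 ⟨(⟨i / n, Nat.div_lt_of_lt_mul hi.1⟩, ⟨i % n, Nat.mod_lt _ hn⟩), ?_, heq⟩
  simp only [Set.mem_toFinset, Set.mem_ofPred_eq]
  rw [← h]
  exact heq.symm ▸ hi.2

/-- The test of a guess takes polynomial time. -/
theorem exists_program_tests : ∃ (B : Program) (T : ℕ → ℕ), PolyBounded T ∧
    ∀ (n : ℕ) (G : MixedRel (Fin n)) (D : Fin n → Fin n → Prop) (m : ℕ → ℕ → ℕ),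
      Represents G m → (∀ x y : Fin n, Mem n m 2 [(x : ℕ), (y : ℕ)] ↔ D x y) →
      Tests B n (T n) m fun S => G.Accepts D fun x y => S (addr n [(x : ℕ), (y : ℕ)]) := by
  obtain ⟨P, T, hT, hP⟩ := exists_program_definitions guessDefinitions (by omega)
    guessDefinitions_wf
  obtain ⟨P', T', hT', hP'⟩ := exists_program_formula acceptFormula acceptFormula_wf
  refine ⟨.seq P P', fun n => T n + T' n, hT.add hT', fun n G D m hG hD σ hσ hm => ?_⟩
  refine (hP n σ hσ).seq fun τ ⟨hf, hmτ, hh⟩ => ?_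
  refine (hP' n τ (hσ.congr (hf 0 (by omega) (by omega)) (hmτ 3 (by omega))) (by simp)).mono le_rfl
    fun υ ⟨hmυ, hr, h1⟩ => ⟨fun i hi hi' => (hr i hi (by omega)).trans (hf i hi hi'),
      fun a ha => by rw [hmυ, hmτ a (by omega)], ?_⟩
  have hτ : ∀ a < 13, τ.mem a = m a := fun a ha => (hmτ a (by omega)).trans (hm a ha)
  have hsat := sat_acceptFormula_iff (X := fun x y => σ.mem 13 (addr n [(x : ℕ), (y : ℕ)]) ≠ 0)
    (hG.congr hτ) (fun x y => by rw [mem_congr (hτ 2 (by omega)), hD])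
    (fun x y => mem_congr (hmτ 13 (by omega)) _) hh (vars τ)
  rw [h1]
  by_cases hs : acceptFormula.Sat n τ.mem (vars τ)
  · exact .inl ⟨if_pos hs, hsat.1 hs⟩
  · exact .inr ⟨if_neg hs, fun h => hs (hsat.2 h)⟩

end RAM

theorem theorem6 :
    ∃ (P : RAM.Program) (C c d : ℕ), ∀ (n : ℕ) (I : SteinerInstance (Fin n)),
      RAM.SolvesWithin P I (C * 2 ^ (c * I.A.card) * (n + 1) ^ d) := by
  classical
  obtain ⟨P₁, T₁, hT₁, hP₁⟩ := RAM.exists_program_table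
  obtain ⟨P₂, T₂, hT₂, hP₂⟩ := RAM.exists_program_definitions RAM.graphDefinitions (by omega)
    RAM.graphDefinitions_wf
  obtain ⟨B, T, hT, hB⟩ := RAM.exists_program_tests
  obtain ⟨P₃, T₃, hT₃, hP₃⟩ := RAM.exists_program_search B hT
  obtain ⟨C, d, hC⟩ := hT₁.add (hT₂.add hT₃)
  refine ⟨.seq P₁ (.seq P₂ P₃), C, 8, d, fun n I => ?_⟩
  set G := I.toMixedRel with hG
  have main : RAM.Terminates (.seq P₁ (.seq P₂ P₃)) (RAM.input I)
      (T₁ n + (T₂ n + 2 ^ (8 * I.A.card) * T₃ n)) fun τ => τ.reg 0 = if I.IsYes then 1 else 0 := by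
    refine (hP₁ n (RAM.input I) (by simp [RAM.input])).seq fun σ ⟨hσ, hσm⟩ => ?_
    refine (hP₂ n σ hσ).seq fun τ ⟨hτf, hτm, hτh⟩ => ?_
    have hmem : ∀ a, a ≠ 3 → (a < 4 ∨ 13 ≤ a) → τ.mem a = (RAM.input I).mem a := fun a ha ha' =>
      (hτm a ha').trans (hσm a ha)
    have hrep : RAM.Represents G τ.mem := by
      refine RAM.represents_of_holds (fun x y => ?_) (fun x y => ?_) hτh
      · rw [RAM.mem_congr (hmem 0 (by omega) (by omega))]
        exact (RAM.mem_adjacency _ x y).trans (by simp [hG, SteinerInstance.toMixedRel])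
      · rw [RAM.mem_congr (hmem 1 (by omega) (by omega))]
        exact RAM.mem_adjacency _ x y
    have hter : ∀ x y : Fin n, RAM.Mem n τ.mem 2 [(x : ℕ), (y : ℕ)] ↔ (x, y) ∈ I.terminals := by
      intro x y
      rw [RAM.mem_congr (hmem 2 (by omega) (by omega))]
      exact RAM.mem_adjacency _ x y
    have hτ : RAM.Ready n τ := hσ.congr (hτf 0 (by omega) (by omega)) (hτm 3 (by omega))
    refine (hP₃ n τ _ (hB n G _ τ.mem hrep hter) hτ fun l => ?_).mono ?_ fun υ hυ => hυ.trans ?_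
    · rw [hmem 13 (by omega) (by omega)]
      rfl
    · refine Nat.mul_le_mul_right _ (Nat.pow_le_pow_right (by omega) ?_)
      have h1 := RAM.count_le_ncard (N := fun l => τ.mem 12 l ≠ 0) hrep.rep
      have h2 := G.ncard_rep_le
      have h3 : {p | G.End p}.ncard ≤ 2 * I.A.card := I.ncard_end_le
      omega
    · refine if_congr ?_ rfl rfl
      rw [I.isYes_iff_exists_accepts]
      constructor
      · rintro ⟨S, hS, hacc⟩
        exact ⟨_, fun x y h => (hrep.rep x y).1 (hS _ h).2, hacc⟩
      · rintro ⟨X, hX, hacc⟩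
        refine ⟨fun l => ∃ x y : Fin n, l = RAM.addr n [(x : ℕ), (y : ℕ)] ∧ X x y, ?_, ?_⟩
        · rintro l ⟨x, y, rfl, h⟩
          exact ⟨RAM.addr_lt _ (RAM.isTuple_two x y).2, (hrep.rep x y).2 (hX x y h)⟩
        · convert hacc using 3 with x y
          constructor
          · rintro ⟨a, b, heq, h⟩
            obtain ⟨rfl, rfl⟩ := RAM.addr_two_injective heq
            exact h
          · exact fun h => ⟨x, y, rfl, h⟩
  obtain ⟨t, τ, hr, ht, hτ⟩ := main
  refine ⟨t, τ, hr, ht.trans ?_, fun h => by rw [hτ, if_pos h], fun h => by rw [hτ, if_neg h]⟩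
  have hpow : 1 ≤ 2 ^ (8 * I.A.card) := Nat.one_le_two_pow
  calc T₁ n + (T₂ n + 2 ^ (8 * I.A.card) * T₃ n)
      ≤ 2 ^ (8 * I.A.card) * (T₁ n + (T₂ n + T₃ n)) := by nlinarith
    _ ≤ 2 ^ (8 * I.A.card) * (C * (n + 1) ^ d) := Nat.mul_le_mul_left _ (hC n)
    _ = C * 2 ^ (8 * I.A.card) * (n + 1) ^ d := by ring
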